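/- **Setting.** Let $k\ge 2$ be an integer, $\Omega=[0,2\pi]$, $T>0$, and let $u$ be a classical solution of $u_t=u_{xx}$ on $\Omega\times(0,T]$, continuous on $\Omega\times[0,T]$, with $u(\cdot,0)=u_0$ and $q=u_x$. For $t\in[0,T]$, one of the following boundary conditions holds: (P) periodic, $u(0,t)=u(2\pi,t)$ and $q(0,t)=q(2\pi,t)$; (M1) $u(0,t)=g_0(t)$, $q(2\pi,t)=g_1(t)$; (M2) $q(0,t)=g_0(t)$, $u(2\pi,t)=g_1(t)$. Assume $\|u\|_{k+4,\infty}:=\sup_{0\le t\le T}\|u(\cdot,t)\|_{W^{k+4,\infty}(\Omega)}<\infty$. Let $0=x_{1/2}<x_{3/2}<\dots<x_{N+1/2}=2\pi$, $N\ge1$, be a mesh with cells $\tau_j=(x_{j-1/2},x_{j+1/2})$, lengths $h_j$, $\bar h_j=h_j/2$, $h=\max_j h_j$, and $h\le c\,h_j$ for all $j$. Let $V_h$ be the space of functions that are polynomials of degree at most $k$ on each cell, $v^\pm$ the right/left limits at the nodes, and $(f,g)_j=\int_{\tau_j}fg\,dx$. The LDG solution $u_h(\cdot,t),q_h(\cdot,t)\in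 V_h$, $t\in[0,T]$, with $u_h$ differentiable in $t$, satisfies for all $v,w\in V_h$ and all $j$ $$(u_{ht},v)_j=-(q_h,v_x)_j+\hat q_hv^-|_{j+1/2}-\hat q_hv^+|_{j-1/2},\qquad (q_h,w)_j=-(u_h,w_x)_j+\hat u_hw^-|_{j+1/2}-\hat u_hw^+|_{j-1/2},$$ with fluxes (flux1) $\hat u_h=u_h^-$, $\hat q_h=q_h^+$, or (flux2) $\hat u_h=u_h^+$, $\hat q_h=q_h^-$. At $x_{1/2}$ and $x_{N+1/2}$ a one-sided limit from outside $\Omega$ is taken from the periodic extension in case (P), and is replaced by the corresponding boundary datum in the mixed cases. Both fluxes are allowed with (P); (M1) is used with (flux1), and (M2) with (flux2). On $\tau_j$ let $L_{j,m}$ be the Legendre polynomial of degree $m$ transplanted to $\tau_j$ (value $1$ at $x_{j+1/2}$), and $D_s^{-1}v(x)=\bar h_j^{-1}\int_{x_{j-1/2}}^xv$. Let $P_h^-v$ (resp. $P_h^+v$) be the polynomial of degree at most $k$ with the same moments as $v$ against polynomials of degree at most $k-1$ on $\tau_j$ and the same value as $v$ at $x_{j+1/2}$ (resp. $x_{j-1/2}$).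 Put $$\bar v_{j,k}=-v(x_{j+1/2})+\tfrac1{h_j}\int_{\tau_j}v\sum_{m=0}^k(2m+1)L_{j,m}\,dx,$$ $$\tilde v_{j,k}=(-1)^{k+1}v(x_{j-1/2})+\tfrac1{h_j}\int_{\tau_j}v\sum_{m=0}^k(-1)^{k+m}(2m+1)L_{j,m}\,dx,$$ $F_1=P_h^+D_s^{-1}L_{j,k}$, $F_2=P_h^-D_s^{-1}L_{j,k}$, $\bar F_1=P_h^-D_s^{-1}F_1$, $\bar F_2=P_h^+D_s^{-1}F_2$. Assume that the initial value is $u_h(\cdot,0)=u_I^2(\cdot,0)$, where on $\tau_j$ $$u_I^2=P_h^-u-\bar h_j^2\,\partial_t\bar u_{j,k}\,\bar F_1-\bar h_j\,\tilde q_{j,k}\,F_2\quad\text{for (flux1)},\qquad u_I^2=P_h^+u-\bar h_j\,\bar q_{j,k}\,F_1-\bar h_j^2\,\partial_t\tilde u_{j,k}\,\bar F_2\quad\text{for (flux2)}.$$ Let $R^r_{j,m}$ (resp. $R^l_{j,m}$), $1\le m\le k$, be the interior right (resp. left) Radau points of $\tau_j$: the zeros of $L_{j,k+1}-L_{j,k}$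 other than $x_{j+1/2}$ (resp. of $L_{j,k+1}+L_{j,k}$ other than $x_{j-1/2}$). **Theorem.** There is a constant $C$, depending only on $k$ and $c$, such that for all $t\in[0,T]$: for (flux1), $$\max_{j,m}|(u-u_h)(R^r_{j,m},t)|\le C(1+t\sqrt h)\,h^{k+2}\|u\|_{k+4,\infty},\qquad \max_{j,m}|(q-q_h)(R^l_{j,m},t)|\le C(1+\sqrt{th})\,h^{k+2}\|u\|_{k+4,\infty};$$ and for (flux2), $$\max_{j,m}|(u-u_h)(R^l_{j,m},t)|\le C(1+t\sqrt h)\,h^{k+2}\|u\|_{k+4,\infty},\qquad \max_{j,m}|(q-q_h)(R^r_{j,m},t)|\le C(1+\sqrt{th})\,h^{k+2}\|u\|_{k+4,\infty}.$$ -/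

import Mathlib

open scoped ContDiff

noncomputable section

namespace LDG

/-- The spatial domain `Ω = [0, 2π]`. -/
def Omega : Set ℝ := Set.Icc 0 (2 * Real.pi)

/-! ### Sobolev spaces `W^{m,∞}(0, 2π)` -/

/-- `g` is an `i`-th weak derivative of `f` on `(0, 2π)`. -/
def HasWeakDeriv (i : ℕ) (f g : ℝ → ℝ) : Prop :=
  MeasureTheory.LocallyIntegrableOn f (Set.Ioo 0 (2 * Real.pi)) ∧
  MeasureTheory.LocallyIntegrableOn g (Set.Ioo 0 (2 * Real.pi)) ∧
  ∀ φ : ℝ → ℝ, ContDiff ℝ ∞ φ → HasCompactSupport φ → tsupport φ ⊆ Set.Ioo 0 (2 * Real.pi) →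
    ∫ x in Set.Ioo 0 (2 * Real.pi), f x * iteratedDeriv i φ x =
      (-1) ^ i * ∫ x in Set.Ioo 0 (2 * Real.pi), g x * φ x

/-- The norm `‖f‖_{m,∞} = max_{i ≤ m} ‖∂ⁱf‖_{L^∞(0,2π)}` with weak derivatives; it is `∞` when `f`
is not in `W^{m,∞}(0, 2π)`. (The infimum runs over the almost everywhere equal versions of the
`i`-th weak derivative, and is `∞` if there is none.) -/
def sobolevNorm (m : ℕ) (f : ℝ → ℝ) : ENNReal :=
  ⨆ i ∈ Finset.range (m + 1), ⨅ g : ℝ → ℝ, ⨅ _ : HasWeakDeriv i f g,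
    MeasureTheory.eLpNorm g ⊤ (MeasureTheory.volume.restrict (Set.Ioo 0 (2 * Real.pi)))

/-- `sup_{0 ≤ t ≤ T} ‖u(·,t)‖_{m,∞}`; time is the first argument of `u`. -/
def supSobolevNorm (m : ℕ) (T : ℝ) (u : ℝ → ℝ → ℝ) : ENNReal :=
  ⨆ t ∈ Set.Icc 0 T, sobolevNorm m (u t)

/-! ### The exact solution -/

/-- The two choices of alternating numerical fluxes: `minusPlus` is `û = u⁻, q̂ = q⁺`,
and `plusMinus` is `û = u⁺, q̂ = q⁻`. -/
inductive Flux where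
  | minusPlus
  | plusMinus

/-- Boundary conditions: periodic, or mixed with the data `g₀` at `x = 0` and `g₁` at `x = 2π`. -/
inductive Boundary where
  | periodic
  | mixed (g₀ g₁ : ℝ → ℝ)

/-- The auxiliary variable `q = u_x` (one-sided derivatives at the end points of `Ω`). -/
def qOf (u : ℝ → ℝ → ℝ) (t x : ℝ) : ℝ := derivWithin (u t) Omega x

/-- The boundary conditions of the exact solution. In the mixed case the type of the condition goes
with the flux: `u(0,t) = g₀(t), u_x(2π,t) = g₁(t)` for `minusPlus`, and
`u_x(0,t) = g₀(t), u(2π,t) = g₁(t)` for `plusMinus`. -/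
def BoundaryCondition (fl : Flux) (bc : Boundary) (T : ℝ) (u : ℝ → ℝ → ℝ) : Prop :=
  match bc, fl with
  | .periodic, _ =>
      ∀ t ∈ Set.Icc 0 T, u t 0 = u t (2 * Real.pi) ∧ qOf u t 0 = qOf u t (2 * Real.pi)
  | .mixed g₀ g₁, .minusPlus => ∀ t ∈ Set.Icc 0 T, u t 0 = g₀ t ∧ qOf u t (2 * Real.pi) = g₁ t
  | .mixed g₀ g₁, .plusMinus => ∀ t ∈ Set.Icc 0 T, qOf u t 0 = g₀ t ∧ u t (2 * Real.pi) = g₁ t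

/-- `u` (time first) is a classical solution of `u_t = u_xx` on `[0,2π] × (0,T]` with initial value
`u₀` and the given boundary conditions. -/
structure IsHeatSolution (fl : Flux) (bc : Boundary) (T : ℝ) (u₀ : ℝ → ℝ) (u : ℝ → ℝ → ℝ) :
    Prop where
  continuousOn : ContinuousOn (Function.uncurry u) (Set.Icc 0 T ×ˢ Omega)
  contDiffOn : ∀ t ∈ Set.Icc 0 T, ContDiffOn ℝ 2 (u t) Omega
  equation : ∀ t ∈ Set.Ioc 0 T, ∀ x ∈ Omega,
    HasDerivWithinAt (fun s => u s x) (iteratedDerivWithin 2 (u t) Omega x) (Set.Icc 0 T) t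
  initial : ∀ x ∈ Omega, u 0 x = u₀ x
  boundary : BoundaryCondition fl bc T u

/-! ### Meshes -/

/-- A mesh `0 = x_{1/2} < x_{3/2} < … < x_{N+1/2} = 2π`. The node `x_{j+1/2}` is `node j`, for
`0 ≤ j ≤ N`; the cells are `(node j, node (j+1))` for `0 ≤ j < N`. -/
structure Mesh where
  N : ℕ
  N_pos : 0 < N
  node : ℕ → ℝ
  node_zero : node 0 = 0
  node_last : node N = 2 * Real.pi
  node_lt : ∀ j < N, node j < node (j + 1)

/-- Length of the cell `j`. -/
def Mesh.len (M : Mesh) (j : ℕ) : ℝ := M.node (j + 1) - M.node j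

/-- The mesh size `h`, the largest length of a cell. -/
def Mesh.h (M : Mesh) : ℝ := ⨆ j : Fin M.N, M.len j

/-- Quasi-uniformity with constant `c`. -/
def Mesh.QuasiUniform (M : Mesh) (c : ℝ) : Prop := ∀ j < M.N, M.h ≤ c * M.len j

/-! ### The LDG scheme

An element of the finite element space `V_h` is given by its polynomial `v j` on each cell `j`. -/

/-- Membership in `V_h`: degree at most `k` on every cell. -/
def InVh (M : Mesh) (k : ℕ) (v : ℕ → Polynomial ℝ) : Prop := ∀ j < M.N, (v j).natDegree ≤ k

/-- Left limit of a piecewise polynomial at the node `i`, with the prescribed value `b` at `i = 0`.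
-/
def leftTrace (M : Mesh) (b : ℝ) (v : ℕ → Polynomial ℝ) (i : ℕ) : ℝ :=
  if i = 0 then b else (v (i - 1)).eval (M.node i)

/-- Right limit of a piecewise polynomial at the node `i`, with the prescribed value `b` at `i = N`.
-/
def rightTrace (M : Mesh) (b : ℝ) (v : ℕ → Polynomial ℝ) (i : ℕ) : ℝ :=
  if i = M.N then b else (v i).eval (M.node i)

/-- Value of `v⁻` at the last node, hence of `v⁻` at the node `0` by periodicity. -/
def lastValue (M : Mesh) (v : ℕ → Polynomial ℝ) : ℝ := (v (M.N - 1)).eval (M.node M.N)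

/-- Value of `v⁺` at the node `0`, hence of `v⁺` at the last node by periodicity. -/
def firstValue (M : Mesh) (v : ℕ → Polynomial ℝ) : ℝ := (v 0).eval (M.node 0)

/-- The numerical flux `û_h` at the node `i` and time `t`. -/
def uFlux (fl : Flux) (bc : Boundary) (M : Mesh) (t : ℝ) (v : ℕ → Polynomial ℝ) (i : ℕ) : ℝ :=
  match fl, bc with
  | .minusPlus, .periodic => leftTrace M (lastValue M v) v i
  | .minusPlus, .mixed g₀ _ => leftTrace M (g₀ t) v i
  | .plusMinus, .periodic => rightTrace M (firstValue M v) v i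
  | .plusMinus, .mixed _ g₁ => rightTrace M (g₁ t) v i

/-- The numerical flux `q̂_h` at the node `i` and time `t`. -/
def qFlux (fl : Flux) (bc : Boundary) (M : Mesh) (t : ℝ) (v : ℕ → Polynomial ℝ) (i : ℕ) : ℝ :=
  match fl, bc with
  | .minusPlus, .periodic => rightTrace M (firstValue M v) v i
  | .minusPlus, .mixed _ g₁ => rightTrace M (g₁ t) v i
  | .plusMinus, .periodic => leftTrace M (lastValue M v) v i
  | .plusMinus, .mixed g₀ _ => leftTrace M (g₀ t) v i

/-- `(uh, qh)` solves the semi-discrete LDG scheme on `[0,T]` with polynomials of degree `k`. -/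
structure IsLDGSolution (fl : Flux) (bc : Boundary) (M : Mesh) (k : ℕ) (T : ℝ)
    (uh qh : ℝ → ℕ → Polynomial ℝ) : Prop where
  u_mem : ∀ t ∈ Set.Icc 0 T, InVh M k (uh t)
  q_mem : ∀ t ∈ Set.Icc 0 T, InVh M k (qh t)
  differentiable : ∀ j < M.N, ∀ n, DifferentiableOn ℝ (fun t => (uh t j).coeff n) (Set.Icc 0 T)
  u_eq : ∀ t ∈ Set.Icc 0 T, ∀ j < M.N, ∀ v : Polynomial ℝ, v.natDegree ≤ k →
    ∫ x in M.node j..M.node (j + 1),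
        derivWithin (fun s => (uh s j).eval x) (Set.Icc 0 T) t * v.eval x =
      -(∫ x in M.node j..M.node (j + 1), (qh t j).eval x * v.derivative.eval x)
        + qFlux fl bc M t (qh t) (j + 1) * v.eval (M.node (j + 1))
        - qFlux fl bc M t (qh t) j * v.eval (M.node j)
  q_eq : ∀ t ∈ Set.Icc 0 T, ∀ j < M.N, ∀ w : Polynomial ℝ, w.natDegree ≤ k →
    ∫ x in M.node j..M.node (j + 1), (qh t j).eval x * w.eval x =
      -(∫ x in M.node j..M.node (j + 1), (uh t j).eval x * w.derivative.eval x)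
        + uFlux fl bc M t (uh t) (j + 1) * w.eval (M.node (j + 1))
        - uFlux fl bc M t (uh t) j * w.eval (M.node j)

/-! ### Legendre polynomials, Radau points, Gauss–Radau projections -/

/-- The Legendre polynomial `P_m((2x - a - b)/(b - a))` of the cell `(a,b)`, with value `1` at `b`.
Mathlib's `shiftedLegendre m` at `y` is `P_m(1 - 2y)`. -/
def legendre (a b : ℝ) (m : ℕ) (x : ℝ) : ℝ :=
  Polynomial.aeval ((b - x) / (b - a)) (Polynomial.shiftedLegendre m)

/-- Interior right Radau points of the cell `(a,b)`: zeros of `L_{k+1} - L_k` other than `b`. -/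
def rightRadau (k : ℕ) (a b : ℝ) : Set ℝ :=
  {x | x ∈ Set.Icc a b ∧ legendre a b (k + 1) x - legendre a b k x = 0 ∧ x ≠ b}

/-- Interior left Radau points of the cell `(a,b)`: zeros of `L_{k+1} + L_k` other than `a`. -/
def leftRadau (k : ℕ) (a b : ℝ) : Set ℝ :=
  {x | x ∈ Set.Icc a b ∧ legendre a b (k + 1) x + legendre a b k x = 0 ∧ x ≠ a}

/-- `p` has degree at most `k`, the same moments on `(a,b)` as `v` against polynomials of degree at
most `k - 1`, and the same value as `v` at `e`. -/
def IsGaussRadau (k : ℕ) (a b e : ℝ) (v : ℝ → ℝ) (p : Polynomial ℝ) : Prop :=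
  p.natDegree ≤ k ∧
  (∀ w : Polynomial ℝ, w.natDegree < k →
    ∫ x in a..b, p.eval x * w.eval x = ∫ x in a..b, v x * w.eval x) ∧
  p.eval e = v e

/-- The polynomial with the properties `IsGaussRadau k a b e v`; for `a < b`, `v`
integrable on `(a,b)` and `e = a` or `e = b` there is exactly one. -/
def gaussRadau (k : ℕ) (a b e : ℝ) (v : ℝ → ℝ) : Polynomial ℝ :=
  Classical.epsilon (IsGaussRadau k a b e v)

/-- The Gauss–Radau projection `P_h^-` on the cell `(a,b)`. -/
def projMinus (k : ℕ) (a b : ℝ) (v : ℝ → ℝ) : Polynomial ℝ := gaussRadau k a b b v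

/-- The Gauss–Radau projection `P_h^+` on the cell `(a,b)`. -/
def projPlus (k : ℕ) (a b : ℝ) (v : ℝ → ℝ) : Polynomial ℝ := gaussRadau k a b a v

/-- The integral operator `D_s^{-1} v (x) = (1 / h̄) ∫_a^x v` on the cell `(a,b)`, `h̄ = (b-a)/2`. -/
def integralOp (a b : ℝ) (v : ℝ → ℝ) (x : ℝ) : ℝ := 1 / ((b - a) / 2) * ∫ y in a..x, v y

/-- The Legendre coefficient of index `k` of `v - P_h^- v`:
`- v(b) + (1/(b-a)) ∫ v ∑_{m ≤ k} (2m+1) L_m`. -/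
def coeffMinus (k : ℕ) (a b : ℝ) (v : ℝ → ℝ) : ℝ :=
  -v b + 1 / (b - a) * ∫ x in a..b, v x *
    ∑ m ∈ Finset.range (k + 1), (2 * (m : ℝ) + 1) * legendre a b m x

/-- The Legendre coefficient of index `k` of `v - P_h^+ v`:
`(-1)^{k+1} v(a) + (1/(b-a)) ∫ v ∑_{m ≤ k} (-1)^{k+m} (2m+1) L_m`. -/
def coeffPlus (k : ℕ) (a b : ℝ) (v : ℝ → ℝ) : ℝ :=
  (-1) ^ (k + 1) * v a + 1 / (b - a) * ∫ x in a..b, v x *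
    ∑ m ∈ Finset.range (k + 1), (-1) ^ (k + m) * (2 * (m : ℝ) + 1) * legendre a b m x

/-! ### The special initial interpolant `u_I^2` -/

/-- `F_{1,1} = P_h^+ D_s^{-1} L_k`. -/
def F1 (k : ℕ) (a b : ℝ) : Polynomial ℝ := projPlus k a b (integralOp a b (legendre a b k))

/-- `F_{2,1} = P_h^- D_s^{-1} L_k`. -/
def F2 (k : ℕ) (a b : ℝ) : Polynomial ℝ := projMinus k a b (integralOp a b (legendre a b k))

/-- `F̄_{1,1} = P_h^- D_s^{-1} F_{1,1}`. -/
def F1bar (k : ℕ) (a b : ℝ) : Polynomial ℝ :=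
  projMinus k a b (integralOp a b fun x => (F1 k a b).eval x)

/-- `F̄_{2,1} = P_h^+ D_s^{-1} F_{2,1}`. -/
def F2bar (k : ℕ) (a b : ℝ) : Polynomial ℝ :=
  projPlus k a b (integralOp a b fun x => (F2 k a b).eval x)

/-- The interpolant `u_I^2(·,t) = P_h^∓ u - W_2` on the cell `(a,b)`, where
`W_2 = h̄² G₁ F̄_{1,1} + h̄ Q₀ F_{2,1}` for `minusPlus` and
`W_2 = h̄ Q₀ F_{1,1} + h̄² G₁ F̄_{2,1}` for `plusMinus`, with `h̄ = (b-a)/2`. Here `G₁` is the time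
derivative of the Legendre coefficient of index `k` of the projection error of `u`, and `Q₀` is the
corresponding coefficient of `q = u_x` for the opposite projection. -/
def interpCell (fl : Flux) (k : ℕ) (T : ℝ) (u : ℝ → ℝ → ℝ) (t a b : ℝ) : Polynomial ℝ :=
  match fl with
  | .minusPlus =>
      projMinus k a b (u t) -
        (Polynomial.C (((b - a) / 2) ^ 2 *
            derivWithin (fun s => coeffMinus k a b (u s)) (Set.Icc 0 T) t) * F1bar k a b +
          Polynomial.C ((b - a) / 2 * coeffPlus k a b (qOf u t)) * F2 k a b)
  | .plusMinus =>
      projPlus k a b (u t) -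
        (Polynomial.C ((b - a) / 2 * coeffMinus k a b (qOf u t)) * F1 k a b +
          Polynomial.C (((b - a) / 2) ^ 2 *
            derivWithin (fun s => coeffPlus k a b (u s)) (Set.Icc 0 T) t) * F2bar k a b)

/-- The initial discretization `u_h(·,0) = u_I^2(·,0)`. -/
def SpecialInitial (fl : Flux) (M : Mesh) (k : ℕ) (T : ℝ) (u : ℝ → ℝ → ℝ)
    (uh : ℝ → ℕ → Polynomial ℝ) : Prop :=
  ∀ j < M.N, uh 0 j = interpCell fl k T u 0 (M.node j) (M.node (j + 1))

end LDG

end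

/-! Let u_I be the corrected Gauss–Radau interpolant of u, q_I the analogous interpolant of q = u_x
built at the opposite end of each cell, ξ = u_h − u_I and η = q_h − q_I. At a Radau point the plain
projection errs by O(h^{k+2}) instead of O(h^{k+1}), and the corrections are themselves O(h^{k+2})
(`abs_sub_interp_le`). It remains to bound ξ and η in the maximum norm.

The projection error acts on polynomials of degree at most k only through its coefficient of L_k
(`mom_sub_polyInt_gaussRadau`). Integration by parts turns this defect in one equation into a term
that a correction in the other variable absorbs, so that two corrections leave only a residual
(`polyInt_interp_mul`). The corrections vanish at the end of the cell that feeds the flux; hence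
fluxes and boundary data contribute nothing. Let D represent the discrete derivative of u in L². The
alternating fluxes make the other discrete derivative −D† (`sum_qForm_eq`), and the errors solve η =
Dξ + r, ξ' = −D†η + ρ', ξ(0) = 0 (`exists_parabolicData`). Here r and ρ have size ε ~ h^{k+3}, while
ρ' has only size ε/h, because the available regularity runs out.

Bounding ρ' by its size over the whole time interval would lose too much. Instead ξ(t) is tested
with a backward solution z of z' = −D†Dz. On the last stretch of length h the source contributes ε/h
· h = ε. Before that, integration by parts in time replaces ρ' by ρ paired with D†Dz(τ), which
decays like 1/τ and integrates to a logarithm. This gives ‖ξ‖ ≲ ε(h^{-1/2} + t)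
(`ParabolicData.norm_xi_le`), and with data D†ψ also ‖η‖ ≲ ε(h^{-1/2} + √t)
(`ParabolicData.norm_eta_le`). The smoothing bounds come from one Lyapunov functional
(`IsFlow.norm_sq_add_le`), with constants that do not depend on D, hence not on the mesh. The
inverse inequality between L² and the maximum norm costs a last h^{-1/2}, and h^{-1/2} ·
h^{k+3}(h^{-1/2} + s) = h^{k+2}(1 + s√h) is the claim with s = t and s = √t.

The argument needs ∂_t of all space derivatives of u that occur, up to t = 0; `exists_heatChain`
extracts this from the Sobolev bound and the equation. -/

namespace LDG

open Set Filter Topology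

/-! ### Smoothing estimates for an abstract parabolic flow. -/

section Flow

variable {E F : Type*} [NormedAddCommGroup E] [InnerProductSpace ℝ E] [CompleteSpace E]
  [NormedAddCommGroup F] [InnerProductSpace ℝ F] [CompleteSpace F]

open ContinuousLinearMap (adjoint)

/-- `w` solves the abstract parabolic equation `w' = -D D† w`. -/
def IsFlow (D : E →L[ℝ] F) (w : ℝ → F) : Prop :=
  ∀ τ, HasDerivAt w (-(D (adjoint D (w τ)))) τ

theorem exists_isFlow (D : E →L[ℝ] F) (ψ : F) : ∃ w, IsFlow D w ∧ w 0 = ψ := by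
  refine ⟨fun τ => NormedSpace.exp (τ • (-(D ∘L adjoint D))) ψ, fun τ => ?_, ?_⟩
  · have h := hasDerivAt_exp_smul_const' (𝕂 := ℝ) (-(D ∘L adjoint D)) τ
    have h2 := h.clm_apply (hasDerivAt_const τ ψ)
    simpa using h2
  · simp

/-- Exchanging the roles of D and D† allows the smoothing estimate to be iterated, gaining one
further operator each time. -/
theorem IsFlow.adjoint_comp {D : E →L[ℝ] F} {w : ℝ → F} (hw : IsFlow D w) :
    IsFlow (adjoint D) (fun τ => adjoint D (w τ)) := by
  intro τ
  simpa [Function.comp_def] using (adjoint D).hasFDerivAt.comp_hasDerivAt τ (hw τ)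

theorem IsFlow.shift {D : E →L[ℝ] F} {w : ℝ → F} (hw : IsFlow D w) (s : ℝ) :
    IsFlow D (fun τ => w (τ + s)) := by
  intro τ
  exact (hw (τ + s)).comp_add_const τ s

theorem IsFlow.hasDerivAt_norm_sq {D : E →L[ℝ] F} {w : ℝ → F} (hw : IsFlow D w) (τ : ℝ) :
    HasDerivAt (fun τ => ‖w τ‖ ^ 2) (-2 * ‖adjoint D (w τ)‖ ^ 2) τ := by
  have h := (hw τ).norm_sq
  convert h using 1
  rw [inner_neg_right, ← ContinuousLinearMap.adjoint_inner_left, real_inner_self_eq_norm_sq]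
  ring

/-- The left side is a Lyapunov functional: the term −2‖D†w‖² from the energy cancels the derivative
of the weight 2τ, and −4τ‖DD†w‖² remains. -/
theorem IsFlow.norm_sq_add_le {D : E →L[ℝ] F} {w : ℝ → F} (hw : IsFlow D w) {τ : ℝ} (hτ : 0 ≤ τ) :
    ‖w τ‖ ^ 2 + 2 * τ * ‖adjoint D (w τ)‖ ^ 2 ≤ ‖w 0‖ ^ 2 := by
  have hd : ∀ s, HasDerivAt (fun τ => ‖w τ‖ ^ 2 + 2 * τ * ‖adjoint D (w τ)‖ ^ 2)
      (-4 * s * ‖D (adjoint D (w s))‖ ^ 2) s := by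
    intro s
    have h1 := hw.hasDerivAt_norm_sq s
    have h2 := hw.adjoint_comp.hasDerivAt_norm_sq s
    have h3 := h1.add (((hasDerivAt_id s).const_mul 2).mul h2)
    refine h3.congr_deriv ?_
    simp only [id, ContinuousLinearMap.adjoint_adjoint]
    ring
  have hanti := antitoneOn_of_deriv_nonpos (convex_Ici (0 : ℝ))
    (fun s _ => (hd s).continuousAt.continuousWithinAt)
    (fun s _ => (hd s).differentiableAt.differentiableWithinAt)
    (fun s hs => by
      rw [interior_Ici, mem_Ioi] at hs
      rw [(hd s).deriv]
      have : 0 ≤ s * ‖D (adjoint D (w s))‖ ^ 2 := by positivity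
      linarith)
  simpa using hanti (mem_Ici.2 le_rfl) (mem_Ici.2 hτ) hτ

theorem IsFlow.norm_le {D : E →L[ℝ] F} {w : ℝ → F} (hw : IsFlow D w) {τ : ℝ} (hτ : 0 ≤ τ) :
    ‖w τ‖ ≤ ‖w 0‖ := by
  have h := hw.norm_sq_add_le hτ
  have : 0 ≤ 2 * τ * ‖adjoint D (w τ)‖ ^ 2 := by positivity
  exact (abs_le_of_sq_le_sq' (by linarith) (norm_nonneg _)).2

theorem IsFlow.norm_adjoint_le {D : E →L[ℝ] F} {w : ℝ → F} (hw : IsFlow D w) {τ : ℝ} (hτ : 0 < τ) :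
    ‖adjoint D (w τ)‖ ≤ ‖w 0‖ / √(2 * τ) := by
  have h := hw.norm_sq_add_le hτ.le
  rw [le_div_iff₀ (by positivity)]
  refine (abs_le_of_sq_le_sq' ?_ (norm_nonneg _)).2
  rw [mul_pow, Real.sq_sqrt (by positivity)]
  nlinarith [sq_nonneg ‖w τ‖]

theorem IsFlow.norm_adjoint_le_sqrt {D : E →L[ℝ] F} {w : ℝ → F} (hw : IsFlow D w) {τ : ℝ}
    (hτ : 0 < τ) : ‖adjoint D (w τ)‖ ≤ ‖w 0‖ / √τ := by
  refine (hw.norm_adjoint_le hτ).trans ?_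
  gcongr
  linarith

/-- Restart at time τ/2; the remaining time τ/2 gives √(2 · τ/2) = √τ. -/
theorem IsFlow.norm_adjoint_le_half {D : E →L[ℝ] F} {w : ℝ → F} (hw : IsFlow D w) {τ : ℝ}
    (hτ : 0 < τ) : ‖adjoint D (w τ)‖ ≤ ‖w (τ / 2)‖ / √τ := by
  have h := (hw.shift (τ / 2)).norm_adjoint_le (half_pos hτ)
  simpa [mul_div_cancel₀] using h

/-- Two smoothing steps over half the time each, with factor 1/√τ apiece. The second is applied to
the flow D†w. -/
theorem IsFlow.norm_comp_adjoint_le {D : E →L[ℝ] F} {w : ℝ → F} (hw : IsFlow D w) {τ : ℝ}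
    (hτ : 0 < τ) : ‖D (adjoint D (w τ))‖ ≤ ‖w 0‖ / τ := by
  have h := hw.adjoint_comp.norm_adjoint_le_half hτ
  have h2 := hw.norm_adjoint_le (half_pos hτ)
  simp only [ContinuousLinearMap.adjoint_adjoint] at h
  rw [mul_div_cancel₀ _ (two_ne_zero)] at h2
  refine h.trans ?_
  rw [div_le_iff₀ (by positivity)]
  refine h2.trans (le_of_eq ?_)
  rw [div_mul_eq_mul_div, div_eq_div_iff (by positivity) (by positivity), mul_assoc,
    Real.mul_self_sqrt hτ.le]

theorem IsFlow.norm_adjoint_comp_adjoint_le {D : E →L[ℝ] F} {w : ℝ → F} (hw : IsFlow D w) {τ : ℝ}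
    (hτ : 0 < τ) : ‖adjoint D (D (adjoint D (w τ)))‖ ≤ 2 * ‖w 0‖ / (τ * √τ) := by
  have h3 := hw.adjoint_comp.adjoint_comp.norm_adjoint_le_half hτ
  have h2 := hw.norm_comp_adjoint_le (half_pos hτ)
  simp only [ContinuousLinearMap.adjoint_adjoint] at h3
  refine h3.trans ?_
  rw [div_le_iff₀ (by positivity)]
  refine h2.trans (le_of_eq ?_)
  field_simp

end Flow

/-! ### Duality estimates for the discrete parabolic error problem. -/

section Parabolic

variable {E : Type*} [NormedAddCommGroup E] [InnerProductSpace ℝ E] [CompleteSpace E]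

open ContinuousLinearMap (adjoint)

/-- `ξ' = -D†(D ξ + r) + ρ'` with `ξ(0) = 0`, where the source has the size `ε / h`, its
antiderivative `ρ` and `r` have the size `ε`. -/
structure ParabolicData (D : E →L[ℝ] E) (T h ε : ℝ) (ξ ρ ρ' r : ℝ → E) : Prop where
  h_pos : 0 < h
  h_le : h ≤ 7
  deriv_xi : ∀ s ∈ Icc 0 T, HasDerivWithinAt ξ (-(adjoint D (D (ξ s) + r s)) + ρ' s) (Icc 0 T) s
  deriv_rho : ∀ s ∈ Icc 0 T, HasDerivWithinAt ρ (ρ' s) (Icc 0 T) s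
  rho_le : ∀ s ∈ Icc 0 T, ‖ρ s‖ ≤ ε
  rho'_le : ∀ s ∈ Icc 0 T, ‖ρ' s‖ ≤ ε / h
  r_le : ∀ s ∈ Icc 0 T, ‖r s‖ ≤ ε
  xi_zero : ξ 0 = 0

variable {D : E →L[ℝ] E} {T h ε : ℝ} {ξ ρ ρ' r : ℝ → E}

theorem HasDerivWithinAt.Ici_of_Icc {G : Type*} [NormedAddCommGroup G] [NormedSpace ℝ G]
    {f : ℝ → G} {f' : G} {a b s : ℝ}
    (hf : HasDerivWithinAt f f' (Icc a b) s) (hs : s ∈ Ico a b) :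
    HasDerivWithinAt f f' (Ici s) s :=
  hf.mono_of_mem_nhdsWithin (mem_of_superset (Icc_mem_nhdsGE hs.2) (Icc_subset_Icc_left hs.1))

/-- A substitute for integrating g', of which no integrability is known. The majorant B need not be
differentiable at b, which admits the singularities of the smoothing bounds at τ = 0. -/
theorem abs_sub_le_of_deriv_le {g g' B B' : ℝ → ℝ} {a b : ℝ} (hab : a ≤ b)
    (hg : ContinuousOn g (Icc a b)) (hg' : ∀ s ∈ Ico a b, HasDerivWithinAt g (g' s) (Ici s) s)
    (hB : ContinuousOn B (Icc a b)) (hB' : ∀ s ∈ Ico a b, HasDerivAt B (B' s) s)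
    (bound : ∀ s ∈ Ico a b, |g' s| ≤ B' s) : |g b - g a| ≤ B b - B a := by
  have := image_norm_le_of_norm_deriv_right_le_deriv_boundary' (f := fun s => g s - g a)
    (B := fun s => B s - B a) (hg.sub continuousOn_const)
    (fun s hs => (hg' s hs).sub_const _) (by simp) (hB.sub continuousOn_const)
    (fun s hs => ((hB' s hs).sub_const _).hasDerivWithinAt) bound (right_mem_Icc.2 hab)
  simpa using this

/-- Duality on the final stretch, where the source ρ' is used with its size ε/h. -/
theorem ParabolicData.late (P : ParabolicData D T h ε ξ ρ ρ' r) {z : ℝ → E}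
    (hz : IsFlow (adjoint D) z) {t t₁ : ℝ} (h0 : 0 ≤ t₁) (h1 : t₁ ≤ t) (hT : t ≤ T)
    {B B' : ℝ → ℝ} (hB : ContinuousOn B (Icc t₁ t)) (hB' : ∀ s ∈ Ico t₁ t, HasDerivAt B (B' s) s)
    (bound : ∀ s ∈ Ico t₁ t, ε * ‖D (z (t - s))‖ + ε / h * ‖z (t - s)‖ ≤ B' s) :
    |inner ℝ (ξ t) (z 0) - inner ℝ (ξ t₁) (z (t - t₁))| ≤ B t - B t₁ := by
  -- The flow runs backwards in s, so its contribution (ξ, D†Dz) cancels (D†Dξ, z).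
  have hd : ∀ s ∈ Icc t₁ t, HasDerivWithinAt (fun s => inner ℝ (ξ s) (z (t - s)))
      (-(inner ℝ (r s) (D (z (t - s)))) + inner ℝ (ρ' s) (z (t - s))) (Icc t₁ t) s := by
    intro s hs
    have hs' : s ∈ Icc 0 T := ⟨h0.trans hs.1, hs.2.trans hT⟩
    have h2 := ((P.deriv_xi s hs').mono (Icc_subset_Icc h0 hT)).inner ℝ
      ((hz (t - s)).comp_const_sub t s).hasDerivWithinAt
    refine h2.congr_deriv ?_
    simp only [ContinuousLinearMap.adjoint_adjoint, inner_add_left, inner_neg_left, neg_neg,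
      ContinuousLinearMap.adjoint_inner_left, ContinuousLinearMap.adjoint_inner_right]
    ring
  have := abs_sub_le_of_deriv_le h1 (fun s hs => (hd s hs).continuousWithinAt)
    (fun s hs => HasDerivWithinAt.Ici_of_Icc (hd s (Ico_subset_Icc_self hs)) hs) hB hB'
    (fun s hs => ?_)
  · simpa using this
  have hs' : s ∈ Icc 0 T := ⟨h0.trans hs.1, hs.2.le.trans hT⟩
  refine le_trans ((abs_add_le _ _).trans ?_) (bound s hs)
  rw [abs_neg]
  exact add_le_add ((abs_real_inner_le_norm _ _).trans (by gcongr; exact P.r_le s hs'))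
    ((abs_real_inner_le_norm _ _).trans (by gcongr; exact P.rho'_le s hs'))

/-- Away from the final time, pairing ξ − ρ instead of ξ removes ρ'. The price is ρ against D†Dz,
which is harmless while τ = t − s stays away from 0, and the two end values of ρ. -/
theorem ParabolicData.early (P : ParabolicData D T h ε ξ ρ ρ' r) {z : ℝ → E}
    (hz : IsFlow (adjoint D) z) {t t₁ : ℝ} (h0 : 0 ≤ t₁) (h1 : t₁ ≤ T)
    {B B' : ℝ → ℝ} (hB : ContinuousOn B (Icc 0 t₁)) (hB' : ∀ s ∈ Ico 0 t₁, HasDerivAt B (B' s) s)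
    (bound : ∀ s ∈ Ico 0 t₁,
      ε * ‖D (z (t - s))‖ + ε * ‖adjoint D (D (z (t - s)))‖ ≤ B' s) :
    |inner ℝ (ξ t₁) (z (t - t₁))| ≤ B t₁ - B 0 + ε * ‖z (t - t₁)‖ + ε * ‖z t‖ := by
  have hd : ∀ s ∈ Icc 0 t₁, HasDerivWithinAt (fun s => inner ℝ (ξ s - ρ s) (z (t - s)))
      (-(inner ℝ (r s) (D (z (t - s)))) - inner ℝ (ρ s) (adjoint D (D (z (t - s)))))
      (Icc 0 t₁) s := by
    intro s hs
    have hs' : s ∈ Icc 0 T := ⟨hs.1, hs.2.trans h1⟩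
    have h2 := (((P.deriv_xi s hs').sub (P.deriv_rho s hs')).mono
      (Icc_subset_Icc le_rfl h1)).inner ℝ
      ((hz (t - s)).comp_const_sub t s).hasDerivWithinAt
    refine h2.congr_deriv ?_
    simp only [ContinuousLinearMap.adjoint_adjoint, inner_add_left, inner_neg_left, neg_neg,
      ContinuousLinearMap.adjoint_inner_left, ContinuousLinearMap.adjoint_inner_right,
      inner_sub_left, Pi.sub_apply, map_sub]
    ring
  have key := abs_sub_le_of_deriv_le h0 (fun s hs => (hd s hs).continuousWithinAt)
    (fun s hs => HasDerivWithinAt.Ici_of_Icc (hd s (Ico_subset_Icc_self hs)) hs) hB hB'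
    (fun s hs => ?_)
  · have e1 : |inner ℝ (ρ t₁) (z (t - t₁))| ≤ ε * ‖z (t - t₁)‖ :=
      (abs_real_inner_le_norm _ _).trans (by gcongr; exact P.rho_le _ ⟨h0, h1⟩)
    have e2 : |inner ℝ (ρ 0) (z t)| ≤ ε * ‖z t‖ :=
      (abs_real_inner_le_norm _ _).trans (by gcongr; exact P.rho_le _ ⟨le_rfl, h0.trans h1⟩)
    simp only [P.xi_zero, sub_zero, zero_sub, inner_sub_left, inner_neg_left] at key
    rw [abs_le] at *
    constructor <;> linarith [e1.1, e1.2, e2.1, e2.2, key.1, key.2]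
  have hs' : s ∈ Icc 0 T := ⟨hs.1, hs.2.le.trans h1⟩
  refine le_trans ((abs_sub _ _).trans ?_) (bound s hs)
  rw [abs_neg]
  exact add_le_add ((abs_real_inner_le_norm _ _).trans (by gcongr; exact P.r_le s hs'))
    ((abs_real_inner_le_norm _ _).trans (by gcongr; exact P.rho_le s hs'))

theorem ParabolicData.eps_nonneg (P : ParabolicData D T h ε ξ ρ ρ' r) (hT : 0 ≤ T) : 0 ≤ ε :=
  (norm_nonneg _).trans (P.rho_le 0 ⟨le_rfl, hT⟩)

theorem hasDerivAt_sqrt_const_sub {t s : ℝ} (hs : s < t) :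
    HasDerivAt (fun s => √(t - s)) (-(1 / (2 * √(t - s)))) s := by
  have := ((hasDerivAt_id s).const_sub t).sqrt (by simpa using (sub_pos.2 hs).ne')
  simpa [neg_div] using this

theorem hasDerivAt_log_const_sub {t s d : ℝ} (hs : 0 < t - s + d) :
    HasDerivAt (fun s => Real.log (t - s + d)) (-(1 / (t - s + d))) s := by
  have := (((hasDerivAt_id s).const_sub t).add_const d).log (by simpa using hs.ne')
  simpa [neg_div] using this

theorem hasDerivAt_inv_sqrt_const_sub {t s : ℝ} (hs : s < t) :
    HasDerivAt (fun s => 1 / √(t - s)) (1 / (2 * ((t - s) * √(t - s)))) s := by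
  have hp : 0 < t - s := sub_pos.2 hs
  have := (hasDerivAt_sqrt_const_sub hs).inv (Real.sqrt_pos.2 hp).ne'
  simp only [one_div]
  refine this.congr_deriv ?_
  rw [Real.sq_sqrt hp.le]
  field_simp

theorem sqrt_le_three {h : ℝ} (h7 : h ≤ 7) : √h ≤ 3 :=
  Real.sqrt_le_iff.2 ⟨by norm_num, by linarith⟩

theorem neg_log_le_div_sqrt {h : ℝ} (hp : 0 < h) : -Real.log h ≤ 2 / √h := by
  have h1 := Real.log_le_sub_one_of_pos (x := 1 / √h) (by positivity)
  have h2 : Real.log (1 / √h) = -(Real.log h / 2) := by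
    rw [one_div, Real.log_inv, Real.log_sqrt hp.le]
  have h3 : 2 / √h = 2 * (1 / √h) := by ring
  rw [h3]; linarith

theorem norm_le_of_forall_inner_le {F : Type*} [NormedAddCommGroup F] [InnerProductSpace ℝ F]
    {x : F} {M : ℝ} (hM : 0 ≤ M)
    (h : ∀ χ : F, |inner ℝ x χ| ≤ M * ‖χ‖) : ‖x‖ ≤ M := by
  have h1 := h x
  rw [real_inner_self_eq_norm_sq, abs_of_nonneg (by positivity), sq] at h1
  rcases (norm_nonneg x).eq_or_lt with h0 | h0
  · rwa [← h0]
  · exact le_of_mul_le_mul_right h1 h0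

/-- The time interval is split at t − h. The terms ε‖Dz‖ ≲ ε/√τ integrate to √t, the source near the
end to ε, and ε‖D†Dz‖ ≤ ε/τ on [h, t] to ε log(t/h), which h^{-1/2} + t dominates. -/
theorem ParabolicData.norm_xi_le (P : ParabolicData D T h ε ξ ρ ρ' r) {t : ℝ} (ht : t ∈ Icc 0 T) :
    ‖ξ t‖ ≤ 14 * ε * (1 / √h + t) := by
  have hε : 0 ≤ ε := P.eps_nonneg (ht.1.trans ht.2)
  have hh := P.h_pos
  have hs3 := sqrt_le_three P.h_le
  have hsp : 0 < √h := Real.sqrt_pos.2 hh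
  have h1 : 1 ≤ 3 * (1 / √h) := by
    rw [mul_one_div, le_div_iff₀ hsp]; linarith
  have hst : 2 * √t ≤ 1 + t := by nlinarith [sq_nonneg (√t - 1), Real.sq_sqrt ht.1]
  refine norm_le_of_forall_inner_le (by have := ht.1; positivity) fun χ => ?_
  obtain ⟨z, hz, rfl⟩ := exists_isFlow (adjoint D) χ
  set n := ‖z 0‖
  have hn : 0 ≤ n := norm_nonneg _
  have hzn : ∀ {τ}, 0 ≤ τ → ‖z τ‖ ≤ n := fun hτ => hz.norm_le hτ
  have hDz : ∀ {τ}, 0 < τ → ‖D (z τ)‖ ≤ n / √τ := fun hτ => by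
    simpa using hz.norm_adjoint_le_sqrt hτ
  have hAz : ∀ {τ}, 0 < τ → ‖adjoint D (D (z τ))‖ ≤ n / τ := fun hτ => by
    simpa using hz.norm_comp_adjoint_le hτ
  have late : ∀ t₁, 0 ≤ t₁ → t₁ ≤ t → |inner ℝ (ξ t) (z 0) - inner ℝ (ξ t₁) (z (t - t₁))| ≤
      2 * ε * n * √(t - t₁) + ε / h * n * (t - t₁) := by
    intro t₁ h0 h1
    have := P.late hz h0 h1 ht.2 (B := fun s => -(2 * ε * n) * √(t - s) + ε / h * n * s)
      (B' := fun s => -(2 * ε * n) * -(1 / (2 * √(t - s))) + ε / h * n) (by fun_prop)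
      (fun s hs => ((hasDerivAt_sqrt_const_sub hs.2).const_mul _).add
        (by simpa using (hasDerivAt_id s).const_mul (ε / h * n))) (fun s hs => ?_)
    · refine this.trans (le_of_eq ?_)
      simp
      ring
    · have hp := sub_pos.2 hs.2
      have e1 : ε * ‖D (z (t - s))‖ ≤ ε * (n / √(t - s)) := by gcongr; exact hDz hp
      have e2 : ε / h * ‖z (t - s)‖ ≤ ε / h * n := by gcongr; exact hzn hp.le
      have e3 : -(2 * ε * n) * -(1 / (2 * √(t - s))) = ε * (n / √(t - s)) := by
        field_simp
      linarith
  rcases le_or_gt t h with hth | hth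
  · have := late 0 le_rfl ht.1
    rw [P.xi_zero, inner_zero_left, sub_zero, sub_zero] at this
    have e : ε / h * n * t ≤ ε * n := by
      rw [div_mul_eq_mul_div, div_mul_eq_mul_div, div_le_iff₀ hh]; gcongr
    have e2 : ε * n * (2 * √t + 1) ≤ ε * n * (14 * (1 / √h + t)) := by
      gcongr; have := ht.1; linarith
    linarith
  · have hl := late (t - h) (by linarith) (by linarith)
    rw [sub_sub_cancel] at hl
    have he := P.early hz (t := t) (t₁ := t - h) (by linarith) (by linarith [ht.2])
      (B := fun s => -(2 * ε * n) * √(t - s) + -(ε * n) * Real.log (t - s + 0))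
      (B' := fun s => -(2 * ε * n) * -(1 / (2 * √(t - s))) + -(ε * n) * -(1 / (t - s + 0)))
      (fun s hs => ?_)
      (fun s hs => ((hasDerivAt_sqrt_const_sub (by linarith [hs.2])).const_mul _).add
        ((hasDerivAt_log_const_sub (by linarith [hs.2])).const_mul _)) (fun s hs => ?_)
    · simp only [sub_sub_cancel, sub_zero, add_zero] at he
      have e1 : ε * ‖z h‖ ≤ ε * n := by gcongr; exact hzn hh.le
      have e2 : ε * ‖z t‖ ≤ ε * n := by gcongr; exact hzn ht.1
      have e3 : ε / h * n * h = ε * n := by field_simp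
      have e4 := neg_log_le_div_sqrt hh
      have e5 : Real.log t ≤ t := Real.log_le_self ht.1
      -- With 2√t ≤ 1 + t, log t ≤ t and −log h ≤ 2/√h the bracket is at most 4 + 2t + 2/√h, and 1 ≤
      -- 3/√h makes 12 + 2 = 14.
      have e6 : ε * n * (2 * √t + Real.log t + -Real.log h + 3) ≤ ε * n * (14 * (1 / √h + t)) := by
        gcongr
        have : 2 / √h = 2 * (1 / √h) := by ring
        have := ht.1
        linarith
      have := abs_add_le (inner ℝ (ξ t) (z 0) - inner ℝ (ξ (t - h)) (z h)) (inner ℝ (ξ (t - h)) (z h))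
      rw [sub_add_cancel] at this
      linarith
    · have hlt : 0 < t - s := by linarith [hs.2]
      exact (((hasDerivAt_sqrt_const_sub (by linarith [hs.2])).const_mul _).add
        ((hasDerivAt_log_const_sub (by linarith)).const_mul _)).continuousAt.continuousWithinAt
    · have hp : 0 < t - s := by linarith [hs.2]
      have e1 : ε * ‖D (z (t - s))‖ ≤ ε * (n / √(t - s)) := by gcongr; exact hDz hp
      have e2 : ε * ‖adjoint D (D (z (t - s)))‖ ≤ ε * (n / (t - s)) := by gcongr; exact hAz hp
      have e3 : -(2 * ε * n) * -(1 / (2 * √(t - s))) = ε * (n / √(t - s)) := by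
        field_simp
      have e4 : -(ε * n) * -(1 / (t - s + 0)) = ε * (n / (t - s)) := by
        rw [add_zero]; ring
      linarith

/-- Merges the smoothing bound 1/τ and the operator norm bound κ/b into one whose integral is an
explicit logarithm. -/
theorem min_le_div_add {a b τ κ : ℝ} (hκ : 0 ≤ κ) (hb : 0 < b) (hτ : 0 < τ)
    (h1 : a ≤ 1 / τ) (h2 : a ≤ κ / b) : a ≤ 2 * (1 + κ) / (τ + b) := by
  rcases le_total b τ with h | h
  · refine h1.trans ?_
    rw [div_le_div_iff₀ hτ (by positivity)]
    nlinarith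
  · refine h2.trans ?_
    rw [div_le_div_iff₀ hb (by positivity)]
    nlinarith

theorem log_add_sub_log_le {t h : ℝ} (ht : 0 ≤ t) (hh : 0 < h) (h7 : h ≤ 7) :
    Real.log (t + h ^ 4) - Real.log (h ^ 4) ≤ 302 * (1 / √h + √t) := by
  have hsp : 0 < √h := Real.sqrt_pos.2 hh
  have h1 : 1 ≤ 3 * (1 / √h) := by
    rw [mul_one_div, le_div_iff₀ hsp]; linarith [sqrt_le_three h7]
  have e1 : Real.log (t + h ^ 4) ≤ 2 * (√t + h ^ 2) := by
    have : t + h ^ 4 ≤ (√t + h ^ 2) ^ 2 := by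
      have := Real.sq_sqrt ht
      have : 0 ≤ √t * h ^ 2 := by positivity
      nlinarith
    refine (Real.log_le_log (by positivity) this).trans ?_
    rw [Real.log_pow]
    push_cast
    gcongr
    exact Real.log_le_self (by positivity)
  have e2 : -Real.log (h ^ 4) ≤ 8 * (1 / √h) := by
    have := neg_log_le_div_sqrt hh
    rw [Real.log_pow]
    push_cast
    have e : 2 / √h = 2 * (1 / √h) := by ring
    linarith
  -- 2h² ≤ 98 ≤ 294/√h, and 294 + 8 = 302.
  have e3 : h ^ 2 ≤ 49 := by nlinarith
  have := Real.sqrt_nonneg t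
  linarith

/-- Since (Dξ, ψ) = (ξ, D†ψ), the test flow is z = D†w with w(0) = ψ, and each smoothing bound is
worse by τ^{-1/2}. The source terms still give ε/√h: ∫ τ^{-1/2} over [0, h] is weighted by 1/h, and
∫ τ^{-3/2} starts at h. The integral of ‖Dz‖ ≲ 1/τ diverges at 0 and is cut off at τ ~ h⁴ by ‖Dz‖ ≤
‖D‖²‖ψ‖. The power of h in the bound of ‖D‖ thus enters only a logarithm, and h^{-2} is good enough.
-/
theorem ParabolicData.norm_eta_le (P : ParabolicData D T h ε ξ ρ ρ' r) {K : ℝ}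
    (hK : ‖D‖ ≤ K / h ^ 2) {t : ℝ} (ht : t ∈ Icc 0 T) :
    ‖D (ξ t) + r t‖ ≤ 620 * (1 + K ^ 2) * ε * (1 / √h + √t) := by
  have hε : 0 ≤ ε := P.eps_nonneg (ht.1.trans ht.2)
  have hh := P.h_pos
  have hs3 := sqrt_le_three P.h_le
  have hsp : 0 < √h := Real.sqrt_pos.2 hh
  have h1 : 1 ≤ 3 * (1 / √h) := by
    rw [mul_one_div, le_div_iff₀ hsp]; linarith
  set κ := 2 * (1 + K ^ 2) with hκ
  have hκ2 : 2 ≤ κ := by nlinarith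
  have hlog := log_add_sub_log_le ht.1 hh P.h_le
  set Λ := Real.log (t + h ^ 4) - Real.log (h ^ 4) with hΛ
  have hst : 0 ≤ √t := Real.sqrt_nonneg t
  have main : ‖D (ξ t)‖ ≤ ε * (κ * Λ + 8 * (1 / √h)) := by
    have hΛ0 : 0 ≤ Λ := sub_nonneg.2 (Real.log_le_log (by positivity) (by linarith [ht.1]))
    refine norm_le_of_forall_inner_le (by positivity) fun ψ => ?_
    obtain ⟨w, hw, rfl⟩ := exists_isFlow D ψ
    set n := ‖w 0‖
    have hn : 0 ≤ n := norm_nonneg _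
    have hz : IsFlow (adjoint D) (fun τ => adjoint D (w τ)) := hw.adjoint_comp
    set z := fun τ => adjoint D (w τ) with hzdef
    have hzn : ∀ {τ}, 0 < τ → ‖z τ‖ ≤ n / √τ := fun hτ => hw.norm_adjoint_le_sqrt hτ
    have hDz : ∀ {τ}, 0 < τ → ‖D (z τ)‖ ≤ κ * n / (τ + h ^ 4) := fun {τ} hτ => by
      have a1 : ‖D (z τ)‖ ≤ n / τ := hw.norm_comp_adjoint_le hτ
      have a2 : ‖D (z τ)‖ ≤ K ^ 2 / h ^ 4 * n := by
        have b1 : ‖w τ‖ ≤ n := hw.norm_le hτ.le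
        have b2 : ‖z τ‖ ≤ ‖D‖ * ‖w τ‖ := by
          simpa using (adjoint D).le_opNorm (w τ)
        have b3 := D.le_opNorm (z τ)
        have hK0 : 0 ≤ K / h ^ 2 := (norm_nonneg _).trans hK
        calc ‖D (z τ)‖ ≤ ‖D‖ * (‖D‖ * ‖w τ‖) := b3.trans (by gcongr)
          _ ≤ K / h ^ 2 * (K / h ^ 2 * n) := by gcongr
          _ = K ^ 2 / h ^ 4 * n := by field_simp
      rcases hn.eq_or_lt with hn0 | hn0
      · rw [← hn0] at a1 ⊢; simpa using a1
      · have := min_le_div_add (a := ‖D (z τ)‖ / n) (τ := τ) (b := h ^ 4) (κ := K ^ 2)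
          (by positivity) (by positivity) hτ
          (by rw [div_le_iff₀ hn0, one_div_mul_eq_div]; exact a1) (by rwa [div_le_iff₀ hn0])
        rw [div_le_iff₀ hn0] at this
        refine this.trans (le_of_eq ?_)
        rw [← hκ]; ring
    have hAz : ∀ {τ}, 0 < τ → ‖adjoint D (D (z τ))‖ ≤ 2 * n / (τ * √τ) := fun hτ =>
      hw.norm_adjoint_comp_adjoint_le hτ
    have hinner : inner ℝ (D (ξ t)) (w 0) = inner ℝ (ξ t) (z 0) := by
      rw [hzdef, ContinuousLinearMap.adjoint_inner_right]
    rw [hinner]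
    have late : ∀ t₁, 0 ≤ t₁ → t₁ ≤ t → |inner ℝ (ξ t) (z 0) - inner ℝ (ξ t₁) (z (t - t₁))| ≤
        κ * n * ε * (Real.log (t - t₁ + h ^ 4) - Real.log (h ^ 4)) +
          2 * n * (ε / h) * √(t - t₁) := by
      intro t₁ h0 h1
      have hpos : ∀ s ∈ Icc t₁ t, 0 < t - s + h ^ 4 := fun s hs => by
        have := hs.2
        have : 0 < h ^ 4 := by positivity
        linarith
      have := P.late hz h0 h1 ht.2
        (B := fun s => -(κ * n * ε) * Real.log (t - s + h ^ 4) + -(2 * n * (ε / h)) * √(t - s))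
        (B' := fun s => -(κ * n * ε) * -(1 / (t - s + h ^ 4)) +
          -(2 * n * (ε / h)) * -(1 / (2 * √(t - s))))
        (fun s hs => ContinuousWithinAt.add
          (((hasDerivAt_log_const_sub (hpos s hs)).const_mul _).continuousAt.continuousWithinAt)
          (by fun_prop))
        (fun s hs => ((hasDerivAt_log_const_sub (hpos s (Ico_subset_Icc_self hs))).const_mul _).add
          ((hasDerivAt_sqrt_const_sub hs.2).const_mul _)) (fun s hs => ?_)
      · refine this.trans (le_of_eq ?_)
        simp
        ring
      · have hp := sub_pos.2 hs.2
        have e1 : ε * ‖D (z (t - s))‖ ≤ ε * (κ * n / (t - s + h ^ 4)) := by gcongr; exact hDz hp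
        have e2 : ε / h * ‖z (t - s)‖ ≤ ε / h * (n / √(t - s)) := by gcongr; exact hzn hp
        have e3 : -(2 * n * (ε / h)) * -(1 / (2 * √(t - s))) = ε / h * (n / √(t - s)) := by
          field_simp
        have e4 : -(κ * n * ε) * -(1 / (t - s + h ^ 4)) = ε * (κ * n / (t - s + h ^ 4)) := by ring
        linarith
    rcases le_or_gt t h with hth | hth
    · have := late 0 le_rfl ht.1
      rw [P.xi_zero, inner_zero_left, sub_zero, sub_zero, ← hΛ] at this
      have e : 2 * n * (ε / h) * √t ≤ 2 * n * ε * (1 / √h) := by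
        have : √t ≤ √h := Real.sqrt_le_sqrt hth
        have : ε / h * √h = ε * (1 / √h) := by
          rw [mul_one_div, div_mul_eq_mul_div, div_eq_div_iff hh.ne' hsp.ne', mul_assoc,
            Real.mul_self_sqrt hh.le]
        calc 2 * n * (ε / h) * √t ≤ 2 * n * (ε / h) * √h := by gcongr
          _ = 2 * n * (ε / h * √h) := by ring
          _ = 2 * n * ε * (1 / √h) := by rw [this]; ring
      have : 0 ≤ n * ε * (1 / √h) := by positivity
      linarith
    · have hl := late (t - h) (by linarith) (by linarith)
      rw [sub_sub_cancel] at hl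
      have he := P.early hz (t := t) (t₁ := t - h) (by linarith) (by linarith [ht.2])
        (B := fun s => -(κ * n * ε) * Real.log (t - s + h ^ 4) + 4 * n * ε * (1 / √(t - s)))
        (B' := fun s => -(κ * n * ε) * -(1 / (t - s + h ^ 4)) +
          4 * n * ε * (1 / (2 * ((t - s) * √(t - s)))))
        (fun s hs => ?_)
        (fun s hs => ((hasDerivAt_log_const_sub (by have := hs.2; have := pow_pos hh 4; linarith)).const_mul _).add
          ((hasDerivAt_inv_sqrt_const_sub (by linarith [hs.2])).const_mul _)) (fun s hs => ?_)
      · simp only [sub_sub_cancel, sub_zero] at he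
        have e1 : ε * ‖z h‖ ≤ ε * (n / √h) := by gcongr; exact hzn hh
        have e2 : ε * ‖z t‖ ≤ ε * (n / √h) := by
          gcongr
          exact (hzn (hh.trans hth)).trans (by gcongr)
        have e3 : 2 * n * (ε / h) * √h = 2 * n * ε * (1 / √h) := by
          have : ε / h * √h = ε * (1 / √h) := by
            rw [mul_one_div, div_mul_eq_mul_div, div_eq_div_iff hh.ne' hsp.ne', mul_assoc,
              Real.mul_self_sqrt hh.le]
          rw [mul_assoc, this]; ring
        have e4 : 0 ≤ 4 * n * ε * (1 / √t) := by positivity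
        have e5 : n / √h = n * (1 / √h) := by ring
        have := abs_add_le (inner ℝ (ξ t) (z 0) - inner ℝ (ξ (t - h)) (z h))
          (inner ℝ (ξ (t - h)) (z h))
        rw [sub_add_cancel] at this
        have e6 : κ * n * ε * Λ =
          κ * n * ε * (Real.log (t + h ^ 4) - Real.log (h ^ 4)) := by rw [hΛ]
        rw [e5] at e1 e2
        linarith
      · have hlt : 0 < t - s := by linarith [hs.2]
        exact (((hasDerivAt_log_const_sub (by have := pow_pos hh 4; linarith)).const_mul _).add
          ((hasDerivAt_inv_sqrt_const_sub (by linarith [hs.2])).const_mul _)).continuousAt.continuousWithinAt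
      · have hp : 0 < t - s := by linarith [hs.2]
        have e1 : ε * ‖D (z (t - s))‖ ≤ ε * (κ * n / (t - s + h ^ 4)) := by gcongr; exact hDz hp
        have e2 : ε * ‖adjoint D (D (z (t - s)))‖ ≤ ε * (2 * n / ((t - s) * √(t - s))) := by
          gcongr; exact hAz hp
        have e3 : 4 * n * ε * (1 / (2 * ((t - s) * √(t - s)))) =
          ε * (2 * n / ((t - s) * √(t - s))) := by field_simp; ring
        have e4 : -(κ * n * ε) * -(1 / (t - s + h ^ 4)) = ε * (κ * n / (t - s + h ^ 4)) := by ring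
        linarith
  have hr := P.r_le t ht
  have e0 : κ * Λ ≤ κ * (302 * (1 / √h + √t)) := by gcongr
  -- The 8 collects 2 from the late source, 4 from the early one and 2 from the end values of ρ; the
  -- last 1 is r itself.
  have e1 : κ * Λ + 8 * (1 / √h) + 1 ≤ 310 * κ * (1 / √h + √t) := by
    have : 0 < 1 / √h := by positivity
    nlinarith
  calc ‖D (ξ t) + r t‖ ≤ ‖D (ξ t)‖ + ‖r t‖ := norm_add_le _ _
    _ ≤ ε * (κ * Λ + 8 * (1 / √h) + 1) := by linarith
    _ ≤ ε * (310 * κ * (1 / √h + √t)) := by gcongr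
    _ = 620 * (1 + K ^ 2) * ε * (1 / √h + √t) := by rw [hκ]; ring

end Parabolic
end LDG


/-! ### From weak derivatives to classical ones. -/

namespace LDG

open Set Filter Topology MeasureTheory

/-- Test functions on `(a, b)`. -/
structure IsTest (a b : ℝ) (φ : ℝ → ℝ) : Prop where
  contDiff : ContDiff ℝ ∞ φ
  compact : HasCompactSupport φ
  subset : tsupport φ ⊆ Ioo a b

theorem IsTest.eq_zero {a b x : ℝ} {φ : ℝ → ℝ} (h : IsTest a b φ) (hx : x ∉ Ioo a b) : φ x = 0 :=
  image_eq_zero_of_notMem_tsupport fun h' => hx (h.subset h')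

theorem IsTest.exists_Icc {a b : ℝ} (hab : a < b) {φ : ℝ → ℝ} (h : IsTest a b φ) :
    ∃ α β, a < α ∧ α ≤ β ∧ β < b ∧ ∀ x, x ∉ Icc α β → φ x = 0 := by
  rcases (tsupport φ).eq_empty_or_nonempty with h0 | h0
  · refine ⟨(a + b) / 2, (a + b) / 2, by linarith, le_rfl, by linarith, fun x _ => ?_⟩
    exact image_eq_zero_of_notMem_tsupport (by rw [h0]; exact notMem_empty x)
  · have hc : IsCompact (tsupport φ) := h.compact
    obtain ⟨α, hα⟩ := hc.exists_isLeast h0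
    obtain ⟨β, hβ⟩ := hc.exists_isGreatest h0
    refine ⟨α, β, (h.subset hα.1).1, hα.2 hβ.1, (h.subset hβ.1).2, fun x hx => ?_⟩
    exact image_eq_zero_of_notMem_tsupport fun h' => hx ⟨hα.2 h', hβ.2 h'⟩

/-- The primitive from a vanishes to the left of the support of ψ, and to the right because ψ has
mean zero. -/
theorem IsTest.exists_primitive {a b : ℝ} (hab : a < b) {ψ : ℝ → ℝ} (h : IsTest a b ψ)
    (h0 : ∫ x in a..b, ψ x = 0) : ∃ φ, IsTest a b φ ∧ deriv φ = ψ := by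
  have hc : Continuous ψ := h.contDiff.continuous
  obtain ⟨α, β, hα, hαβ, hβ, hz⟩ := h.exists_Icc hab
  have hd : ∀ x, HasDerivAt (fun x => ∫ y in a..x, ψ y) (ψ x) x := fun x =>
    intervalIntegral.integral_hasDerivAt_right (hc.intervalIntegrable _ _)
      (hc.stronglyMeasurableAtFilter _ _) hc.continuousAt
  have hdd : deriv (fun x => ∫ y in a..x, ψ y) = ψ := funext fun x => (hd x).deriv
  have hsupp : tsupport (fun x => ∫ y in a..x, ψ y) ⊆ Icc α β := by
    refine closure_minimal (fun x hx => ?_) isClosed_Icc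
    by_contra hcon
    refine hx ?_
    rcases lt_or_ge x α with hlt | hge
    · refine intervalIntegral.integral_zero_ae (Eventually.of_forall fun y hy => hz y fun hy' => ?_)
      have := hy.2
      have h3 : max a x < α := max_lt hα hlt
      linarith [hy'.1]
    · have hgt : β < x := lt_of_not_ge fun h' => hcon ⟨hge, h'⟩
      have e1 : ∫ y in x..b, ψ y = 0 := by
        refine intervalIntegral.integral_zero_ae
          (Eventually.of_forall fun y hy => hz y fun hy' => ?_)
        have := hy.1
        have h3 : β < min x b := lt_min hgt hβ
        linarith [hy'.2]
      have e2 := intervalIntegral.integral_add_adjacent_intervals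
        (hc.intervalIntegrable (μ := volume) a x) (hc.intervalIntegrable x b)
      simp only
      linarith
  refine ⟨fun x => ∫ y in a..x, ψ y, ⟨?_, ?_, ?_⟩, hdd⟩
  · rw [contDiff_infty_iff_deriv, hdd]
    exact ⟨fun x => (hd x).differentiableAt, h.contDiff⟩
  · exact HasCompactSupport.of_support_subset_isCompact isCompact_Icc
      ((subset_tsupport _).trans hsupp)
  · exact hsupp.trans fun x hx => ⟨hα.trans_le hx.1, hx.2.trans_lt hβ⟩

theorem exists_isTest_integral_eq_one {a b : ℝ} (hab : a < b) :
    ∃ φ, IsTest a b φ ∧ ∫ x in a..b, φ x = 1 := by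
  let f : ContDiffBump ((a + b) / 2) := ⟨(b - a) / 8, (b - a) / 4, by linarith, by linarith⟩
  have hs : tsupport (f.normed volume) ⊆ Ioo a b := by
    rw [f.tsupport_normed_eq, Real.closedBall_eq_Icc]
    intro x hx
    simp only [f] at hx
    exact ⟨by linarith [hx.1], by linarith [hx.2]⟩
  refine ⟨f.normed volume, ⟨f.contDiff_normed, f.hasCompactSupport_normed, hs⟩, ?_⟩
  rw [intervalIntegral.integral_eq_integral_of_support_subset, f.integral_normed]
  exact (subset_tsupport _).trans (hs.trans Ioo_subset_Ioc_self)

/-- Du Bois-Reymond's lemma. -/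
theorem ae_const_of_integral_mul_deriv {a b : ℝ} (hab : a < b) {d : ℝ → ℝ}
    (hd : IntervalIntegrable d volume a b)
    (h : ∀ φ, IsTest a b φ → ∫ x in a..b, d x * deriv φ x = 0) :
    ∃ c, ∀ᵐ x, x ∈ Ioo a b → d x = c := by
  obtain ⟨ψ₀, hψ₀, h1⟩ := exists_isTest_integral_eq_one hab
  refine ⟨∫ x in a..b, d x * ψ₀ x, ?_⟩
  set c := ∫ x in a..b, d x * ψ₀ x with hc
  have hii : ∀ ψ : ℝ → ℝ, IsTest a b ψ → IntervalIntegrable ψ volume a b :=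
    fun ψ hψ => hψ.contDiff.continuous.intervalIntegrable _ _
  have hdi : ∀ ψ : ℝ → ℝ, IsTest a b ψ → IntervalIntegrable (fun x => d x * ψ x) volume a b :=
    fun ψ hψ => hd.mul_continuousOn hψ.contDiff.continuous.continuousOn
  have key := isOpen_Ioo.ae_eq_zero_of_integral_contDiff_smul_eq_zero (μ := volume)
    (U := Ioo a b) (f := fun x => d x - c) ?_ ?_
  · filter_upwards [key] with x hx hxI
    linarith [hx hxI]
  · refine IntegrableOn.locallyIntegrableOn ?_
    have := (hd.sub (intervalIntegrable_const (c := c)))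
    rw [intervalIntegrable_iff_integrableOn_Ioo_of_le hab.le] at this
    exact this
  · intro ψ h1' h2' h3'
    have hψ : IsTest a b ψ := ⟨h1', h2', h3'⟩
    set m := ∫ x in a..b, ψ x with hm
    -- Removing the mean of ψ by a multiple of ψ₀ makes it the derivative of a test function.
    have hT : IsTest a b (fun x => ψ x - m * ψ₀ x) := by
      refine ⟨hψ.contDiff.sub (contDiff_const.mul hψ₀.contDiff), ?_, ?_⟩
      · exact hψ.compact.sub (hψ₀.compact.mul_left (f := fun _ => m))
      · refine (tsupport_sub _ _).trans (union_subset hψ.subset ?_)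
        exact (tsupport_mul_subset_right (f := fun _ => m)).trans hψ₀.subset
    obtain ⟨φ, hφ, hφd⟩ := hT.exists_primitive hab (by
      rw [intervalIntegral.integral_sub (hii ψ hψ) ((hii ψ₀ hψ₀).const_mul m),
        intervalIntegral.integral_const_mul, h1, ← hm]; ring)
    have hz := h φ hφ
    rw [hφd] at hz
    have e1 : (fun x => d x * (ψ x - m * ψ₀ x)) = fun x => d x * ψ x - m * (d x * ψ₀ x) := by
      funext x; ring
    rw [e1, intervalIntegral.integral_sub (hdi ψ hψ) ((hdi ψ₀ hψ₀).const_mul m),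
      intervalIntegral.integral_const_mul, ← hc] at hz
    have hsub : Function.support (fun x => ψ x • (d x - c)) ⊆ Ioc a b := fun x hx => by
      by_contra hcon
      exact hx (by simp [hψ.eq_zero (fun h' => hcon (Ioo_subset_Ioc_self h'))])
    rw [← intervalIntegral.integral_eq_integral_of_support_subset hsub]
    have e2 : (fun x => ψ x • (d x - c)) = fun x => d x * ψ x - c * ψ x := by
      funext x; simp only [smul_eq_mul]; ring
    rw [e2, intervalIntegral.integral_sub (hdi ψ hψ) ((hii ψ hψ).const_mul c),
      intervalIntegral.integral_const_mul, ← hm]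
    linarith

/-- A function with a weak derivative is almost everywhere a primitive of it. -/
theorem ae_eq_primitive_of_integral_mul_deriv {a b : ℝ} (hab : a < b) {g g' : ℝ → ℝ}
    (hg : IntervalIntegrable g volume a b) (hg' : IntervalIntegrable g' volume a b)
    (h : ∀ φ, IsTest a b φ → ∫ x in a..b, g x * deriv φ x = -∫ x in a..b, g' x * φ x) :
    ∃ c, ∀ᵐ x, x ∈ Ioo a b → g x = c + ∫ y in a..x, g' y := by
  set G := fun x => ∫ y in a..x, g' y with hG
  have hac : AbsolutelyContinuousOnInterval G a b :=
    hg'.absolutelyContinuousOnInterval_intervalIntegral left_mem_uIcc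
  have hGi : IntervalIntegrable G volume a b := hac.continuousOn.intervalIntegrable
  suffices h0 : ∀ φ, IsTest a b φ → ∫ x in a..b, (g x - G x) * deriv φ x = 0 by
    obtain ⟨c, hc⟩ := ae_const_of_integral_mul_deriv hab (hg.sub hGi) h0
    exact ⟨c, by filter_upwards [hc] with x hx hxI; linarith [hx hxI]⟩
  intro φ hφ
  have hdc : Continuous (deriv φ) := hφ.contDiff.continuous_deriv (by exact_mod_cast le_top)
  have hφac : AbsolutelyContinuousOnInterval φ a b :=
    (hφ.contDiff.of_le (m := 1) (by exact_mod_cast le_top)).contDiffOn.absolutelyContinuousOnInterval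
  have hparts := hac.integral_mul_deriv_eq_deriv_mul hφac
  have ha : φ a = 0 := hφ.eq_zero (by simp)
  have hb : φ b = 0 := hφ.eq_zero (by simp)
  have hder : ∫ x in a..b, deriv G x * φ x = ∫ x in a..b, g' x * φ x := by
    refine intervalIntegral.integral_congr_ae ?_
    filter_upwards [hg'.ae_hasDerivAt_integral] with x hx hxI
    rw [(hx (uIoc_subset_uIcc hxI) a left_mem_uIcc).deriv]
  have e : (fun x => (g x - G x) * deriv φ x) = fun x => g x * deriv φ x - G x * deriv φ x := by
    funext x; ring
  rw [e, intervalIntegral.integral_sub (hg.mul_continuousOn hdc.continuousOn)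
    (hGi.mul_continuousOn hdc.continuousOn), h φ hφ, hparts, hder, ha, hb]
  ring

/-- `G 0, …, G n` are successive derivatives on `Omega`, all of them bounded by `B` and Lipschitz
continuous with constant `B`. -/
structure SmoothChain (n : ℕ) (B : ℝ) (G : ℕ → ℝ → ℝ) : Prop where
  hasDeriv : ∀ i < n, ∀ x ∈ Omega, HasDerivWithinAt (G i) (G (i + 1) x) Omega x
  bound : ∀ i ≤ n, ∀ x ∈ Omega, |G i x| ≤ B
  lipschitz : ∀ i ≤ n, ∀ x ∈ Omega, ∀ y ∈ Omega, |G i x - G i y| ≤ B * |x - y|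

theorem two_pi_pos : (0 : ℝ) < 2 * Real.pi := Real.two_pi_pos

/-- The norm is an infimum over versions of the weak derivative, so a strict bound B is used to
select one. `le_mul_toReal_of_forall_lt` finally lets B decrease to the norm. -/
theorem exists_weakDeriv_of_sobolevNorm_lt {m : ℕ} {f : ℝ → ℝ} {B : ℝ}
    (h : sobolevNorm m f < ENNReal.ofReal B) {i : ℕ} (hi : i ≤ m) :
    ∃ g, HasWeakDeriv i f g ∧ ∀ᵐ x, x ∈ Ioo 0 (2 * Real.pi) → |g x| ≤ B := by
  have h1 : (⨅ g : ℝ → ℝ, ⨅ _ : HasWeakDeriv i f g,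
      eLpNorm g ⊤ (volume.restrict (Ioo 0 (2 * Real.pi)))) < ENNReal.ofReal B := by
    refine lt_of_le_of_lt ?_ h
    exact le_iSup₂ (f := fun i (_ : i ∈ Finset.range (m + 1)) => ⨅ g : ℝ → ℝ,
      ⨅ _ : HasWeakDeriv i f g, eLpNorm g ⊤ (volume.restrict (Ioo 0 (2 * Real.pi)))) i
      (Finset.mem_range.2 (Nat.lt_succ_of_le hi))
  obtain ⟨g, hg⟩ := iInf_lt_iff.1 h1
  obtain ⟨hw, hlt⟩ := iInf_lt_iff.1 hg
  refine ⟨g, hw, ?_⟩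
  rw [eLpNorm_exponent_top] at hlt
  have := enorm_ae_le_eLpNormEssSup g (volume.restrict (Ioo 0 (2 * Real.pi)))
  rw [ae_restrict_iff' measurableSet_Ioo] at this
  filter_upwards [this] with x hx hxI
  have h3 := (hx hxI).trans hlt.le
  have hB : 0 < ENNReal.ofReal B := lt_of_le_of_lt zero_le hlt
  rw [← ofReal_norm, ENNReal.ofReal_le_ofReal_iff (ENNReal.ofReal_pos.1 hB).le] at h3
  exact h3

theorem HasWeakDeriv.intervalIntegrable {i : ℕ} {f g : ℝ → ℝ} {B : ℝ} (h : HasWeakDeriv i f g)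
    (hB : ∀ᵐ x, x ∈ Ioo 0 (2 * Real.pi) → |g x| ≤ B) :
    IntervalIntegrable g volume 0 (2 * Real.pi) := by
  rw [intervalIntegrable_iff_integrableOn_Ioo_of_le two_pi_pos.le]
  refine IntegrableOn.of_bound measure_Ioo_lt_top h.2.1.aestronglyMeasurable B ?_
  rwa [ae_restrict_iff' measurableSet_Ioo]

theorem HasWeakDeriv.integral_eq {i : ℕ} {f g : ℝ → ℝ} (h : HasWeakDeriv i f g) {φ : ℝ → ℝ}
    (hφ : IsTest 0 (2 * Real.pi) φ) :
    ∫ x in 0..2 * Real.pi, f x * iteratedDeriv i φ x =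
      (-1) ^ i * ∫ x in 0..2 * Real.pi, g x * φ x := by
  have := h.2.2 φ hφ.contDiff hφ.compact hφ.subset
  rwa [← integral_Ioc_eq_integral_Ioo, ← integral_Ioc_eq_integral_Ioo,
    ← intervalIntegral.integral_of_le two_pi_pos.le,
    ← intervalIntegral.integral_of_le two_pi_pos.le] at this

theorem IsTest.deriv {a b : ℝ} {φ : ℝ → ℝ} (h : IsTest a b φ) : IsTest a b (deriv φ) :=
  ⟨(contDiff_infty_iff_deriv.1 h.contDiff).2, h.compact.deriv,
    (tsupport_deriv_subset).trans h.subset⟩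

theorem HasWeakDeriv.succ_primitive {i : ℕ} {f g g' : ℝ → ℝ} {B : ℝ} (h : HasWeakDeriv i f g)
    (h' : HasWeakDeriv (i + 1) f g') (hB : ∀ᵐ x, x ∈ Ioo 0 (2 * Real.pi) → |g x| ≤ B)
    (hB' : ∀ᵐ x, x ∈ Ioo 0 (2 * Real.pi) → |g' x| ≤ B) :
    ∃ c, ∀ᵐ x, x ∈ Ioo 0 (2 * Real.pi) → g x = c + ∫ y in 0..x, g' y := by
  refine ae_eq_primitive_of_integral_mul_deriv two_pi_pos (h.intervalIntegrable hB)
    (h'.intervalIntegrable hB') fun φ hφ => ?_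
  have e1 := h.integral_eq hφ.deriv
  have e2 := h'.integral_eq hφ
  rw [iteratedDeriv_succ', e1, pow_succ, mul_assoc] at e2
  have := mul_left_cancel₀ (pow_ne_zero i (by norm_num : (-1 : ℝ) ≠ 0)) e2
  rw [this]; ring

/-- Each weak derivative of order at most n is almost everywhere a primitive of the next, which is
bounded by B. These primitives are Lipschitz, and being continuous they are classical derivatives of
one another. -/
theorem exists_smoothChain {n : ℕ} {f : ℝ → ℝ} {B : ℝ} (hf : ContinuousOn f Omega)
    (h : sobolevNorm (n + 1) f < ENNReal.ofReal B) :
    ∃ G, SmoothChain n B G ∧ EqOn f (G 0) Omega := by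
  choose! g hg hgB using fun i (hi : i ≤ n + 1) => exists_weakDeriv_of_sobolevNorm_lt h hi
  choose! c hc using fun i (hi : i ≤ n) => (hg i (by omega)).succ_primitive (hg (i + 1) (by omega))
    (hgB i (by omega)) (hgB (i + 1) (by omega))
  have hgi : ∀ i ≤ n + 1, IntervalIntegrable (g i) volume 0 (2 * Real.pi) := fun i hi =>
    (hg i hi).intervalIntegrable (hgB i hi)
  have hgi' : ∀ i ≤ n + 1, ∀ x ∈ Omega, ∀ y ∈ Omega, IntervalIntegrable (g i) volume x y := by
    intro i hi x hx y hy
    refine (hgi i hi).mono_set ?_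
    rw [uIcc_of_le two_pi_pos.le]
    exact ordConnected_Icc.uIcc_subset hx hy
  have hz : (0 : ℝ) ∈ Omega := ⟨le_rfl, two_pi_pos.le⟩
  let G : ℕ → ℝ → ℝ := fun i x => c i + ∫ y in 0..x, g (i + 1) y
  have hlip : ∀ i ≤ n, ∀ x ∈ Omega, ∀ y ∈ Omega, |G i x - G i y| ≤ B * |x - y| := by
    intro i hi x hx y hy
    have e : G i x - G i y = ∫ z in y..x, g (i + 1) z := by
      simp only [G, add_sub_add_left_eq_sub]
      exact intervalIntegral.integral_interval_sub_left (hgi' _ (by omega) _ hz _ hx)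
        (hgi' _ (by omega) _ hz _ hy)
    rw [e]
    refine intervalIntegral.norm_integral_le_of_norm_le_const_ae (E := ℝ) (f := g (i + 1)) ?_
    -- The half-open interval of integration may contain 2π, where nothing is known about the weak
    -- derivative.
    have hne : ∀ᵐ z : ℝ, z ≠ 2 * Real.pi := by simp [ae_iff]
    filter_upwards [hgB (i + 1) (by omega), hne] with z hz1 hz2 hz3
    refine hz1 ⟨?_, lt_of_le_of_ne ?_ hz2⟩
    · exact lt_of_le_of_lt (le_min hy.1 hx.1) hz3.1
    · exact hz3.2.trans (max_le hy.2 hx.2)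
  have hcont : ∀ i ≤ n, ContinuousOn (G i) Omega := by
    intro i hi
    have hB0 : 0 ≤ B := by
      have := hlip i hi 0 hz 1 ⟨zero_le_one, by linarith [Real.pi_gt_three]⟩
      simp at this
      exact (abs_nonneg _).trans this
    refine LipschitzOnWith.continuousOn (K := ⟨B, hB0⟩) ?_
    exact LipschitzOnWith.of_dist_le_mul fun x hx y hy => hlip i hi x hx y hy
  have hae : ∀ i ≤ n, g i =ᵐ[volume.restrict (Icc 0 (2 * Real.pi))] G i := by
    intro i hi
    rw [← restrict_Ioo_eq_restrict_Icc]
    exact (ae_restrict_iff' measurableSet_Ioo).2 (hc i hi)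
  have hbd : ∀ i ≤ n, ∀ x ∈ Omega, |G i x| ≤ B := by
    intro i hi
    -- The bound holds almost everywhere; written as the equality of two continuous functions,
    -- max(|G i|, B) and B, it extends to the closed interval.
    have e1 : (fun x => max (|G i x|) B) =ᵐ[volume.restrict (Icc 0 (2 * Real.pi))]
        fun _ => B := by
      have h2 : ∀ᵐ x ∂volume.restrict (Icc 0 (2 * Real.pi)), |g i x| ≤ B := by
        rw [← restrict_Ioo_eq_restrict_Icc]
        exact (ae_restrict_iff' measurableSet_Ioo).2 (hgB i (by omega))
      filter_upwards [hae i hi, h2] with x hx hx2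
      rw [← hx]; exact max_eq_right hx2
    have e2 := Measure.eqOn_Icc_of_ae_eq volume two_pi_pos.ne e1
      ((hcont i hi).abs.sup continuousOn_const) continuousOn_const
    intro x hx
    have := e2 hx
    simp only at this
    rw [← this]; exact le_max_left _ _
  refine ⟨G, ⟨fun i hi x hx => ?_, hbd, hlip⟩, ?_⟩
  · have e : EqOn (G i) (fun x => c i + ∫ y in 0..x, G (i + 1) y) Omega := by
      intro x hx
      simp only [G, add_right_inj]
      refine intervalIntegral.integral_congr_ae ?_
      have := hae (i + 1) (by omega)
      rw [Filter.EventuallyEq, ae_restrict_iff' measurableSet_Icc] at this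
      filter_upwards [this] with z hz hzI
      refine hz ?_
      rw [uIoc_of_le hx.1] at hzI
      exact ⟨hzI.1.le, hzI.2.trans hx.2⟩
    have hd : HasDerivWithinAt (fun x => c i + ∫ y in 0..x, G (i + 1) y) (G (i + 1) x) Omega x := by
      refine HasDerivWithinAt.const_add _ ?_
      have : Fact (x ∈ Icc 0 (2 * Real.pi)) := ⟨hx⟩
      have hcon := hcont (i + 1) (by omega)
      refine intervalIntegral.integral_hasDerivWithinAt_right (s := Icc 0 (2 * Real.pi))
        (t := Icc 0 (2 * Real.pi)) ?_ ?_ (hcon x hx)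
      · refine ContinuousOn.intervalIntegrable (hcon.mono ?_)
        exact ordConnected_Icc.uIcc_subset hz hx
      · exact hcon.stronglyMeasurableAtFilter_nhdsWithin measurableSet_Icc x
    exact hd.congr e (e hx)
  -- A weak derivative of order zero is a priori another function. Testing shows that it agrees with
  -- f almost everywhere, and by continuity f = G 0 on all of `Omega`.
  · have h0 := hg 0 (by omega)
    have hfi : LocallyIntegrableOn (fun x => f x - g 0 x) (Ioo 0 (2 * Real.pi)) := h0.1.sub h0.2.1
    have key := isOpen_Ioo.ae_eq_zero_of_integral_contDiff_smul_eq_zero hfi ?_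
    · refine Measure.eqOn_Icc_of_ae_eq volume two_pi_pos.ne ?_ hf (hcont 0 (by omega))
      refine EventuallyEq.trans ?_ (hae 0 (by omega))
      rw [← restrict_Ioo_eq_restrict_Icc]
      refine (ae_restrict_iff' measurableSet_Ioo).2 ?_
      filter_upwards [key] with x hx hxI
      linarith [hx hxI]
    · intro φ h1 h2 h3
      have hφ : IsTest 0 (2 * Real.pi) φ := ⟨h1, h2, h3⟩
      have e := h0.integral_eq hφ
      simp only [iteratedDeriv_zero, pow_zero, one_mul] at e
      have hsub : Function.support (fun x => φ x • (f x - g 0 x)) ⊆ Ioc 0 (2 * Real.pi) :=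
        fun x hx => by
          by_contra hcon
          exact hx (by simp [hφ.eq_zero (fun h' => hcon (Ioo_subset_Ioc_self h'))])
      rw [← intervalIntegral.integral_eq_integral_of_support_subset hsub]
      have hfc : IntervalIntegrable f volume 0 (2 * Real.pi) :=
        ContinuousOn.intervalIntegrable (by rwa [uIcc_of_le two_pi_pos.le])
      have e2 : (fun x => φ x • (f x - g 0 x)) = fun x => f x * φ x - g 0 x * φ x := by
        funext x; simp only [smul_eq_mul]; ring
      rw [e2, intervalIntegral.integral_sub (hfc.mul_continuousOn hφ.contDiff.continuous.continuousOn)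
        ((hgi 0 (by omega)).mul_continuousOn hφ.contDiff.continuous.continuousOn), e, sub_self]

end LDG


/-! ### Regularity of the solution in time. -/

namespace LDG

open Set Filter Topology MeasureTheory

theorem abs_sub_sub_mul_le {S : Set ℝ} (hS : Convex ℝ S) {G g : ℝ → ℝ} {L x x' : ℝ}
    (hG : ∀ y ∈ S, HasDerivWithinAt G (g y) S y) (hx : x ∈ S) (hx' : x' ∈ S)
    (hg : ∀ y ∈ S, |g y - g x| ≤ L * |y - x|) (hL : 0 ≤ L) :
    |G x' - G x - g x * (x' - x)| ≤ L * |x' - x| ^ 2 := by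
  have hsub : uIcc x x' ⊆ S := hS.ordConnected.uIcc_subset hx hx'
  have := (convex_uIcc x x').norm_image_sub_le_of_norm_hasDerivWithin_le
    (f := fun y => G y - g x * y) (f' := fun y => g y - g x) (C := L * |x' - x|)
    (fun y hy => ((hG y (hsub hy)).mono hsub).sub
      (by simpa using (hasDerivWithinAt_id y (uIcc x x')).const_mul (g x)))
    (fun y hy => (hg y (hsub hy)).trans
      (mul_le_mul_of_nonneg_left (abs_sub_left_of_mem_uIcc hy) hL)) left_mem_uIcc right_mem_uIcc
  simp only [Real.norm_eq_abs] at this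
  rw [sq, ← mul_assoc]
  refine le_trans (le_of_eq ?_) this
  congr 1; ring

/-- A step of length at most 1 towards the interior, to the right or to the left of x according to x
≤ 3 or not; 4 ≤ 2π leaves room. -/
theorem exists_mem_Omega_abs_sub_eq {x η : ℝ} (hx : x ∈ Omega) (h0 : 0 ≤ η) (h1 : η ≤ 1) :
    ∃ x' ∈ Omega, |x' - x| = η := by
  have := Real.pi_gt_three
  rcases le_total x 3 with h | h
  · exact ⟨x + η, ⟨by linarith [hx.1], by linarith⟩, by simp [abs_of_nonneg h0]⟩
  · exact ⟨x - η, ⟨by linarith, by linarith [hx.2]⟩, by simp [abs_of_nonneg h0]⟩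

theorem convex_Omega : Convex ℝ Omega := convex_Icc _ _

theorem zero_mem_Omega : (0 : ℝ) ∈ Omega := ⟨le_rfl, two_pi_pos.le⟩

theorem SmoothChain.nonneg {n : ℕ} {B : ℝ} {G : ℕ → ℝ → ℝ} (h : SmoothChain n B G) : 0 ≤ B :=
  (abs_nonneg _).trans (h.bound 0 (Nat.zero_le _) 0 zero_mem_Omega)

theorem SmoothChain.continuousOn {n : ℕ} {B : ℝ} {G : ℕ → ℝ → ℝ} (h : SmoothChain n B G) {i : ℕ}
    (hi : i ≤ n) : ContinuousOn (G i) Omega :=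
  LipschitzOnWith.continuousOn (K := ⟨B, h.nonneg⟩)
    (LipschitzOnWith.of_dist_le_mul fun x hx y hy => h.lipschitz i hi x hx y hy)

theorem SmoothChain.taylor {n : ℕ} {B : ℝ} {G : ℕ → ℝ → ℝ} (h : SmoothChain n B G) {i : ℕ}
    (hi : i + 1 ≤ n) {x x' : ℝ} (hx : x ∈ Omega) (hx' : x' ∈ Omega) :
    |G i x' - G i x - G (i + 1) x * (x' - x)| ≤ B * |x' - x| ^ 2 :=
  abs_sub_sub_mul_le convex_Omega (h.hasDeriv i hi) hx hx'
    (fun y hy => h.lipschitz (i + 1) hi y hy x hx) h.nonneg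

/-- `U i` is the `i`-th space derivative of `U 0`, which solves the heat equation on the closed
rectangle. -/
structure HeatChain (n : ℕ) (B T : ℝ) (U : ℕ → ℝ → ℝ → ℝ) : Prop where
  chain : ∀ t ∈ Icc 0 T, SmoothChain n B (fun i => U i t)
  unif : ∀ i ≤ n, ∀ t ∈ Icc 0 T, ∀ ε > 0, ∃ δ > 0, ∀ s ∈ Icc 0 T, |s - t| < δ →
    ∀ x ∈ Omega, |U i s x - U i t x| ≤ ε
  time : ∀ i, i + 2 ≤ n → ∀ t ∈ Icc 0 T, ∀ x ∈ Omega,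
    HasDerivWithinAt (fun s => U i s x) (U (i + 2) t x) (Icc 0 T) t

/-- Continuity in time climbs the chain: U (i+1) differs from a difference quotient of U i with step
η by at most Bη, uniformly in time, and the quotient is continuous in time for fixed η. -/
theorem unif_of_continuousOn {n : ℕ} {B T : ℝ} {U : ℕ → ℝ → ℝ → ℝ}
    (hch : ∀ t ∈ Icc 0 T, SmoothChain n B (fun i => U i t))
    (h0 : ContinuousOn (Function.uncurry (U 0)) (Icc 0 T ×ˢ Omega)) (i : ℕ) (hi : i ≤ n) :
    ∀ t ∈ Icc 0 T, ∀ ε > 0, ∃ δ > 0, ∀ s ∈ Icc 0 T, |s - t| < δ →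
      ∀ x ∈ Omega, |U i s x - U i t x| ≤ ε := by
  induction i with
  | zero =>
    intro t ht ε hε
    have hu := (isCompact_Icc.prod isCompact_Icc : IsCompact (Icc 0 T ×ˢ Omega)).uniformContinuousOn_of_continuous h0
    obtain ⟨δ, hδ, h⟩ := Metric.uniformContinuousOn_iff.1 hu ε hε
    refine ⟨δ, hδ, fun s hs hst x hx => ?_⟩
    have := h (s, x) ⟨hs, hx⟩ (t, x) ⟨ht, hx⟩ (by
      rw [Prod.dist_eq]; simp [Real.dist_eq, hst])
    exact le_of_lt this
  | succ i ih =>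
    intro t ht ε hε
    have hB : 0 ≤ B := (hch t ht).nonneg
    -- The two difference quotients, at times s and t, cost 2Bη together, half of ε. The other half
    -- is the time increment at the two points, each at most εη/4 before division by η.
    obtain ⟨η, hη0, hη1, hηε⟩ : ∃ η : ℝ, 0 < η ∧ η ≤ 1 ∧ 2 * B * η ≤ ε / 2 := by
      refine ⟨min 1 (ε / (4 * (B + 1))), by positivity, min_le_left _ _, ?_⟩
      calc 2 * B * min 1 (ε / (4 * (B + 1))) ≤ 2 * (B + 1) * (ε / (4 * (B + 1))) := by
            gcongr
            · linarith
            · exact min_le_right _ _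
        _ = ε / 2 := by field_simp; ring
    obtain ⟨δ, hδ, h⟩ := ih (by omega) t ht (ε * η / 4) (by positivity)
    refine ⟨δ, hδ, fun s hs hst x hx => ?_⟩
    obtain ⟨x', hx', hxx⟩ := exists_mem_Omega_abs_sub_eq hx hη0.le hη1
    have a1 := (hch t ht).taylor hi hx hx'
    have a2 := (hch s hs).taylor hi hx hx'
    have a3 := h s hs hst x hx
    have a4 := h s hs hst x' hx'
    rw [hxx] at a1 a2
    have key : |U (i + 1) s x - U (i + 1) t x| * η ≤ ε * η := by
      rw [← hxx, ← abs_mul, hxx]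
      have e : (U (i + 1) s x - U (i + 1) t x) * (x' - x) =
        (U i s x' - U i t x') - (U i s x - U i t x) -
        (U i s x' - U i s x - U (i + 1) s x * (x' - x)) +
        (U i t x' - U i t x - U (i + 1) t x * (x' - x)) := by ring
      have hb : 2 * B * η ^ 2 ≤ ε / 2 * η := by rw [sq, ← mul_assoc]; gcongr
      rw [e]
      rw [abs_le] at *
      constructor <;> linarith [a1.1, a1.2, a2.1, a2.2, a3.1, a3.2, a4.1, a4.2]
    exact le_of_mul_le_mul_right key hη0

theorem hasDerivWithinAt_of_forall_abs_le {f : ℝ → ℝ} {f' t : ℝ} {S : Set ℝ}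
    (h : ∀ ε > 0, ∃ δ > 0, ∀ s ∈ S, |s - t| < δ → |f s - f t - (s - t) * f'| ≤ ε * |s - t|) :
    HasDerivWithinAt f f' S t := by
  rw [hasDerivWithinAt_iff_isLittleO, Asymptotics.isLittleO_iff]
  intro ε hε
  obtain ⟨δ, hδ, h⟩ := h ε hε
  rw [eventually_nhdsWithin_iff]
  filter_upwards [Metric.ball_mem_nhds t hδ] with s hs hsS
  exact h s hsS hs

theorem abs_sub_sub_mul_le_of_deriv {T t s c ε : ℝ} {f f' : ℝ → ℝ} (ht : t ∈ Icc 0 T)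
    (hs : s ∈ Icc 0 T) (hf : ∀ r ∈ Icc 0 T, HasDerivWithinAt f (f' r) (Icc 0 T) r)
    (hb : ∀ r ∈ Icc 0 T, |r - t| ≤ |s - t| → |f' r - c| ≤ ε) :
    |f s - f t - (s - t) * c| ≤ ε * |s - t| := by
  have hsub : uIcc t s ⊆ Icc 0 T := ordConnected_Icc.uIcc_subset ht hs
  have := (convex_uIcc t s).norm_image_sub_le_of_norm_hasDerivWithin_le
    (f := fun y => f y - c * y) (f' := fun y => f' y - c) (C := ε)
    (fun y hy => ((hf y (hsub hy)).mono hsub).sub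
      (by simpa using (hasDerivWithinAt_id y (uIcc t s)).const_mul c))
    (fun y hy => hb y (hsub hy) (abs_sub_left_of_mem_uIcc hy)) left_mem_uIcc right_mem_uIcc
  simp only [Real.norm_eq_abs] at this
  refine le_trans (le_of_eq ?_) this
  congr 1; ring

theorem le_of_forall_mul_le_add {a b c : ℝ} (h : ∀ η, 0 < η → η ≤ 1 → a * η ≤ b * η + c * η ^ 2) :
    a ≤ b := by
  refine le_of_forall_pos_le_add fun ε hε => ?_
  set η := min 1 (ε / (|c| + 1)) with hη
  have hη0 : 0 < η := by positivity
  have h1 := h η hη0 (min_le_left _ _)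
  have h2 : c * η ≤ ε := by
    calc c * η ≤ (|c| + 1) * (ε / (|c| + 1)) := by
          gcongr
          · linarith [le_abs_self c]
          · exact min_le_right _ _
      _ = ε := by field_simp
  have h3 : a * η ≤ (b + c * η) * η := by linarith
  linarith [le_of_mul_le_mul_right h3 hη0]

/-- The heat equation is differentiated in space without mixed derivatives at hand: the mean value
theorem in time is applied to the difference of U i at two points at distance η, and η → 0 with both
times fixed. -/
theorem heatChain_of_deriv_zero {n : ℕ} {B T : ℝ} {U : ℕ → ℝ → ℝ → ℝ}
    (hch : ∀ t ∈ Icc 0 T, SmoothChain n B (fun i => U i t))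
    (h0 : ContinuousOn (Function.uncurry (U 0)) (Icc 0 T ×ˢ Omega))
    (hd : ∀ t ∈ Icc 0 T, ∀ x ∈ Omega,
      HasDerivWithinAt (fun s => U 0 s x) (U 2 t x) (Icc 0 T) t) : HeatChain n B T U := by
  have hunif := unif_of_continuousOn hch h0
  refine ⟨hch, hunif, fun i => ?_⟩
  induction i with
  | zero => intro _; exact hd
  | succ i ih =>
    intro hi t ht x hx
    have ih := ih (by omega)
    have hB : 0 ≤ B := (hch t ht).nonneg
    refine hasDerivWithinAt_of_forall_abs_le fun ε hε => ?_
    obtain ⟨δ, hδ, hu⟩ := hunif (i + 1 + 2) hi t ht ε hε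
    refine ⟨δ, hδ, fun s hs hst => ?_⟩
    -- The coefficient of η² collects two spatial Taylor remainders of U i, at times s and t, and |s
    -- − t| times one of U (i+2).
    refine le_of_forall_mul_le_add (c := 2 * B + B * |s - t|) fun η hη0 hη1 => ?_
    obtain ⟨x', hx', hxx⟩ := exists_mem_Omega_abs_sub_eq hx hη0.le hη1
    have a1 := (hch t ht).taylor (i := i) (by omega) hx hx'
    have a2 := (hch s hs).taylor (i := i) (by omega) hx hx'
    rw [hxx] at a1 a2
    have a3 := abs_sub_sub_mul_le_of_deriv (f := fun s => U i s x' - U i s x)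
      (c := U (i + 1 + 2) t x * (x' - x)) (ε := ε * η + B * η ^ 2) ht hs
      (fun r hr => (ih r hr x' hx').sub (ih r hr x hx)) (fun r hr hrt => by
        have b1 := (hch r hr).taylor (i := i + 2) (by omega) hx hx'
        have b2 := hu r hr (hrt.trans_lt hst) x hx
        rw [hxx] at b1
        have b3 : |(U (i + 1 + 2) r x - U (i + 1 + 2) t x) * (x' - x)| ≤ ε * η := by
          rw [abs_mul, hxx]; gcongr
        have e : i + 2 + 1 = i + 1 + 2 := by omega
        rw [e] at b1
        rw [abs_le] at *
        constructor <;> linarith [b1.1, b1.2, b3.1, b3.2])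
    rw [← hxx, ← abs_mul, hxx]
    rw [abs_le] at *
    constructor <;> linarith [a1.1, a1.2, a2.1, a2.2, a3.1, a3.2]

theorem HeatChain.unif_deriv {n : ℕ} {B T : ℝ} {U : ℕ → ℝ → ℝ → ℝ} (h : HeatChain n B T U) {i : ℕ}
    (hi : i + 2 ≤ n) {t : ℝ} (ht : t ∈ Icc 0 T) {ε : ℝ} (hε : 0 < ε) :
    ∃ δ > 0, ∀ s ∈ Icc 0 T, |s - t| < δ →
      ∀ x ∈ Omega, |U i s x - U i t x - (s - t) * U (i + 2) t x| ≤ ε * |s - t| := by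
  obtain ⟨δ, hδ, hu⟩ := h.unif (i + 2) hi t ht ε hε
  exact ⟨δ, hδ, fun s hs hst x hx => abs_sub_sub_mul_le_of_deriv ht hs
    (fun r hr => h.time i hi r hr x hx) fun r hr hrt => hu r hr (hrt.trans_lt hst) x hx⟩

theorem HeatChain.hasDerivWithinAt_integral {n : ℕ} {B T : ℝ} {U : ℕ → ℝ → ℝ → ℝ}
    (h : HeatChain n B T U) {i : ℕ} (hi : i + 2 ≤ n) {t : ℝ} (ht : t ∈ Icc 0 T) {a b : ℝ}
    (hab : a ≤ b) (hsub : Icc a b ⊆ Omega) {φ : ℝ → ℝ} (hφ : Continuous φ) :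
    HasDerivWithinAt (fun s => ∫ x in a..b, U i s x * φ x) (∫ x in a..b, U (i + 2) t x * φ x)
      (Icc 0 T) t := by
  obtain ⟨M, hM⟩ := (isCompact_Icc (a := a) (b := b)).exists_bound_of_continuousOn hφ.continuousOn
  have hM0 : 0 ≤ M := (norm_nonneg _).trans (hM a (left_mem_Icc.2 hab))
  have hint : ∀ j ≤ n, ∀ s ∈ Icc 0 T, IntervalIntegrable (fun x => U j s x * φ x) volume a b := by
    intro j hj s hs
    refine ContinuousOn.intervalIntegrable ?_
    rw [uIcc_of_le hab]
    exact (((h.chain s hs).continuousOn hj).mono hsub).mul hφ.continuousOn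
  refine hasDerivWithinAt_of_forall_abs_le fun ε hε => ?_
  obtain ⟨δ, hδ, hu⟩ := h.unif_deriv hi ht (ε := ε / ((M + 1) * (b - a + 1)))
    (div_pos hε (mul_pos (by linarith) (by linarith)))
  refine ⟨δ, hδ, fun s hs hst => ?_⟩
  rw [← intervalIntegral.integral_const_mul, ← intervalIntegral.integral_sub
    (hint i (by omega) s hs) (hint i (by omega) t ht), ← intervalIntegral.integral_sub
    ((hint i (by omega) s hs).sub (hint i (by omega) t ht)) ((hint _ hi t ht).const_mul _)]
  have := intervalIntegral.norm_integral_le_of_norm_le_const (a := a) (b := b)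
    (f := fun x => U i s x * φ x - U i t x * φ x - (s - t) * (U (i + 2) t x * φ x))
    (C := ε / ((M + 1) * (b - a + 1)) * |s - t| * M) (fun x hx => by
      rw [uIoc_of_le hab] at hx
      have hx' := Ioc_subset_Icc_self hx
      have e : U i s x * φ x - U i t x * φ x - (s - t) * (U (i + 2) t x * φ x) =
        (U i s x - U i t x - (s - t) * U (i + 2) t x) * φ x := by ring
      rw [e, norm_mul]
      gcongr
      · exact hu s hs hst x (hsub hx')
      · exact hM x hx')
  refine this.trans ?_
  rw [abs_of_nonneg (sub_nonneg.2 hab)]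
  have hba : 0 ≤ b - a := sub_nonneg.2 hab
  calc ε / ((M + 1) * (b - a + 1)) * |s - t| * M * (b - a)
      ≤ ε / ((M + 1) * (b - a + 1)) * |s - t| * (M + 1) * (b - a + 1) := by
        gcongr <;> linarith
    _ = ε * |s - t| := by field_simp

theorem uniqueDiffOn_Omega : UniqueDiffOn ℝ Omega := uniqueDiffOn_Icc two_pi_pos

theorem exists_heatChain {n : ℕ} (hn : 2 ≤ n) {fl : Flux} {bc : Boundary} {T : ℝ} (hT : 0 < T)
    {u₀ : ℝ → ℝ} {u : ℝ → ℝ → ℝ} (hu : IsHeatSolution fl bc T u₀ u) {B : ℝ}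
    (hB : supSobolevNorm (n + 1) T u < ENNReal.ofReal B) :
    ∃ U, HeatChain n B T U ∧ ∀ t ∈ Icc 0 T, EqOn (u t) (U 0 t) Omega ∧
      EqOn (qOf u t) (U 1 t) Omega := by
  have hlt : ∀ t ∈ Icc 0 T, sobolevNorm (n + 1) (u t) < ENNReal.ofReal B := fun t ht =>
    (le_iSup₂ (f := fun t (_ : t ∈ Icc 0 T) => sobolevNorm (n + 1) (u t)) t ht).trans_lt hB
  have hex : ∀ t, ∃ G : ℕ → ℝ → ℝ, t ∈ Icc 0 T → SmoothChain n B G ∧ EqOn (u t) (G 0) Omega := by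
    intro t
    by_cases ht : t ∈ Icc 0 T
    · obtain ⟨G, hG⟩ := exists_smoothChain (hu.contDiffOn t ht).continuousOn (hlt t ht)
      exact ⟨G, fun _ => hG⟩
    · exact ⟨fun _ _ => 0, fun h => absurd h ht⟩
  choose G hG using hex
  have hd1 : ∀ t ∈ Icc 0 T, EqOn (derivWithin (u t) Omega) (G t 1) Omega := fun t ht x hx =>
    (((hG t ht).1.hasDeriv 0 (by omega) x hx).congr (hG t ht).2 ((hG t ht).2 hx)).derivWithin
      (uniqueDiffOn_Omega x hx)
  have hd2 : ∀ t ∈ Icc 0 T, EqOn (iteratedDerivWithin 2 (u t) Omega) (G t 2) Omega := by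
    intro t ht x hx
    rw [show (2 : ℕ) = 1 + 1 from rfl, iteratedDerivWithin_succ, iteratedDerivWithin_one]
    exact (((hG t ht).1.hasDeriv 1 (by omega) x hx).congr (hd1 t ht) (hd1 t ht hx)).derivWithin
      (uniqueDiffOn_Omega x hx)
  have hch : ∀ t ∈ Icc 0 T, SmoothChain n B (fun i => G t i) := fun t ht => (hG t ht).1
  have hcont : ContinuousOn (Function.uncurry fun t x => G t 0 x) (Icc 0 T ×ˢ Omega) :=
    hu.continuousOn.congr fun p hp => ((hG p.1 hp.1).2 hp.2).symm
  refine ⟨fun i t x => G t i x, heatChain_of_deriv_zero hch hcont ?_, fun t ht =>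
    ⟨(hG t ht).2, hd1 t ht⟩⟩
  have hpos : ∀ t ∈ Ioc 0 T, ∀ x ∈ Omega,
      HasDerivWithinAt (fun s => G s 0 x) (G t 2 x) (Icc 0 T) t := by
    intro t ht x hx
    have ht' := Ioc_subset_Icc_self ht
    have := hu.equation t ht x hx
    rw [hd2 t ht' hx] at this
    exact this.congr (fun s hs => ((hG s hs).2 hx).symm) ((hG t ht').2 hx).symm
  intro t ht x hx
  -- The equation is assumed only for positive times. At t = 0 the one-sided derivative is the limit
  -- of U 2 as t → 0, which exists by continuity in time.
  rcases ht.1.eq_or_lt with h0 | h0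
  · subst h0
    have hpos' : ∀ s ∈ Ioo 0 T, HasDerivAt (fun s => G s 0 x) (G s 2 x) s := fun s hs =>
      (hpos s (Ioo_subset_Ioc_self hs) x hx).hasDerivAt (Icc_mem_nhds hs.1 hs.2)
    have hu0 := unif_of_continuousOn (U := fun i t x => G t i x) hch hcont
    refine (hasDerivWithinAt_Ici_of_tendsto_deriv (s := Ioo 0 T)
      (fun s hs => (hpos' s hs).differentiableAt.differentiableWithinAt) ?_
      (Ioo_mem_nhdsGT hT) ?_).mono Icc_subset_Ici_self
    · refine ContinuousWithinAt.mono ?_ Ioo_subset_Icc_self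
      rw [Metric.continuousWithinAt_iff]
      intro ε hε
      obtain ⟨δ, hδ, h⟩ := hu0 0 (by omega) 0 ht (ε / 2) (by positivity)
      exact ⟨δ, hδ, fun s hs hst => (h s hs hst x hx).trans_lt (by linarith)⟩
    · rw [Metric.tendsto_nhdsWithin_nhds]
      intro ε hε
      obtain ⟨δ, hδ, h⟩ := hu0 2 hn 0 ht (ε / 2) (by positivity)
      refine ⟨min δ T, by positivity, fun s hs hst => ?_⟩
      have hs0 : 0 < s := hs
      rw [Real.dist_eq, sub_zero, abs_of_pos hs0] at hst
      have hsT : s < T := hst.trans_le (min_le_right _ _)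
      rw [(hpos' s ⟨hs0, hsT⟩).deriv]
      refine (h s ⟨hs0.le, hsT.le⟩ ?_ x hx).trans_lt (by linarith)
      rw [sub_zero, abs_of_pos hs0]
      exact hst.trans_le (min_le_left _ _)
  · exact hpos t ⟨h0, ht.2⟩ x hx

end LDG


/-! ### Legendre polynomials of a cell. -/

namespace LDG

open Set Filter Topology MeasureTheory Polynomial

/-! ### Integrals of polynomials -/

theorem intervalIntegrable_eval (a b : ℝ) (p : ℝ[X]) :
    IntervalIntegrable (fun x => p.eval x) volume a b :=
  p.continuous.intervalIntegrable _ _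

/-- The integral of polynomials over `(a, b)` as a linear form. -/
noncomputable def polyInt (a b : ℝ) : ℝ[X] →ₗ[ℝ] ℝ where
  toFun p := ∫ x in a..b, p.eval x
  map_add' p q := by
    simp only [eval_add]
    exact intervalIntegral.integral_add (intervalIntegrable_eval a b p)
      (intervalIntegrable_eval a b q)
  map_smul' c p := by simp [intervalIntegral.integral_const_mul]

theorem polyInt_apply (a b : ℝ) (p : ℝ[X]) : polyInt a b p = ∫ x in a..b, p.eval x := rfl

theorem integral_eval_mul_eval (a b : ℝ) (p q : ℝ[X]) :
    ∫ x in a..b, p.eval x * q.eval x = polyInt a b (p * q) := by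
  simp [polyInt_apply]

theorem polyInt_C_mul (a b c : ℝ) (p : ℝ[X]) : polyInt a b (C c * p) = c * polyInt a b p := by
  rw [← smul_eq_C_mul, map_smul, smul_eq_mul]

theorem polyInt_derivative (a b : ℝ) (p : ℝ[X]) :
    polyInt a b (derivative p) = p.eval b - p.eval a :=
  intervalIntegral.integral_eq_sub_of_hasDerivAt (fun x _ => p.hasDerivAt x)
    (intervalIntegrable_eval a b _)

theorem polyInt_derivative_mul (a b : ℝ) (p q : ℝ[X]) : polyInt a b (derivative p * q) =
    p.eval b * q.eval b - p.eval a * q.eval a - polyInt a b (p * derivative q) := by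
  have := polyInt_derivative a b (p * q)
  rw [derivative_mul, map_add, eval_mul, eval_mul] at this
  linarith

theorem polyInt_sq_nonneg {a b : ℝ} (hab : a ≤ b) (p : ℝ[X]) : 0 ≤ polyInt a b (p * p) := by
  rw [polyInt_apply]
  refine intervalIntegral.integral_nonneg hab fun x _ => ?_
  rw [eval_mul]; exact mul_self_nonneg _

theorem eq_zero_of_polyInt_sq_eq_zero {a b : ℝ} (hab : a < b) {p : ℝ[X]}
    (h : polyInt a b (p * p) = 0) : p = 0 := by
  rw [polyInt_apply] at h
  have hc : ContinuousOn (fun x => (p * p).eval x) (Icc a b) := (p * p).continuous.continuousOn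
  have h0 : ∀ x ∈ Icc a b, p.eval x = 0 := by
    by_contra! hcon
    obtain ⟨x, hx, hne⟩ := hcon
    have := intervalIntegral.integral_pos hab hc
      (fun y _ => by rw [eval_mul]; exact mul_self_nonneg _)
      ⟨x, hx, by rw [eval_mul]; exact mul_self_pos.2 hne⟩
    linarith
  exact eq_zero_of_infinite_isRoot p ((Icc_infinite hab).mono h0)

/-- Each integration by parts moves a derivative to q without boundary terms, and fewer than n
differentiations make q constant. With W = X^m(1 − X)^m, Rodrigues' formula makes this the
orthogonality of the Legendre polynomials. -/
theorem polyInt_iterate_derivative_mul {a b : ℝ} {W : ℝ[X]} {m : ℕ}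
    (hW : ∀ j < m, (derivative^[j] W).eval a = 0 ∧ (derivative^[j] W).eval b = 0) :
    ∀ n ≤ m, ∀ q : ℝ[X], q.natDegree < n → polyInt a b (derivative^[n] W * q) = 0 := by
  intro n
  induction n with
  | zero => intro _ q hq; omega
  | succ n ih =>
    intro hn q hq
    rw [Function.iterate_succ_apply', polyInt_derivative_mul, (hW n hn).1, (hW n hn).2]
    rcases Nat.eq_zero_or_pos q.natDegree with h0 | h0
    · rw [derivative_of_natDegree_zero h0]; simp
    · rw [ih (by omega) _ ((natDegree_derivative_lt h0.ne').trans_le (by omega))]; ring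

/-! ### Legendre polynomials -/

/-- The shifted Legendre polynomial with real coefficients. -/
noncomputable def sleg (m : ℕ) : ℝ[X] := (shiftedLegendre m).map (Int.castRingHom ℝ)

theorem natDegree_sleg (m : ℕ) : (sleg m).natDegree = m := by
  rw [sleg, natDegree_map_eq_of_injective (RingHom.injective_int _), natDegree_shiftedLegendre]

theorem eval_sleg (m : ℕ) (y : ℝ) : (sleg m).eval y = aeval y (shiftedLegendre m) := by
  rw [sleg, eval_map, aeval_def]; rfl

theorem eval_sleg_zero (m : ℕ) : (sleg m).eval 0 = 1 := by
  rw [← coeff_zero_eq_eval_zero, sleg, coeff_map, coeff_shiftedLegendre]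
  simp

theorem eval_sleg_one (m : ℕ) : (sleg m).eval 1 = (-1) ^ m := by
  rw [eval_sleg, shiftedLegendre_eval_symm, sub_self, ← eval_sleg, eval_sleg_zero, mul_one]

theorem polyInt_sleg_mul {m : ℕ} {q : ℝ[X]} (hq : q.natDegree < m) :
    polyInt 0 1 (sleg m * q) = 0 := by
  have hR : C (m.factorial : ℝ) * sleg m = derivative^[m] (X ^ m * (1 - X) ^ m) := by
    have := congrArg (Polynomial.map (Int.castRingHom ℝ)) (factorial_mul_shiftedLegendre_eq m)
    rw [← iterate_derivative_map] at this
    simpa [sleg] using this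
  have hz : ∀ j < m, ∀ (e : ℝ) (p r : ℝ[X]), p.eval e = 0 →
      (derivative^[j] (p ^ m * r)).eval e = 0 := by
    intro j hj e p r hp
    have hd := pow_sub_dvd_iterate_derivative_of_pow_dvd j (Dvd.intro r rfl : p ^ m ∣ p ^ m * r)
    obtain ⟨s, hs⟩ := hd
    rw [hs, eval_mul, eval_pow, hp, zero_pow (by omega), zero_mul]
  have key := polyInt_iterate_derivative_mul (a := 0) (b := 1)
    (W := X ^ m * (1 - X : ℝ[X]) ^ m) (m := m) (fun j hj =>
      ⟨hz j hj 0 X _ (by simp), by rw [mul_comm]; exact hz j hj 1 (1 - X) _ (by simp)⟩) m le_rfl q hq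
  rw [← hR, mul_assoc, polyInt_C_mul] at key
  exact (mul_eq_zero.1 key).resolve_left (by positivity)

/-- The affine map of `(a, b)` onto `(0, 1)` sending `b` to `0`, as a polynomial. -/
noncomputable def cellMap (a b : ℝ) : ℝ[X] := C (1 / (b - a)) * (C b - X)

theorem eval_cellMap (a b x : ℝ) : (cellMap a b).eval x = (b - x) / (b - a) := by
  simp [cellMap]; ring

theorem natDegree_cellMap {a b : ℝ} (hab : a < b) : (cellMap a b).natDegree = 1 := by
  rw [cellMap, natDegree_C_mul (by have := sub_pos.2 hab; positivity), natDegree_sub]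
  exact natDegree_X_sub_C b

/-- The Legendre polynomial of degree `m` of the cell `(a, b)`. -/
noncomputable def legP (a b : ℝ) (m : ℕ) : ℝ[X] := (sleg m).comp (cellMap a b)

theorem eval_legP (a b : ℝ) (m : ℕ) (x : ℝ) : (legP a b m).eval x = legendre a b m x := by
  rw [legP, eval_comp, eval_cellMap, eval_sleg, legendre]

theorem eval_legP_eq (a b : ℝ) (m : ℕ) (x : ℝ) :
    (legP a b m).eval x = (sleg m).eval ((b - x) / (b - a)) := by
  rw [legP, eval_comp, eval_cellMap]

theorem natDegree_legP {a b : ℝ} (hab : a < b) (m : ℕ) : (legP a b m).natDegree = m := by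
  rw [legP, natDegree_comp, natDegree_sleg, natDegree_cellMap hab, mul_one]

theorem polyInt_comp_cellMap {a b : ℝ} (hab : a < b) (p : ℝ[X]) :
    polyInt a b (p.comp (cellMap a b)) = (b - a) * polyInt 0 1 p := by
  have hne : b - a ≠ 0 := (sub_pos.2 hab).ne'
  have h := intervalIntegral.integral_comp_sub_div (a := a) (b := b) (fun y => p.eval y) hne
    (b / (b - a))
  have e1 : b / (b - a) - a / (b - a) = 1 := by field_simp
  rw [sub_self, e1] at h
  rw [polyInt_apply, polyInt_apply, ← smul_eq_mul, ← h]
  congr 1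
  funext x
  rw [eval_comp, eval_cellMap, sub_div]

theorem polyInt_legP_mul {a b : ℝ} (hab : a < b) {m : ℕ} {q : ℝ[X]} (hq : q.natDegree < m) :
    polyInt a b (legP a b m * q) = 0 := by
  have hne : b - a ≠ 0 := (sub_pos.2 hab).ne'
  set r : ℝ[X] := q.comp (C b - C (b - a) * X) with hr
  have hqr : q = r.comp (cellMap a b) := by
    rw [hr, comp_assoc]
    have : (C b - C (b - a) * X).comp (cellMap a b) = X := by
      simp only [sub_comp, mul_comp, C_comp, X_comp, cellMap]
      rw [← mul_assoc, ← C_mul, mul_one_div_cancel hne]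
      simp
    rw [this, comp_X]
  have hdeg : r.natDegree < m := by
    refine lt_of_le_of_lt (natDegree_comp_le.trans ?_) hq
    have : (C b - C (b - a) * X : ℝ[X]).natDegree ≤ 1 := by compute_degree
    calc _ ≤ q.natDegree * 1 := Nat.mul_le_mul le_rfl this
      _ = _ := mul_one _
  rw [hqr, legP, ← mul_comp, polyInt_comp_cellMap hab, polyInt_sleg_mul hdeg, mul_zero]

theorem eval_legP_right (a b : ℝ) (m : ℕ) : (legP a b m).eval b = 1 := by
  rw [eval_legP_eq, sub_self, zero_div, eval_sleg_zero]

theorem eval_legP_left {a b : ℝ} (hab : a < b) (m : ℕ) : (legP a b m).eval a = (-1) ^ m := by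
  rw [eval_legP_eq, div_self (sub_pos.2 hab).ne', eval_sleg_one]

/-- With c the midpoint, (x − c)L' − mL has degree below m, so ∫ L(x − c)L' = m∫L². Integrating the
derivative of (x − c)L² then gives (2m + 1)∫L² = b − a, since L² = 1 at both ends. -/
theorem polyInt_legP_sq {a b : ℝ} (hab : a < b) (m : ℕ) :
    polyInt a b (legP a b m * legP a b m) = (b - a) / (2 * m + 1) := by
  set L := legP a b m with hL
  have hdeg : L.natDegree = m := natDegree_legP hab m
  set c : ℝ := (a + b) / 2
  have key : polyInt a b (L * ((X - C c) * derivative L)) = m * polyInt a b (L * L) := by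
    have e : L * ((X - C c) * derivative L) =
        L * ((X - C c) * derivative L - C (m : ℝ) * L) + C (m : ℝ) * (L * L) := by ring
    rw [e, map_add, polyInt_C_mul]
    rcases Nat.eq_zero_or_pos m with h0 | h0
    · have : derivative L = 0 := derivative_of_natDegree_zero (by omega)
      simp [h0, this]
    · rw [polyInt_legP_mul hab, zero_add]
      have hle : ((X - C c) * derivative L - C (m : ℝ) * L).natDegree ≤ m - 1 := by
        rw [natDegree_le_iff_coeff_eq_zero]
        intro N hN
        obtain ⟨N, rfl⟩ : ∃ M, N = M + 1 := ⟨N - 1, by omega⟩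
        rw [coeff_sub, coeff_C_mul, sub_mul, coeff_sub, coeff_X_mul, coeff_C_mul, coeff_derivative,
          coeff_derivative]
        have h2 : L.coeff (N + 1 + 1) = 0 := coeff_eq_zero_of_natDegree_lt (by omega)
        rw [h2]
        rcases Nat.lt_or_ge m (N + 1) with h3 | h3
        · rw [coeff_eq_zero_of_natDegree_lt (by omega : L.natDegree < N + 1)]; ring
        · have : m = N + 1 := by omega
          rw [this]; push_cast; ring
      omega
  have parts := polyInt_derivative a b ((X - C c) * (L * L))
  rw [derivative_mul, derivative_mul, map_add] at parts
  have e2 : (X - C c) * (derivative L * L + L * derivative L) =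
      C 2 * (L * ((X - C c) * derivative L)) := by rw [C_ofNat]; ring
  rw [e2, polyInt_C_mul, key] at parts
  simp only [derivative_sub, derivative_X, derivative_C, sub_zero, one_mul, eval_mul, eval_sub,
    eval_X, eval_C] at parts
  rw [hL, eval_legP_right, eval_legP_left hab, ← hL] at parts
  have hs : (-1 : ℝ) ^ m * (-1) ^ m = 1 := by rw [← mul_pow]; norm_num
  rw [eq_div_iff (by positivity)]
  have e3 : (a - c) * ((-1) ^ m * (-1) ^ m) = a - c := by rw [hs, mul_one]
  rw [e3] at parts
  linarith

theorem polyInt_legP_mul_legP {a b : ℝ} (hab : a < b) {m n : ℕ} (hmn : m ≠ n) :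
    polyInt a b (legP a b m * legP a b n) = 0 := by
  rcases lt_or_gt_of_ne hmn with h | h
  · rw [mul_comm]; exact polyInt_legP_mul hab (by rwa [natDegree_legP hab])
  · exact polyInt_legP_mul hab (by rwa [natDegree_legP hab])

/-- Legendre coefficient of index `m` of a function. -/
noncomputable def legCoef (a b : ℝ) (m : ℕ) (v : ℝ → ℝ) : ℝ :=
  (2 * m + 1) / (b - a) * ∫ x in a..b, v x * (legP a b m).eval x

theorem legCoef_eval (a b : ℝ) (m : ℕ) (p : ℝ[X]) :
    legCoef a b m (fun x => p.eval x) = (2 * m + 1) / (b - a) * polyInt a b (p * legP a b m) := by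
  rw [legCoef, integral_eval_mul_eval]

theorem exists_sub_C_mul_natDegree_le {p q : ℝ[X]} {n : ℕ} (hp : p.natDegree ≤ n + 1)
    (hq : q.natDegree = n + 1) : ∃ c, (p - C c * q).natDegree ≤ n := by
  have hne : q.coeff (n + 1) ≠ 0 := by
    rw [← hq]; exact leadingCoeff_ne_zero.2 (by rintro rfl; simp at hq)
  refine ⟨p.coeff (n + 1) / q.coeff (n + 1), ?_⟩
  rw [natDegree_le_iff_coeff_eq_zero]
  intro N hN
  rw [coeff_sub, coeff_C_mul]
  rcases Nat.lt_or_ge (n + 1) N with h | h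
  · rw [coeff_eq_zero_of_natDegree_lt (hp.trans_lt h), coeff_eq_zero_of_natDegree_lt
      (hq.trans_lt h)]
    ring
  · have : N = n + 1 := by omega
    subst this
    field_simp; ring

theorem exists_eq_sum_legP {a b : ℝ} (hab : a < b) (k : ℕ) :
    ∀ p : ℝ[X], p.natDegree ≤ k →
      ∃ c : ℕ → ℝ, p = ∑ m ∈ Finset.range (k + 1), C (c m) * legP a b m := by
  induction k with
  | zero =>
    intro p hp
    have h1 : legP a b 0 = 1 := by
      have h := eq_C_of_natDegree_eq_zero (natDegree_legP hab 0)
      have h2 := eval_legP_right a b 0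
      rw [h, eval_C] at h2
      rw [h, h2, C_1]
    refine ⟨fun _ => p.coeff 0, ?_⟩
    simp only [zero_add, Finset.range_one, Finset.sum_singleton, h1, mul_one]
    exact eq_C_of_natDegree_le_zero hp
  | succ k ih =>
    intro p hp
    obtain ⟨d, hd⟩ := exists_sub_C_mul_natDegree_le hp (natDegree_legP hab (k + 1))
    obtain ⟨c, hc⟩ := ih _ hd
    refine ⟨Function.update c (k + 1) d, ?_⟩
    rw [Finset.sum_range_succ, Function.update_self]
    have : ∑ m ∈ Finset.range (k + 1), C (Function.update c (k + 1) d m) * legP a b m =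
        ∑ m ∈ Finset.range (k + 1), C (c m) * legP a b m :=
      Finset.sum_congr rfl fun m hm => by
        rw [Function.update_of_ne (by have := Finset.mem_range.1 hm; omega)]
    rw [this, ← hc]; ring

theorem eq_sum_legCoef {a b : ℝ} (hab : a < b) {k : ℕ} {p : ℝ[X]} (hp : p.natDegree ≤ k) :
    p = ∑ m ∈ Finset.range (k + 1), C (legCoef a b m (fun x => p.eval x)) * legP a b m := by
  obtain ⟨c, hc⟩ := exists_eq_sum_legP hab k p hp
  have hcm : ∀ m ∈ Finset.range (k + 1), legCoef a b m (fun x => p.eval x) = c m := by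
    intro m hm
    rw [legCoef_eval]
    nth_rewrite 1 [hc]
    rw [Finset.sum_mul, map_sum, Finset.sum_eq_single m]
    · rw [mul_assoc, polyInt_C_mul, polyInt_legP_sq hab]
      have := sub_pos.2 hab
      field_simp
    · intro n _ hn
      rw [mul_assoc, polyInt_C_mul, polyInt_legP_mul_legP hab hn, mul_zero]
    · intro h; exact absurd hm h
  nth_rewrite 1 [hc]
  exact Finset.sum_congr rfl fun m hm => by rw [hcm m hm]

/-! ### Bounds -/

/-- The sum of the absolute values of the coefficients. -/
noncomputable def coeffBound (p : ℝ[X]) : ℝ := ∑ i ∈ Finset.range (p.natDegree + 1), |p.coeff i|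

theorem coeffBound_nonneg (p : ℝ[X]) : 0 ≤ coeffBound p :=
  Finset.sum_nonneg fun _ _ => abs_nonneg _

theorem abs_eval_le_coeffBound (p : ℝ[X]) {y : ℝ} (h0 : 0 ≤ y) (h1 : y ≤ 1) :
    |p.eval y| ≤ coeffBound p := by
  rw [eval_eq_sum_range]
  refine (Finset.abs_sum_le_sum_abs _ _).trans (Finset.sum_le_sum fun i _ => ?_)
  rw [abs_mul, abs_of_nonneg (pow_nonneg h0 i)]
  exact mul_le_of_le_one_right (abs_nonneg _) (pow_le_one₀ h0 h1)

/-- A bound of the Legendre polynomials of degree at most `k + 1` and their derivatives on the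
reference cell. -/
noncomputable def legBound (k : ℕ) : ℝ :=
  1 + ∑ m ∈ Finset.range (k + 2), (coeffBound (sleg m) + coeffBound (derivative (sleg m)))

theorem one_le_legBound (k : ℕ) : 1 ≤ legBound k :=
  le_add_of_nonneg_right (Finset.sum_nonneg fun _ _ =>
    add_nonneg (coeffBound_nonneg _) (coeffBound_nonneg _))

theorem coeffBound_add_le_legBound {k m : ℕ} (hm : m ≤ k + 1) :
    coeffBound (sleg m) + coeffBound (derivative (sleg m)) ≤ legBound k := by
  have := Finset.single_le_sum (f := fun m => coeffBound (sleg m) + coeffBound (derivative (sleg m)))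
    (fun _ _ => add_nonneg (coeffBound_nonneg _) (coeffBound_nonneg _))
    (Finset.mem_range.2 (by omega : m < k + 2))
  unfold legBound
  linarith

theorem cellMap_mem {a b x : ℝ} (hab : a < b) (hx : x ∈ Icc a b) :
    0 ≤ (b - x) / (b - a) ∧ (b - x) / (b - a) ≤ 1 := by
  have h := sub_pos.2 hab
  exact ⟨div_nonneg (by linarith [hx.2]) h.le, by rw [div_le_one h]; linarith [hx.1]⟩

theorem abs_eval_legP_le {a b x : ℝ} (hab : a < b) {k m : ℕ} (hm : m ≤ k + 1) (hx : x ∈ Icc a b) :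
    |(legP a b m).eval x| ≤ legBound k := by
  rw [eval_legP_eq]
  obtain ⟨h0, h1⟩ := cellMap_mem hab hx
  have := abs_eval_le_coeffBound (sleg m) h0 h1
  linarith [coeffBound_add_le_legBound hm, coeffBound_nonneg (derivative (sleg m))]

theorem abs_eval_derivative_legP_le {a b x : ℝ} (hab : a < b) {k m : ℕ} (hm : m ≤ k + 1)
    (hx : x ∈ Icc a b) : |(derivative (legP a b m)).eval x| ≤ legBound k / (b - a) := by
  have h := sub_pos.2 hab
  rw [legP, derivative_comp, eval_mul, eval_comp, eval_cellMap]
  obtain ⟨h0, h1⟩ := cellMap_mem hab hx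
  have := abs_eval_le_coeffBound (derivative (sleg m)) h0 h1
  have e : (derivative (cellMap a b)).eval x = -(1 / (b - a)) := by
    simp [cellMap]
  rw [e, abs_mul, abs_neg, abs_of_pos (by positivity : 0 < 1 / (b - a)), one_div_mul_eq_div]
  gcongr
  linarith [coeffBound_add_le_legBound hm, coeffBound_nonneg (sleg m)]

end LDG


/-! ### Gauss–Radau projections, correction functions and inverse inequalities. -/

namespace LDG

open Set Filter Topology MeasureTheory Polynomial

/-! ### Moments against polynomials -/

/-- The moment of `v` against the polynomial `w`. -/
noncomputable def mom (a b : ℝ) (v : ℝ → ℝ) (w : ℝ[X]) : ℝ := ∫ x in a..b, v x * w.eval x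

theorem mom_eval (a b : ℝ) (p w : ℝ[X]) : mom a b (fun x => p.eval x) w = polyInt a b (p * w) :=
  integral_eval_mul_eval a b p w

theorem intervalIntegrable_mul_eval {a b : ℝ} (hab : a ≤ b) {v : ℝ → ℝ}
    (hv : ContinuousOn v (Icc a b)) (w : ℝ[X]) :
    IntervalIntegrable (fun x => v x * w.eval x) volume a b :=
  ContinuousOn.intervalIntegrable (by
    rw [uIcc_of_le hab]; exact hv.mul w.continuous.continuousOn)

theorem mom_C_mul (a b c : ℝ) (v : ℝ → ℝ) (w : ℝ[X]) : mom a b v (C c * w) = c * mom a b v w := by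
  unfold mom
  rw [← intervalIntegral.integral_const_mul]
  congr 1; funext x; rw [eval_mul, eval_C]; ring

theorem mom_sum {a b : ℝ} (hab : a ≤ b) {v : ℝ → ℝ} (hv : ContinuousOn v (Icc a b))
    (s : Finset ℕ) (w : ℕ → ℝ[X]) : mom a b v (∑ i ∈ s, w i) = ∑ i ∈ s, mom a b v (w i) := by
  unfold mom
  rw [← intervalIntegral.integral_finsetSum fun i _ => intervalIntegrable_mul_eval hab hv (w i)]
  congr 1; funext x; rw [eval_finsetSum, Finset.mul_sum]

theorem mom_sub {a b : ℝ} (hab : a ≤ b) {v v' : ℝ → ℝ} (hv : ContinuousOn v (Icc a b))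
    (hv' : ContinuousOn v' (Icc a b)) (w : ℝ[X]) :
    mom a b (fun x => v x - v' x) w = mom a b v w - mom a b v' w := by
  unfold mom
  rw [← intervalIntegral.integral_sub (intervalIntegrable_mul_eval hab hv w)
    (intervalIntegrable_mul_eval hab hv' w)]
  congr 1; funext x; ring

theorem abs_mom_le {a b V W : ℝ} (hab : a ≤ b) {v : ℝ → ℝ} {w : ℝ[X]}
    (hv : ∀ x ∈ Icc a b, |v x| ≤ V) (hw : ∀ x ∈ Icc a b, |w.eval x| ≤ W) :
    |mom a b v w| ≤ V * W * (b - a) := by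
  have hV : 0 ≤ V := (abs_nonneg _).trans (hv a (left_mem_Icc.2 hab))
  have := intervalIntegral.norm_integral_le_of_norm_le_const (a := a) (b := b)
    (f := fun x => v x * w.eval x) (C := V * W) (fun x hx => by
      rw [uIoc_of_le hab] at hx
      have hx := Ioc_subset_Icc_self hx
      rw [norm_mul]
      exact mul_le_mul (hv x hx) (hw x hx) (abs_nonneg _) hV)
  rwa [abs_of_nonneg (sub_nonneg.2 hab)] at this

theorem legCoef_eq (a b : ℝ) (m : ℕ) (v : ℝ → ℝ) :
    legCoef a b m v = (2 * m + 1) / (b - a) * mom a b v (legP a b m) := rfl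

theorem abs_legCoef_le {a b V : ℝ} (hab : a < b) {k m : ℕ} (hm : m ≤ k) {v : ℝ → ℝ}
    (hv : ∀ x ∈ Icc a b, |v x| ≤ V) : |legCoef a b m v| ≤ (2 * k + 1) * legBound k * V := by
  have h := sub_pos.2 hab
  have hV : 0 ≤ V := (abs_nonneg _).trans (hv a (left_mem_Icc.2 hab.le))
  have h1 := abs_mom_le hab.le hv (fun x hx => abs_eval_legP_le hab (k := k) (by omega : m ≤ k + 1) hx)
  rw [legCoef_eq, abs_mul, abs_of_nonneg (by positivity)]
  have hm' : (m : ℝ) ≤ k := by exact_mod_cast hm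
  have hL := one_le_legBound k
  calc (2 * (m : ℝ) + 1) / (b - a) * |mom a b v (legP a b m)|
      ≤ (2 * (k : ℝ) + 1) / (b - a) * (V * legBound k * (b - a)) := by gcongr
    _ = (2 * k + 1) * legBound k * V := by field_simp

/-! ### The Gauss–Radau projection -/

/-- `e` is an end point of `(a, b)`, and `σ` the value of `L_1` there. -/
def IsEnd (a b e σ : ℝ) : Prop := (e = b ∧ σ = 1) ∨ (e = a ∧ σ = -1)

theorem IsEnd.eval_legP {a b e σ : ℝ} (hab : a < b) (he : IsEnd a b e σ) (m : ℕ) :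
    (legP a b m).eval e = σ ^ m := by
  rcases he with ⟨rfl, rfl⟩ | ⟨rfl, rfl⟩
  · rw [eval_legP_right, one_pow]
  · rw [eval_legP_left hab]

theorem IsEnd.mem {a b e σ : ℝ} (hab : a ≤ b) (he : IsEnd a b e σ) : e ∈ Icc a b := by
  rcases he with ⟨rfl, rfl⟩ | ⟨rfl, rfl⟩
  · exact right_mem_Icc.2 hab
  · exact left_mem_Icc.2 hab

theorem IsEnd.pow_mul_pow {a b e σ : ℝ} (he : IsEnd a b e σ) (k : ℕ) : σ ^ k * σ ^ k = 1 := by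
  rcases he with ⟨rfl, rfl⟩ | ⟨rfl, rfl⟩
  · simp
  · rw [← mul_pow]; norm_num

theorem IsEnd.abs_pow {a b e σ : ℝ} (he : IsEnd a b e σ) (k : ℕ) : |σ ^ k| = 1 := by
  rcases he with ⟨rfl, rfl⟩ | ⟨rfl, rfl⟩ <;> simp

/-- The Legendre coefficients of the Gauss–Radau projection. -/
noncomputable def grCoef (k : ℕ) (a b e σ : ℝ) (v : ℝ → ℝ) (m : ℕ) : ℝ :=
  if m = k then σ ^ k * (v e - ∑ n ∈ Finset.range k, legCoef a b n v * σ ^ n)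
  else legCoef a b m v

/-- The Gauss–Radau projection, by its Legendre expansion. -/
noncomputable def grPoly (k : ℕ) (a b e σ : ℝ) (v : ℝ → ℝ) : ℝ[X] :=
  ∑ m ∈ Finset.range (k + 1), C (grCoef k a b e σ v m) * legP a b m

theorem natDegree_sum_C_mul_legP_le {a b : ℝ} (hab : a < b) (k : ℕ) (c : ℕ → ℝ) :
    (∑ m ∈ Finset.range (k + 1), C (c m) * legP a b m).natDegree ≤ k :=
  natDegree_sum_le_of_forall_le _ _ fun m hm => (natDegree_C_mul_le _ _).trans (by
    rw [natDegree_legP hab]; have := Finset.mem_range.1 hm; omega)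

theorem polyInt_sum_mul_legP {a b : ℝ} (hab : a < b) {k n : ℕ} (hn : n ≤ k) (c : ℕ → ℝ) :
    polyInt a b ((∑ m ∈ Finset.range (k + 1), C (c m) * legP a b m) * legP a b n) =
      c n * ((b - a) / (2 * n + 1)) := by
  rw [Finset.sum_mul, map_sum, Finset.sum_eq_single n]
  · rw [mul_assoc, polyInt_C_mul, polyInt_legP_sq hab]
  · intro m _ hm
    rw [mul_assoc, polyInt_C_mul, polyInt_legP_mul_legP hab hm, mul_zero]
  · intro h; exact absurd (Finset.mem_range.2 (by omega)) h

theorem isGaussRadau_grPoly {k : ℕ} {a b e σ : ℝ} (hab : a < b) (he : IsEnd a b e σ) {v : ℝ → ℝ}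
    (hv : ContinuousOn v (Icc a b)) : IsGaussRadau k a b e v (grPoly k a b e σ v) := by
  have h := sub_pos.2 hab
  refine ⟨natDegree_sum_C_mul_legP_le hab k _, fun w hw => ?_, ?_⟩
  · change mom a b (fun x => (grPoly k a b e σ v).eval x) w = mom a b v w
    have hw1 := eq_sum_legCoef hab (k := k - 1) (by omega : w.natDegree ≤ k - 1)
    rw [hw1, mom_sum hab.le hv, mom_sum hab.le (Polynomial.continuous _).continuousOn]
    refine Finset.sum_congr rfl fun n hn => ?_
    have hn' : n < k := by have := Finset.mem_range.1 hn; omega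
    rw [mom_C_mul, mom_C_mul, mom_eval, grPoly, polyInt_sum_mul_legP hab hn'.le, grCoef,
      if_neg hn'.ne]
    congr 1
    rw [legCoef_eq]
    field_simp
  · rw [grPoly, eval_finsetSum, Finset.sum_range_succ]
    simp only [eval_mul, eval_C, he.eval_legP hab]
    have : ∑ m ∈ Finset.range k, grCoef k a b e σ v m * σ ^ m =
        ∑ m ∈ Finset.range k, legCoef a b m v * σ ^ m :=
      Finset.sum_congr rfl fun m hm => by
        rw [grCoef, if_neg (Finset.mem_range.1 hm).ne]
    rw [this, grCoef, if_pos rfl]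
    linear_combination (v e - ∑ n ∈ Finset.range k, legCoef a b n v * σ ^ n) * he.pow_mul_pow k

/-- The moments force the difference to be a multiple of L_k, which does not vanish at an end of the
cell. -/
theorem IsGaussRadau.unique {k : ℕ} {a b e σ : ℝ} (hab : a < b) (he : IsEnd a b e σ) {v : ℝ → ℝ}
    {p q : ℝ[X]} (hp : IsGaussRadau k a b e v p) (hq : IsGaussRadau k a b e v q) : p = q := by
  set d := p - q with hd
  have hdeg : d.natDegree ≤ k := (natDegree_sub_le _ _).trans (max_le hp.1 hq.1)
  have hmom : ∀ w : ℝ[X], w.natDegree < k → polyInt a b (d * w) = 0 := by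
    intro w hw
    have := (hp.2.1 w hw).trans (hq.2.1 w hw).symm
    rw [integral_eval_mul_eval, integral_eval_mul_eval] at this
    rw [hd, sub_mul, map_sub, this, sub_self]
  have hexp := eq_sum_legCoef hab hdeg
  rw [Finset.sum_range_succ, Finset.sum_eq_zero, zero_add] at hexp
  · have h0 : d.eval e = 0 := by rw [hd, eval_sub, hp.2.2, hq.2.2, sub_self]
    rw [hexp, eval_mul, eval_C, he.eval_legP hab] at h0
    have hσ : σ ^ k ≠ 0 := fun h => by have := he.pow_mul_pow k; rw [h] at this; simp at this
    rw [(mul_eq_zero.1 h0).resolve_right hσ, C_0, zero_mul] at hexp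
    exact sub_eq_zero.1 hexp
  · intro m hm
    rw [legCoef_eval, hmom _ (by rw [natDegree_legP hab]; exact Finset.mem_range.1 hm), mul_zero,
      C_0, zero_mul]

theorem gaussRadau_spec {k : ℕ} {a b e σ : ℝ} (hab : a < b) (he : IsEnd a b e σ) {v : ℝ → ℝ}
    (hv : ContinuousOn v (Icc a b)) : IsGaussRadau k a b e v (gaussRadau k a b e v) :=
  Classical.epsilon_spec ⟨_, isGaussRadau_grPoly hab he hv⟩

theorem gaussRadau_eq {k : ℕ} {a b e σ : ℝ} (hab : a < b) (he : IsEnd a b e σ) {v : ℝ → ℝ}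
    {p : ℝ[X]} (hp : IsGaussRadau k a b e v p) : gaussRadau k a b e v = p :=
  IsGaussRadau.unique hab he (Classical.epsilon_spec ⟨p, hp⟩) hp

theorem gaussRadau_eq_grPoly {k : ℕ} {a b e σ : ℝ} (hab : a < b) (he : IsEnd a b e σ) {v : ℝ → ℝ}
    (hv : ContinuousOn v (Icc a b)) : gaussRadau k a b e v = grPoly k a b e σ v :=
  gaussRadau_eq hab he (isGaussRadau_grPoly hab he hv)

/-- The stability constant of the Gauss–Radau projection in the maximum norm. -/
noncomputable def grBound (k : ℕ) : ℝ := ((2 * k + 1) * legBound k) ^ 2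

theorem one_le_grBound (k : ℕ) : 1 ≤ grBound k := by
  have := one_le_legBound k
  have hk : (0 : ℝ) ≤ k := by positivity
  exact one_le_pow₀ (one_le_mul_of_one_le_of_one_le (by linarith) this)

theorem abs_eval_gaussRadau_le {k : ℕ} {a b e σ V x : ℝ} (hab : a < b) (he : IsEnd a b e σ)
    {v : ℝ → ℝ} (hv : ContinuousOn v (Icc a b)) (hV : ∀ x ∈ Icc a b, |v x| ≤ V)
    (hx : x ∈ Icc a b) : |(gaussRadau k a b e v).eval x| ≤ grBound k * V := by
  have hV0 : 0 ≤ V := (abs_nonneg _).trans (hV a (left_mem_Icc.2 hab.le))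
  have hL := one_le_legBound k
  set Λ := legBound k with hΛ
  set M := (2 * (k : ℝ) + 1) * Λ * V with hM
  have hM0 : 0 ≤ M := by positivity
  have h1 : ∀ m ∈ Finset.range k, |legCoef a b m v| ≤ M := fun m hm =>
    abs_legCoef_le hab (Finset.mem_range.1 hm).le hV
  rw [gaussRadau_eq_grPoly hab he hv, grPoly, eval_finsetSum, Finset.sum_range_succ]
  simp only [eval_mul, eval_C]
  have h2 : |∑ m ∈ Finset.range k, grCoef k a b e σ v m * (legP a b m).eval x| ≤ k * (M * Λ) := by
    refine (Finset.abs_sum_le_sum_abs _ _).trans ?_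
    refine (Finset.sum_le_card_nsmul _ _ (M * Λ) fun m hm => ?_).trans (le_of_eq (by simp))
    have hm' := Finset.mem_range.1 hm
    rw [abs_mul, grCoef, if_neg hm'.ne]
    exact mul_le_mul (h1 m hm) (abs_eval_legP_le hab (by omega) hx) (abs_nonneg _) hM0
  have h3 : |∑ n ∈ Finset.range k, legCoef a b n v * σ ^ n| ≤ k * M := by
    refine (Finset.abs_sum_le_sum_abs _ _).trans ?_
    refine (Finset.sum_le_card_nsmul _ _ M fun m hm => ?_).trans (le_of_eq (by simp))
    rw [abs_mul, he.abs_pow, mul_one]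
    exact h1 m hm
  have h4 : |grCoef k a b e σ v k * (legP a b k).eval x| ≤ (V + k * M) * Λ := by
    rw [abs_mul, grCoef, if_pos rfl, abs_mul, he.abs_pow, one_mul]
    refine mul_le_mul ((abs_sub _ _).trans (add_le_add (hV e (he.mem hab.le)) h3))
      (abs_eval_legP_le hab (by omega) hx) (abs_nonneg _) (by positivity)
  refine (abs_add_le _ _).trans ((add_le_add h2 h4).trans ?_)
  have hk0 : (0 : ℝ) ≤ k := by positivity
  have e1 : grBound k * V = (4 * k ^ 2 + 4 * k + 1) * (Λ ^ 2 * V) := by rw [grBound, ← hΛ]; ring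
  have e2 : k * (M * Λ) + (V + k * M) * Λ = (4 * k ^ 2 + 2 * k) * (Λ ^ 2 * V) + Λ * V := by
    rw [hM]; ring
  have h5 : Λ * V ≤ Λ ^ 2 * V := by
    rw [sq, mul_assoc]; exact le_mul_of_one_le_left (by positivity) hL
  have h6 : 0 ≤ 2 * (k : ℝ) * (Λ ^ 2 * V) := by positivity
  rw [e1, e2]
  linarith

theorem gaussRadau_eval {k : ℕ} {a b e σ : ℝ} (hab : a < b) (he : IsEnd a b e σ) {p : ℝ[X]}
    (hp : p.natDegree ≤ k) : gaussRadau k a b e (fun x => p.eval x) = p :=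
  gaussRadau_eq hab he ⟨hp, fun _ _ => rfl, rfl⟩

theorem gaussRadau_sub {k : ℕ} {a b e σ : ℝ} (hab : a < b) (he : IsEnd a b e σ) {v w : ℝ → ℝ}
    (hv : ContinuousOn v (Icc a b)) (hw : ContinuousOn w (Icc a b)) :
    gaussRadau k a b e (fun x => v x - w x) = gaussRadau k a b e v - gaussRadau k a b e w := by
  have h1 := gaussRadau_spec (k := k) hab he hv
  have h2 := gaussRadau_spec (k := k) hab he hw
  refine gaussRadau_eq hab he ⟨(natDegree_sub_le _ _).trans (max_le h1.1 h2.1), fun r hr => ?_, ?_⟩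
  · change _ = mom a b _ r
    rw [mom_sub hab.le hv hw, integral_eval_mul_eval, sub_mul, map_sub, ← integral_eval_mul_eval,
      ← integral_eval_mul_eval, h1.2.1 r hr, h2.2.1 r hr]
    rfl
  · rw [eval_sub, h1.2.2, h2.2.2]

theorem gaussRadau_congr {k : ℕ} {a b e σ : ℝ} (hab : a < b) (he : IsEnd a b e σ) {v w : ℝ → ℝ}
    (hw : ContinuousOn w (Icc a b)) (h : EqOn v w (Icc a b)) :
    gaussRadau k a b e v = gaussRadau k a b e w := by
  have h2 := gaussRadau_spec (k := k) hab he hw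
  refine gaussRadau_eq hab he ⟨h2.1, fun r hr => ?_, ?_⟩
  · rw [h2.2.1 r hr]
    refine intervalIntegral.integral_congr fun x hx => ?_
    rw [uIcc_of_le hab.le] at hx
    simp only [h hx]
  · rw [h2.2.2, h (he.mem hab.le)]

/-- Superconvergence of the Gauss–Radau projection at the Radau points. -/
theorem abs_sub_gaussRadau_le_of_radau {k : ℕ} {a b e σ ε x : ℝ} (hab : a < b)
    (he : IsEnd a b e σ) {v : ℝ → ℝ} (hv : ContinuousOn v (Icc a b)) {p : ℝ[X]}
    (hp : p.natDegree ≤ k + 1) (hε : ∀ x ∈ Icc a b, |v x - p.eval x| ≤ ε) (hx : x ∈ Icc a b)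
    (hR : legendre a b (k + 1) x - σ * legendre a b k x = 0) :
    |v x - (gaussRadau k a b e v).eval x| ≤ (1 + grBound k) * ε := by
  -- L_{k+1} − σL_k is orthogonal to degrees below k and vanishes at e, so the projection of p
  -- subtracts the multiple of it that cancels the degree k + 1. It leaves p unchanged at the Radau
  -- points, and stability of the projection handles v − p.
  obtain ⟨c, hc⟩ : ∃ c, (p - C c * (legP a b (k + 1) - C σ * legP a b k)).natDegree ≤ k := by
    refine exists_sub_C_mul_natDegree_le hp ?_
    rw [natDegree_sub_eq_left_of_natDegree_lt, natDegree_legP hab]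
    refine (natDegree_C_mul_le _ _).trans_lt ?_
    rw [natDegree_legP hab, natDegree_legP hab]
    omega
  set q := p - C c * (legP a b (k + 1) - C σ * legP a b k) with hq
  have hGp : gaussRadau k a b e (fun x => p.eval x) = q := by
    refine gaussRadau_eq hab he ⟨hc, fun w hw => ?_, ?_⟩
    · rw [integral_eval_mul_eval, integral_eval_mul_eval, hq, sub_mul, map_sub, mul_assoc,
        polyInt_C_mul, sub_mul, map_sub, mul_assoc, polyInt_C_mul,
        polyInt_legP_mul hab (hw.trans (Nat.lt_succ_self k)), polyInt_legP_mul hab hw]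
      ring
    · rw [hq, eval_sub, eval_mul, eval_sub, eval_mul, he.eval_legP hab, he.eval_legP hab, eval_C,
        eval_C, pow_succ]
      ring
  have hqx : q.eval x = p.eval x := by
    rw [hq, eval_sub, eval_mul, eval_sub, eval_mul, eval_legP, eval_legP, eval_C, eval_C, hR]
    ring
  have h1 := gaussRadau_sub (k := k) hab he hv p.continuous.continuousOn
  have h2 := abs_eval_gaussRadau_le (k := k) (v := fun x => v x - p.eval x) hab he
    (hv.sub p.continuous.continuousOn) hε hx
  rw [h1, hGp, eval_sub, hqx] at h2
  have e1 : v x - (gaussRadau k a b e v).eval x =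
      (v x - p.eval x) - ((gaussRadau k a b e v).eval x - p.eval x) := by ring
  rw [e1]
  refine (abs_sub _ _).trans ?_
  linarith [hε x hx]

/-! ### The Legendre coefficient of index `k` of the projection error -/

/-- The Legendre coefficient of index `k` of the error of the Gauss–Radau projection at `e`. -/
noncomputable def endCoef (k : ℕ) (a b e σ : ℝ) (v : ℝ → ℝ) : ℝ :=
  -σ ^ k * v e + 1 / (b - a) * ∫ x in a..b, v x *
    ∑ m ∈ Finset.range (k + 1), σ ^ (k + m) * (2 * (m : ℝ) + 1) * legendre a b m x

theorem coeffMinus_eq (k : ℕ) (a b : ℝ) (v : ℝ → ℝ) : coeffMinus k a b v = endCoef k a b b 1 v := by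
  simp [coeffMinus, endCoef]

theorem coeffPlus_eq (k : ℕ) (a b : ℝ) (v : ℝ → ℝ) :
    coeffPlus k a b v = endCoef k a b a (-1) v := by
  rw [coeffPlus, endCoef, pow_succ]; ring

/-- The kernel of `endCoef`. -/
noncomputable def endKernel (k : ℕ) (a b σ : ℝ) : ℝ[X] :=
  ∑ m ∈ Finset.range (k + 1), C (σ ^ (k + m) * (2 * (m : ℝ) + 1)) * legP a b m

theorem endCoef_eq (k : ℕ) (a b e σ : ℝ) (v : ℝ → ℝ) :
    endCoef k a b e σ v = -σ ^ k * v e + 1 / (b - a) * mom a b v (endKernel k a b σ) := by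
  simp only [endCoef, mom, endKernel, eval_finsetSum, eval_mul, eval_C, eval_legP]

theorem endCoef_sub {k : ℕ} {a b e σ : ℝ} (hab : a < b) {v w : ℝ → ℝ}
    (hv : ContinuousOn v (Icc a b)) (hw : ContinuousOn w (Icc a b)) :
    endCoef k a b e σ (fun x => v x - w x) = endCoef k a b e σ v - endCoef k a b e σ w := by
  rw [endCoef_eq, endCoef_eq, endCoef_eq, mom_sub hab.le hv hw]; ring

theorem endCoef_congr {k : ℕ} {a b e σ : ℝ} (hab : a < b) (he : IsEnd a b e σ) {v w : ℝ → ℝ}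
    (h : EqOn v w (Icc a b)) : endCoef k a b e σ v = endCoef k a b e σ w := by
  rw [endCoef_eq, endCoef_eq, h (he.mem hab.le), mom, mom]
  congr 2
  refine intervalIntegral.integral_congr fun x hx => ?_
  rw [uIcc_of_le hab.le] at hx
  simp only [h hx]

/-- As L_m(e) = σ^m, the sum of σ^m(2m + 1)L_m is, up to the length of the cell, the reproducing
kernel of evaluation at e on degree at most k. -/
theorem polyInt_mul_endKernel {k : ℕ} {a b e σ : ℝ} (hab : a < b) (he : IsEnd a b e σ) {p : ℝ[X]}
    (hp : p.natDegree ≤ k) : polyInt a b (p * endKernel k a b σ) = (b - a) * (σ ^ k * p.eval e) := by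
  have h := sub_pos.2 hab
  obtain ⟨c, hc⟩ := exists_eq_sum_legP hab k p hp
  rw [endKernel, Finset.mul_sum, map_sum, hc, eval_finsetSum, Finset.mul_sum, Finset.mul_sum]
  refine Finset.sum_congr rfl fun m hm => ?_
  have hmk : m ≤ k := Nat.lt_succ_iff.1 (Finset.mem_range.1 hm)
  rw [mul_left_comm, polyInt_C_mul, polyInt_sum_mul_legP hab hmk, eval_mul, eval_C,
    he.eval_legP hab, pow_add]
  field_simp

/-- The projection error is orthogonal to L_m for m < k, so only its L_k component is seen. The
reproducing kernel, together with agreement at e, identifies that component with `endCoef`. -/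
theorem mom_sub_polyInt_gaussRadau {k : ℕ} {a b e σ : ℝ} (hab : a < b) (he : IsEnd a b e σ)
    {v : ℝ → ℝ} (hv : ContinuousOn v (Icc a b)) {w : ℝ[X]} (hw : w.natDegree ≤ k) :
    mom a b v w - polyInt a b (gaussRadau k a b e v * w) =
      endCoef k a b e σ v * polyInt a b (legP a b k * w) := by
  have h := sub_pos.2 hab
  set p := gaussRadau k a b e v with hp
  have hspec : IsGaussRadau k a b e v p := gaussRadau_spec hab he hv
  set Δ : ℕ → ℝ := fun m => mom a b v (legP a b m) - polyInt a b (p * legP a b m) with hΔ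
  have hΔ0 : ∀ m < k, Δ m = 0 := fun m hm => by
    have := hspec.2.1 (legP a b m) (by rwa [natDegree_legP hab])
    rw [integral_eval_mul_eval] at this
    simp only [hΔ, this, mom, sub_self]
  have hsum : ∀ c : ℕ → ℝ, mom a b v (∑ m ∈ Finset.range (k + 1), C (c m) * legP a b m) -
      polyInt a b (p * ∑ m ∈ Finset.range (k + 1), C (c m) * legP a b m) = c k * Δ k := by
    intro c
    rw [mom_sum hab.le hv, Finset.mul_sum, map_sum, ← Finset.sum_sub_distrib,
      Finset.sum_eq_single k]
    · rw [mom_C_mul, mul_left_comm, polyInt_C_mul, ← mul_sub]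
    · intro m hm hmk
      rw [mom_C_mul, mul_left_comm, polyInt_C_mul, ← mul_sub]
      have := hΔ0 m (by have := Finset.mem_range.1 hm; omega)
      simp only [hΔ] at this
      rw [this, mul_zero]
    · intro h'; exact absurd (Finset.mem_range.2 (by omega)) h'
  have hcoef : endCoef k a b e σ v = (2 * k + 1) / (b - a) * Δ k := by
    have e1 := hsum (fun m => σ ^ (k + m) * (2 * (m : ℝ) + 1))
    change mom a b v (endKernel k a b σ) - polyInt a b (p * endKernel k a b σ) = _ at e1
    rw [polyInt_mul_endKernel hab he hspec.1, hspec.2.2] at e1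
    rw [pow_add, he.pow_mul_pow] at e1
    rw [endCoef_eq]
    have e2 : mom a b v (endKernel k a b σ) = (b - a) * (σ ^ k * v e) + 1 * (2 * k + 1) * Δ k := by
      linarith
    rw [e2]
    field_simp
    ring
  obtain ⟨c, hc⟩ := exists_eq_sum_legP hab k w hw
  rw [hc, hsum, hcoef, mul_comm (legP a b k), polyInt_sum_mul_legP hab le_rfl]
  field_simp

theorem endCoef_eval {k : ℕ} {a b e σ : ℝ} (hab : a < b) (he : IsEnd a b e σ) {p : ℝ[X]}
    (hp : p.natDegree ≤ k) : endCoef k a b e σ (fun x => p.eval x) = 0 := by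
  have h := sub_pos.2 hab
  have := mom_sub_polyInt_gaussRadau hab he p.continuous.continuousOn
    (natDegree_legP hab k).le
  rw [gaussRadau_eval hab he hp, mom_eval, sub_self, polyInt_legP_sq hab] at this
  exact (mul_eq_zero.1 this.symm).resolve_right (by positivity)

theorem abs_endCoef_le {k : ℕ} {a b e σ V : ℝ} (hab : a < b) (he : IsEnd a b e σ) {v : ℝ → ℝ}
    (hV : ∀ x ∈ Icc a b, |v x| ≤ V) : |endCoef k a b e σ v| ≤ 2 * grBound k * V := by
  have h := sub_pos.2 hab
  have hV0 : 0 ≤ V := (abs_nonneg _).trans (hV a (left_mem_Icc.2 hab.le))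
  have hL := one_le_legBound k
  have hk : ∀ x ∈ Icc a b, |(endKernel k a b σ).eval x| ≤
      (k + 1) * ((2 * k + 1) * legBound k) := by
    intro x hx
    rw [endKernel, eval_finsetSum]
    refine (Finset.abs_sum_le_sum_abs _ _).trans ?_
    refine (Finset.sum_le_card_nsmul _ _ ((2 * k + 1) * legBound k) fun m hm => ?_).trans
      (le_of_eq (by simp))
    have hm' := Finset.mem_range.1 hm
    have hmk : (m : ℝ) ≤ k := by exact_mod_cast Nat.lt_succ_iff.1 hm'
    rw [eval_mul, eval_C, abs_mul, abs_mul, he.abs_pow, one_mul, abs_of_nonneg (by positivity)]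
    exact mul_le_mul (by linarith) (abs_eval_legP_le hab (by omega) hx) (abs_nonneg _)
      (by positivity)
  have h1 := abs_mom_le hab.le hV hk
  rw [endCoef_eq]
  refine (abs_add_le _ _).trans ?_
  rw [abs_mul, abs_neg, he.abs_pow, one_mul, abs_mul, abs_of_pos (by positivity : 0 < 1 / (b - a))]
  have h2 : 1 / (b - a) * |mom a b v (endKernel k a b σ)| ≤
      V * ((k + 1) * ((2 * k + 1) * legBound k)) := by
    rw [one_div_mul_eq_div, div_le_iff₀ h]; exact h1
  have h3 := hV e (he.mem hab.le)
  have hk0 : (0 : ℝ) ≤ k := by positivity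
  have h4 : (k + 1) * ((2 * k + 1) * legBound k) ≤ grBound k := by
    have : (k : ℝ) + 1 ≤ (2 * k + 1) * legBound k := by nlinarith
    rw [grBound, sq]; gcongr
  have h5 : V * ((k + 1) * ((2 * k + 1) * legBound k)) ≤ V * grBound k := by gcongr
  have h6 : V * 1 ≤ V * grBound k := by gcongr; exact one_le_grBound k
  linarith

/-- The functional annihilates polynomials of degree at most k, so v may be replaced by v − p. -/
theorem abs_endCoef_le_of_approx {k : ℕ} {a b e σ ε : ℝ} (hab : a < b) (he : IsEnd a b e σ)
    {v : ℝ → ℝ} (hv : ContinuousOn v (Icc a b)) {p : ℝ[X]} (hp : p.natDegree ≤ k)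
    (hε : ∀ x ∈ Icc a b, |v x - p.eval x| ≤ ε) : |endCoef k a b e σ v| ≤ 2 * grBound k * ε := by
  have := abs_endCoef_le (k := k) hab he hε
  rwa [endCoef_sub hab hv p.continuous.continuousOn, endCoef_eval hab he hp, sub_zero] at this

/-! ### The correction functions -/

theorem integralOp_eval_hasDerivAt (a b : ℝ) (v : ℝ[X]) (x : ℝ) :
    HasDerivAt (integralOp a b fun x => v.eval x) (1 / ((b - a) / 2) * v.eval x) x :=
  (intervalIntegral.integral_hasDerivAt_right (intervalIntegrable_eval _ _ _)
    (v.continuous.stronglyMeasurableAtFilter _ _) v.continuous.continuousAt).const_mul _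

theorem continuous_integralOp (a b : ℝ) (v : ℝ[X]) : Continuous (integralOp a b fun x => v.eval x) :=
  continuous_iff_continuousAt.2 fun x => (integralOp_eval_hasDerivAt a b v x).continuousAt

theorem integralOp_end {a b e σ : ℝ} (he : IsEnd a b e σ) {v : ℝ[X]} (h0 : polyInt a b v = 0) :
    integralOp a b (fun x => v.eval x) e = 0 := by
  rcases he with ⟨rfl, rfl⟩ | ⟨rfl, rfl⟩
  · rw [integralOp, ← polyInt_apply, h0, mul_zero]
  · simp [integralOp]

theorem eval_gaussRadau_integralOp {k : ℕ} {a b e σ : ℝ} (hab : a < b) (he : IsEnd a b e σ)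
    {v : ℝ[X]} (h0 : polyInt a b v = 0) :
    (gaussRadau k a b e (integralOp a b fun x => v.eval x)).eval e = 0 := by
  rw [(gaussRadau_spec hab he (continuous_integralOp a b v).continuousOn).2.2, integralOp_end he h0]

/-- The primitive of v vanishes at both ends because v has mean zero, and the projection is
invisible against w', whose degree is below k. -/
theorem polyInt_mul_of_gaussRadau_integralOp {k : ℕ} (hk : 1 ≤ k) {a b e σ : ℝ} (hab : a < b)
    (he : IsEnd a b e σ) {v : ℝ[X]} (h0 : polyInt a b v = 0) {w : ℝ[X]} (hw : w.natDegree ≤ k) :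
    polyInt a b (v * w) = -((b - a) / 2) *
      polyInt a b (gaussRadau k a b e (integralOp a b fun x => v.eval x) * derivative w) := by
  have h := sub_pos.2 hab
  have hdeg : (derivative w).natDegree < k := by
    rcases Nat.eq_zero_or_pos w.natDegree with hz | hz
    · rw [derivative_of_natDegree_zero hz, natDegree_zero]; omega
    · exact (natDegree_derivative_lt hz.ne').trans_le hw
  have hspec := (gaussRadau_spec (k := k) hab he (continuous_integralOp a b v).continuousOn).2.1 _ hdeg
  rw [integral_eval_mul_eval] at hspec
  rw [hspec]
  have parts := intervalIntegral.integral_mul_deriv_eq_deriv_mul (a := a) (b := b)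
    (fun x _ => integralOp_eval_hasDerivAt a b v x) (fun x _ => w.hasDerivAt x)
    ((continuous_const.mul v.continuous).intervalIntegrable _ _) (intervalIntegrable_eval _ _ _)
  rw [parts, integralOp_end (Or.inl ⟨rfl, rfl⟩ : IsEnd a b b 1) h0,
    integralOp_end (Or.inr ⟨rfl, rfl⟩ : IsEnd a b a (-1)) h0]
  simp only [mul_assoc]
  rw [intervalIntegral.integral_const_mul, integral_eval_mul_eval]
  field_simp
  ring

theorem abs_integralOp_le {a b V x : ℝ} (hab : a < b) {v : ℝ → ℝ} (hV : ∀ x ∈ Icc a b, |v x| ≤ V)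
    (hx : x ∈ Icc a b) : |integralOp a b v x| ≤ 2 * V := by
  have h := sub_pos.2 hab
  have hV0 : 0 ≤ V := (abs_nonneg _).trans (hV a (left_mem_Icc.2 hab.le))
  have := intervalIntegral.norm_integral_le_of_norm_le_const (a := a) (b := x) (f := v) (C := V)
    (fun y hy => by
      rw [uIoc_of_le hx.1] at hy
      exact hV y ⟨hy.1.le, hy.2.trans hx.2⟩)
  rw [integralOp, abs_mul, abs_of_pos (by positivity : 0 < 1 / ((b - a) / 2))]
  rw [abs_of_nonneg (sub_nonneg.2 hx.1), Real.norm_eq_abs] at this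
  calc 1 / ((b - a) / 2) * |∫ y in a..x, v y| ≤ 1 / ((b - a) / 2) * (V * (b - a)) := by
        gcongr; exact this.trans (by gcongr; exact hx.2)
    _ = 2 * V := by field_simp

/-- The correction function `P D⁻¹ L_k`, for the projection at `e`. -/
noncomputable def corr (k : ℕ) (a b e : ℝ) : ℝ[X] :=
  gaussRadau k a b e (integralOp a b fun x => (legP a b k).eval x)

/-- The correction function `P D⁻¹ P' D⁻¹ L_k`, for the projections `P` at `e` and `P'` at `e'`. -/
noncomputable def corrBar (k : ℕ) (a b e e' : ℝ) : ℝ[X] :=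
  gaussRadau k a b e (integralOp a b fun x => (corr k a b e').eval x)

theorem corr_eq (k : ℕ) (a b e : ℝ) :
    gaussRadau k a b e (integralOp a b (legendre a b k)) = corr k a b e := by
  simp only [corr, eval_legP]

section Corr

variable {k : ℕ} {a b e σ e' σ' : ℝ}

theorem polyInt_legP_eq_zero (hab : a < b) (hk : 1 ≤ k) : polyInt a b (legP a b k) = 0 := by
  have := polyInt_legP_mul hab (m := k) (q := 1) (by rw [natDegree_one]; omega)
  rwa [mul_one] at this

theorem natDegree_corr_le (hab : a < b) (he : IsEnd a b e σ) : (corr k a b e).natDegree ≤ k :=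
  (gaussRadau_spec hab he (continuous_integralOp a b _).continuousOn).1

theorem natDegree_corrBar_le (hab : a < b) (he : IsEnd a b e σ) :
    (corrBar k a b e e').natDegree ≤ k :=
  (gaussRadau_spec hab he (continuous_integralOp a b _).continuousOn).1

theorem eval_corr (hab : a < b) (hk : 1 ≤ k) (he : IsEnd a b e σ) : (corr k a b e).eval e = 0 :=
  eval_gaussRadau_integralOp hab he (polyInt_legP_eq_zero hab hk)

theorem polyInt_legP_mul_eq_corr (hab : a < b) (hk : 1 ≤ k) (he : IsEnd a b e σ) {w : ℝ[X]}
    (hw : w.natDegree ≤ k) : polyInt a b (legP a b k * w) =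
      -((b - a) / 2) * polyInt a b (corr k a b e * derivative w) :=
  polyInt_mul_of_gaussRadau_integralOp hk hab he (polyInt_legP_eq_zero hab hk) hw

/-- Test the preceding identity with w = X, which is orthogonal to L_k only for k ≥ 2. The mean zero
is what permits a second correction, and here the restriction on k enters. -/
theorem polyInt_corr_eq_zero (hab : a < b) (hk : 2 ≤ k) (he : IsEnd a b e σ) :
    polyInt a b (corr k a b e) = 0 := by
  have h := sub_pos.2 hab
  have h1 := polyInt_legP_mul_eq_corr hab (by omega : 1 ≤ k) he (w := X)
    (by rw [natDegree_X]; omega)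
  rw [polyInt_legP_mul hab (by rw [natDegree_X]; omega), derivative_X, mul_one] at h1
  exact (mul_eq_zero.1 h1.symm).resolve_left (neg_ne_zero.2 (by positivity))

theorem eval_corrBar (hab : a < b) (hk : 2 ≤ k) (he : IsEnd a b e σ) (he' : IsEnd a b e' σ') :
    (corrBar k a b e e').eval e = 0 :=
  eval_gaussRadau_integralOp hab he (polyInt_corr_eq_zero hab hk he')

theorem polyInt_corr_mul_eq_corrBar (hab : a < b) (hk : 2 ≤ k) (he : IsEnd a b e σ)
    (he' : IsEnd a b e' σ') {w : ℝ[X]} (hw : w.natDegree ≤ k) : polyInt a b (corr k a b e' * w) =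
      -((b - a) / 2) * polyInt a b (corrBar k a b e e' * derivative w) :=
  polyInt_mul_of_gaussRadau_integralOp (by omega) hab he (polyInt_corr_eq_zero hab hk he') hw

/-- A bound of the correction functions. -/
noncomputable def corrBound (k : ℕ) : ℝ := (2 * grBound k) ^ 2 * legBound k

theorem abs_corr_le (hab : a < b) (he : IsEnd a b e σ) {x : ℝ} (hx : x ∈ Icc a b) :
    |(corr k a b e).eval x| ≤ 2 * grBound k * legBound k := by
  have := abs_eval_gaussRadau_le (k := k) hab he (continuous_integralOp a b _).continuousOn
    (fun x hx => abs_integralOp_le hab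
      (fun x hx => abs_eval_legP_le hab (k := k) (m := k) (by omega) hx) hx) hx
  refine this.trans (le_of_eq (by ring))

theorem abs_corrBar_le (hab : a < b) (he : IsEnd a b e σ) (he' : IsEnd a b e' σ') {x : ℝ}
    (hx : x ∈ Icc a b) : |(corrBar k a b e e').eval x| ≤ corrBound k := by
  have := abs_eval_gaussRadau_le (k := k) hab he (continuous_integralOp a b _).continuousOn
    (fun x hx => abs_integralOp_le hab (fun x hx => abs_corr_le (k := k) hab he' hx) hx) hx
  refine this.trans (le_of_eq ?_)
  rw [corrBound]; ring

theorem abs_corr_le_corrBound (hab : a < b) (he : IsEnd a b e σ) {x : ℝ} (hx : x ∈ Icc a b) :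
    |(corr k a b e).eval x| ≤ corrBound k := by
  refine (abs_corr_le hab he hx).trans ?_
  have h1 := one_le_grBound k
  have h2 := one_le_legBound k
  have h3 : 1 ≤ 2 * grBound k := by linarith
  exact mul_le_mul_of_nonneg_right (le_self_pow₀ h3 two_ne_zero) (by linarith)

end Corr

/-! ### Inverse inequalities -/

/-- The constant of the inverse inequalities. -/
noncomputable def invBound (k : ℕ) : ℝ := (k + 1) * ((2 * k + 1) * legBound k)

theorem invBound_pos (k : ℕ) : 0 < invBound k := by
  have := one_le_legBound k
  unfold invBound; positivity

/-- Bessel's inequality for a single coefficient, from the integral of (p − cL_m)² being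
nonnegative. -/
theorem abs_legCoef_eval_le {a b : ℝ} (hab : a < b) {k m : ℕ} (hm : m ≤ k) (p : ℝ[X]) :
    |legCoef a b m (fun x => p.eval x)| ≤ (2 * k + 1) / √(b - a) * √(polyInt a b (p * p)) := by
  have h := sub_pos.2 hab
  set c := legCoef a b m (fun x => p.eval x) with hc
  have h1 := polyInt_sq_nonneg hab.le (p - C c * legP a b m)
  have e1 : (p - C c * legP a b m) * (p - C c * legP a b m) =
      p * p - C (2 * c) * (p * legP a b m) + C (c * c) * (legP a b m * legP a b m) := by
    simp only [C_mul, C_ofNat]; ring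
  have e2 : polyInt a b (p * legP a b m) = c * ((b - a) / (2 * m + 1)) := by
    rw [hc, legCoef_eval]; field_simp
  rw [e1, map_add, map_sub, polyInt_C_mul, polyInt_C_mul, e2, polyInt_legP_sq hab] at h1
  have hm' : (m : ℝ) ≤ k := by exact_mod_cast hm
  have h2 : c ^ 2 * ((b - a) / (2 * m + 1)) ≤ polyInt a b (p * p) := by linarith
  rw [mul_div_assoc', div_le_iff₀ (by positivity)] at h2
  have hP := polyInt_sq_nonneg hab.le p
  refine abs_le_of_sq_le_sq ?_ (by positivity)
  rw [mul_pow, div_pow, Real.sq_sqrt hP, Real.sq_sqrt h.le, div_mul_eq_mul_div, le_div_iff₀ h]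
  refine h2.trans ?_
  rw [mul_comm]
  gcongr
  nlinarith

theorem abs_eval_le_of_sq {a b x : ℝ} (hab : a < b) {k : ℕ} {p : ℝ[X]} (hp : p.natDegree ≤ k)
    (hx : x ∈ Icc a b) : |p.eval x| ≤ invBound k / √(b - a) * √(polyInt a b (p * p)) := by
  have h := sub_pos.2 hab
  have hL := one_le_legBound k
  have e := eq_sum_legCoef hab hp
  set N := √(polyInt a b (p * p))
  rw [e, eval_finsetSum]
  refine (Finset.abs_sum_le_sum_abs _ _).trans ?_
  refine (Finset.sum_le_card_nsmul _ _ ((2 * k + 1) / √(b - a) * N * legBound k)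
    fun m hm => ?_).trans (le_of_eq ?_)
  · have hm' := Finset.mem_range.1 hm
    rw [eval_mul, eval_C, abs_mul]
    exact mul_le_mul (abs_legCoef_eval_le hab (by omega) p) (abs_eval_legP_le hab (by omega) hx)
      (abs_nonneg _) (by positivity)
  · rw [Finset.card_range, nsmul_eq_mul, invBound]; push_cast; ring

theorem abs_eval_derivative_le_of_sq {a b x : ℝ} (hab : a < b) {k : ℕ} {p : ℝ[X]}
    (hp : p.natDegree ≤ k) (hx : x ∈ Icc a b) :
    |(derivative p).eval x| ≤ invBound k / √(b - a) * √(polyInt a b (p * p)) / (b - a) := by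
  have h := sub_pos.2 hab
  have hL := one_le_legBound k
  have e := eq_sum_legCoef hab hp
  set N := √(polyInt a b (p * p))
  rw [e, derivative_sum, eval_finsetSum]
  refine (Finset.abs_sum_le_sum_abs _ _).trans ?_
  refine (Finset.sum_le_card_nsmul _ _ ((2 * k + 1) / √(b - a) * N * (legBound k / (b - a)))
    fun m hm => ?_).trans (le_of_eq ?_)
  · have hm' := Finset.mem_range.1 hm
    rw [derivative_C_mul, eval_mul, eval_C, abs_mul]
    exact mul_le_mul (abs_legCoef_eval_le hab (by omega) p)
      (abs_eval_derivative_legP_le hab (by omega) hx) (abs_nonneg _) (by positivity)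
  · rw [Finset.card_range, nsmul_eq_mul, invBound]; push_cast; ring

/-! ### Approximation by polynomials -/

/-- Approximate the derivative, integrate the approximant from a, and adjust the constant. No
factorials are kept. -/
theorem exists_poly_approx {a b B : ℝ} (hab : a ≤ b) (n : ℕ) : ∀ v : ℕ → ℝ → ℝ,
    (∀ i < n, ∀ x ∈ Icc a b, HasDerivWithinAt (v i) (v (i + 1) x) (Icc a b) x) →
    (∀ x ∈ Icc a b, ∀ y ∈ Icc a b, |v n x - v n y| ≤ B * |x - y|) → 0 ≤ B →
    ∃ p : ℝ[X], p.natDegree ≤ n ∧ ∀ x ∈ Icc a b, |v 0 x - p.eval x| ≤ B * (b - a) ^ (n + 1) := by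
  have hba := sub_nonneg.2 hab
  induction n with
  | zero =>
    intro v _ hl hB
    refine ⟨C (v 0 a), by simp, fun x hx => ?_⟩
    rw [eval_C, zero_add, pow_one]
    refine (hl x hx a (left_mem_Icc.2 hab)).trans ?_
    gcongr
    rw [abs_of_nonneg (sub_nonneg.2 hx.1)]
    linarith [hx.2]
  | succ n ih =>
    intro v hd hl hB
    obtain ⟨q, hq, hqe⟩ := ih (fun i => v (i + 1)) (fun i hi => hd (i + 1) (by omega)) hl hB
    obtain ⟨r, hr, hrd⟩ : ∃ r : ℝ[X], r.natDegree ≤ n + 1 ∧ derivative r = q := by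
      refine ⟨∑ i ∈ Finset.range (n + 1), C (q.coeff i / (i + 1)) * X ^ (i + 1), ?_, ?_⟩
      · refine natDegree_sum_le_of_forall_le _ _ fun i hi => (natDegree_C_mul_X_pow_le _ _).trans ?_
        have := Finset.mem_range.1 hi; omega
      · rw [derivative_sum, q.as_sum_range_C_mul_X_pow' (by omega : q.natDegree < n + 1)]
        refine Finset.sum_congr rfl fun i _ => ?_
        rw [derivative_C_mul_X_pow]
        simp only [Nat.add_sub_cancel]
        congr 2
        push_cast
        rw [← q.as_sum_range_C_mul_X_pow' (by omega : q.natDegree < n + 1)]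
        field_simp
    refine ⟨r - C (r.eval a) + C (v 0 a), ?_, fun x hx => ?_⟩
    · refine (natDegree_add_le _ _).trans (max_le ((natDegree_sub_le _ _).trans (max_le hr ?_)) ?_)
      · simp
      · simp
    · have := (convex_Icc a b).norm_image_sub_le_of_norm_hasDerivWithin_le
        (f := fun y => v 0 y - r.eval y) (f' := fun y => v 1 y - q.eval y)
        (C := B * (b - a) ^ (n + 1))
        (fun y hy => (hd 0 (by omega) y hy).sub (hrd ▸ (r.hasDerivAt y).hasDerivWithinAt))
        (fun y hy => hqe y hy) (left_mem_Icc.2 hab) hx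
      rw [Real.norm_eq_abs, Real.norm_eq_abs, abs_of_nonneg (sub_nonneg.2 hx.1)] at this
      have e : v 0 x - (r - C (r.eval a) + C (v 0 a)).eval x =
          v 0 x - r.eval x - (v 0 a - r.eval a) := by
        simp; ring
      rw [e]
      refine this.trans ?_
      rw [pow_succ _ (n + 1), ← mul_assoc]
      gcongr
      exact hx.2

end LDG


/-! ### The finite element space as a Hilbert space and the discrete derivative. -/

namespace LDG

open Set Filter Topology MeasureTheory Polynomial

/-! ### Meshes -/

namespace Mesh

variable (M : Mesh)

theorem node_mono {i j : ℕ} (hij : i ≤ j) (hj : j ≤ M.N) : M.node i ≤ M.node j := by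
  induction j, hij using Nat.le_induction with
  | base => exact le_rfl
  | succ j hij ih => exact (ih (by omega)).trans (M.node_lt j (by omega)).le

theorem Icc_subset_Omega {j : ℕ} (hj : j < M.N) : Icc (M.node j) (M.node (j + 1)) ⊆ Omega := by
  intro x hx
  have h1 := M.node_mono (Nat.zero_le j) hj.le
  have h2 := M.node_mono (Nat.succ_le_of_lt hj) le_rfl
  rw [M.node_zero] at h1
  rw [M.node_last] at h2
  exact ⟨h1.trans hx.1, hx.2.trans h2⟩

theorem node_mem_Omega {i : ℕ} (hi : i ≤ M.N) : M.node i ∈ Omega := by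
  have h1 := M.node_mono (Nat.zero_le i) hi
  have h2 := M.node_mono hi le_rfl
  rw [M.node_zero] at h1
  rw [M.node_last] at h2
  exact ⟨h1, h2⟩

theorem len_pos {j : ℕ} (hj : j < M.N) : 0 < M.len j := sub_pos.2 (M.node_lt j hj)

theorem len_le_h {j : ℕ} (hj : j < M.N) : M.len j ≤ M.h :=
  le_ciSup (f := fun j : Fin M.N => M.len j) (finite_range _).bddAbove ⟨j, hj⟩

theorem h_pos : 0 < M.h := (M.len_pos M.N_pos).trans_le (M.len_le_h M.N_pos)

theorem len_le {j : ℕ} (hj : j < M.N) : M.len j ≤ 2 * Real.pi := by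
  have h1 := (M.node_mem_Omega hj.le).1
  have h2 := (M.node_mem_Omega (Nat.succ_le_of_lt hj)).2
  unfold len
  linarith

theorem h_le : M.h ≤ 7 := by
  have : Nonempty (Fin M.N) := ⟨⟨0, M.N_pos⟩⟩
  exact (ciSup_le fun j : Fin M.N => M.len_le j.2).trans (by linarith [Real.pi_lt_d2])

theorem sum_len : ∑ j ∈ Finset.range M.N, M.len j = 2 * Real.pi := by
  simp only [len]
  rw [Finset.sum_range_sub, M.node_zero, M.node_last, sub_zero]

theorem one_le_of_quasiUniform {c : ℝ} (hc : M.QuasiUniform c) : 1 ≤ c := by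
  have h1 := hc 0 M.N_pos
  have h2 := M.len_le_h M.N_pos
  have h3 := M.len_pos M.N_pos
  by_contra! hcon
  nlinarith

theorem N_mul_h_le {c : ℝ} (hc : M.QuasiUniform c) : M.N * M.h ≤ c * (2 * Real.pi) := by
  rw [← M.sum_len, Finset.mul_sum]
  have := Finset.card_nsmul_le_sum (Finset.range M.N) (fun j => c * M.len j) M.h
    fun j hj => hc j (Finset.mem_range.1 hj)
  simpa using this

end Mesh

/-! ### The finite element space as a Hilbert space -/

/-- The finite element space. -/
def Vh (M : Mesh) (k : ℕ) : Type := Fin M.N → degreeLE ℝ k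

namespace Vh

variable {M : Mesh} {k : ℕ}

noncomputable instance : AddCommGroup (Vh M k) :=
  inferInstanceAs (AddCommGroup (Fin M.N → degreeLE ℝ k))

noncomputable instance : Module ℝ (Vh M k) :=
  inferInstanceAs (Module ℝ (Fin M.N → degreeLE ℝ k))

/-- The polynomial on the cell `j`. -/
noncomputable def poly (j : ℕ) : Vh M k →ₗ[ℝ] ℝ[X] :=
  if h : j < M.N then (degreeLE ℝ k).subtype ∘ₗ
    (LinearMap.proj (R := ℝ) (φ := fun _ : Fin M.N => degreeLE ℝ k) ⟨j, h⟩) else 0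

theorem poly_apply {j : ℕ} (h : j < M.N) (v : Vh M k) : poly j v = (v ⟨j, h⟩ : ℝ[X]) := by
  rw [poly, dif_pos h]; rfl

theorem natDegree_poly_le (j : ℕ) (v : Vh M k) : (poly j v).natDegree ≤ k := by
  by_cases h : j < M.N
  · rw [poly_apply h]
    exact natDegree_le_iff_degree_le.2 (mem_degreeLE.1 (v ⟨j, h⟩).2)
  · rw [poly, dif_neg h]; simp

theorem ext {v w : Vh M k} (h : ∀ j < M.N, poly j v = poly j w) : v = w := by
  funext j
  have := h j j.2
  rw [poly_apply j.2, poly_apply j.2] at this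
  exact Subtype.ext this

/-- The element of the finite element space with the given polynomials. -/
noncomputable def ofPoly (p : ℕ → ℝ[X]) (hp : InVh M k p) : Vh M k :=
  fun j => ⟨p j, mem_degreeLE.2 (natDegree_le_iff_degree_le.1 (hp j j.2))⟩

theorem poly_ofPoly {p : ℕ → ℝ[X]} (hp : InVh M k p) {j : ℕ} (hj : j < M.N) :
    poly j (ofPoly p hp) = p j := by
  rw [poly_apply hj]; rfl

/-- The map of an element of the finite element space to its coefficients. -/
noncomputable def coeffs : Vh M k →ₗ[ℝ] (Fin M.N × Fin (k + 1) → ℝ) :=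
  LinearMap.pi fun i => lcoeff ℝ i.2 ∘ₗ poly i.1

theorem coeffs_injective : Function.Injective (coeffs : Vh M k →ₗ[ℝ] _) := by
  intro v w h
  refine ext fun j hj => Polynomial.ext fun n => ?_
  by_cases hn : n < k + 1
  · exact congrFun h (⟨j, hj⟩, ⟨n, hn⟩)
  · rw [coeff_eq_zero_of_natDegree_lt ((natDegree_poly_le j v).trans_lt (by omega)),
      coeff_eq_zero_of_natDegree_lt ((natDegree_poly_le j w).trans_lt (by omega))]

instance : Module.Finite ℝ (Vh M k) := Module.Finite.of_injective _ coeffs_injective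

/-- The inner product of `L²(0, 2π)`. -/
noncomputable instance core : InnerProductSpace.Core ℝ (Vh M k) where
  inner v w := ∑ j ∈ Finset.range M.N, polyInt (M.node j) (M.node (j + 1)) (poly j v * poly j w)
  conj_inner_symm v w := by simp [mul_comm]
  re_inner_nonneg v := Finset.sum_nonneg fun j hj =>
    polyInt_sq_nonneg (M.node_lt j (Finset.mem_range.1 hj)).le _
  add_left u v w := by simp [add_mul, Finset.sum_add_distrib]
  smul_left v w r := by simp [Finset.mul_sum]
  definite v h := by
    refine ext fun j hj => ?_
    rw [map_zero]
    refine eq_zero_of_polyInt_sq_eq_zero (M.node_lt j hj) ?_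
    exact (Finset.sum_eq_zero_iff_of_nonneg fun i hi =>
      polyInt_sq_nonneg (M.node_lt i (Finset.mem_range.1 hi)).le _).1 h j (Finset.mem_range.2 hj)

noncomputable instance : NormedAddCommGroup (Vh M k) :=
  InnerProductSpace.Core.toNormedAddCommGroup (𝕜 := ℝ)

noncomputable instance : InnerProductSpace ℝ (Vh M k) := InnerProductSpace.ofCore core.toCore

instance : FiniteDimensional ℝ (Vh M k) := inferInstanceAs (Module.Finite ℝ (Vh M k))

instance : CompleteSpace (Vh M k) := FiniteDimensional.complete ℝ _

theorem inner_eq (v w : Vh M k) : inner ℝ v w =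
    ∑ j ∈ Finset.range M.N, polyInt (M.node j) (M.node (j + 1)) (poly j v * poly j w) := rfl

theorem polyInt_poly_sq_le (v : Vh M k) {j : ℕ} (hj : j < M.N) :
    polyInt (M.node j) (M.node (j + 1)) (poly j v * poly j v) ≤ ‖v‖ ^ 2 := by
  rw [← real_inner_self_eq_norm_sq, inner_eq]
  exact Finset.single_le_sum
    (f := fun j => polyInt (M.node j) (M.node (j + 1)) (poly j v * poly j v))
    (fun i hi => polyInt_sq_nonneg (M.node_lt i (Finset.mem_range.1 hi)).le _)
    (Finset.mem_range.2 hj)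

theorem norm_le_of_abs_le {v : Vh M k} {V : ℝ} (hV : 0 ≤ V)
    (h : ∀ j < M.N, ∀ x ∈ Icc (M.node j) (M.node (j + 1)), |(poly j v).eval x| ≤ V) :
    ‖v‖ ≤ 3 * V := by
  refine (abs_le_of_sq_le_sq' ?_ (by positivity)).2
  rw [← real_inner_self_eq_norm_sq, inner_eq]
  have : ∀ j ∈ Finset.range M.N, polyInt (M.node j) (M.node (j + 1)) (poly j v * poly j v) ≤
      V ^ 2 * M.len j := by
    intro j hj
    have hj' := Finset.mem_range.1 hj
    have h1 := abs_mom_le (M.node_lt j hj').le (h j hj') (h j hj')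
    rw [mom_eval] at h1
    refine (le_abs_self _).trans (h1.trans (le_of_eq ?_))
    rw [Mesh.len]; ring
  refine (Finset.sum_le_sum this).trans ?_
  rw [← Finset.mul_sum, M.sum_len]
  -- The factor 3 comes from 2π ≤ 9.
  nlinarith [Real.pi_lt_d2, sq_nonneg V]

/-- The coefficient map has a linear left inverse, continuous because the dimension is finite, so
the choice of norm plays no role. -/
theorem hasDerivWithinAt_of_coeff {f : ℝ → Vh M k} {f' : Vh M k} {S : Set ℝ} {t : ℝ}
    (h : ∀ j < M.N, ∀ n, HasDerivWithinAt (fun s => (poly j (f s)).coeff n)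
      ((poly j f').coeff n) S t) : HasDerivWithinAt f f' S t := by
  obtain ⟨g, hg⟩ := LinearMap.exists_leftInverse_of_injective (coeffs : Vh M k →ₗ[ℝ] _)
    (LinearMap.ker_eq_bot.2 coeffs_injective)
  have hg' : ∀ v, g (coeffs v) = v := fun v => LinearMap.congr_fun hg v
  have h1 : HasDerivWithinAt (fun s => coeffs (f s)) (coeffs f') S t :=
    hasDerivWithinAt_pi.2 fun i => h i.1 i.1.2 i.2
  have h2 := g.toContinuousLinearMap.hasFDerivAt.comp_hasDerivWithinAt t h1
  simpa [Function.comp_def, hg'] using h2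

/-- The constant of the inverse inequalities on a quasi-uniform mesh. -/
noncomputable def invConst (k : ℕ) (c : ℝ) : ℝ := invBound k * √c

theorem invConst_nonneg (k : ℕ) (c : ℝ) : 0 ≤ invConst k c :=
  mul_nonneg (invBound_pos k).le (Real.sqrt_nonneg _)

theorem div_sqrt_len_le {c : ℝ} (hc : M.QuasiUniform c) {j : ℕ} (hj : j < M.N) :
    invBound k / √(M.node (j + 1) - M.node j) ≤ invConst k c / √M.h := by
  have h1 : 0 < M.node (j + 1) - M.node j := M.len_pos hj
  have h2 : √M.h ≤ √c * √(M.node (j + 1) - M.node j) := by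
    rw [← Real.sqrt_mul (by linarith [M.one_le_of_quasiUniform hc])]
    exact Real.sqrt_le_sqrt (hc j hj)
  have h3 := Real.sqrt_pos.2 M.h_pos
  have h4 := invBound_pos k
  rw [div_le_div_iff₀ (Real.sqrt_pos.2 h1) h3, invConst, mul_assoc]
  gcongr

theorem abs_eval_poly_le {c : ℝ} (hc : M.QuasiUniform c) (v : Vh M k) {j : ℕ} (hj : j < M.N) {x : ℝ}
    (hx : x ∈ Icc (M.node j) (M.node (j + 1))) :
    |(poly j v).eval x| ≤ invConst k c / √M.h * ‖v‖ := by
  have h3 := Real.sqrt_pos.2 M.h_pos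
  have := invConst_nonneg k c
  refine (abs_eval_le_of_sq (M.node_lt j hj) (natDegree_poly_le j v) hx).trans ?_
  refine mul_le_mul (div_sqrt_len_le hc hj) ?_ (Real.sqrt_nonneg _) (by positivity)
  exact Real.sqrt_le_iff.2 ⟨norm_nonneg _, polyInt_poly_sq_le v hj⟩

theorem abs_eval_derivative_poly_le {c : ℝ} (hc : M.QuasiUniform c) (v : Vh M k) {j : ℕ}
    (hj : j < M.N) {x : ℝ} (hx : x ∈ Icc (M.node j) (M.node (j + 1))) :
    |(derivative (poly j v)).eval x| ≤ invConst k c / √M.h * ‖v‖ / M.len j := by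
  have h3 := Real.sqrt_pos.2 M.h_pos
  have := invConst_nonneg k c
  have h1 := M.len_pos hj
  refine (abs_eval_derivative_le_of_sq (M.node_lt j hj) (natDegree_poly_le j v) hx).trans ?_
  refine div_le_div_of_nonneg_right ?_ h1.le
  refine mul_le_mul (div_sqrt_len_le hc hj) ?_ (Real.sqrt_nonneg _) (by positivity)
  exact Real.sqrt_le_iff.2 ⟨norm_nonneg _, polyInt_poly_sq_le v hj⟩

end Vh

/-! ### The discrete derivative -/

/-- The boundary conditions with zero data. -/
def Boundary.homog : Boundary → Boundary
  | .periodic => .periodic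
  | .mixed _ _ => .mixed (fun _ => 0) (fun _ => 0)

section Form

variable (fl : Flux) (bc : Boundary) (M : Mesh) (k : ℕ)

/-- The flux of `u` with zero boundary data. -/
noncomputable def uTrace (i : ℕ) : Vh M k →ₗ[ℝ] ℝ where
  toFun v := uFlux fl bc.homog M 0 (fun j => Vh.poly j v) i
  map_add' v w := by
    cases fl <;> cases bc <;>
      simp only [uFlux, Boundary.homog, leftTrace, rightTrace, lastValue, firstValue, map_add,
        eval_add] <;> split_ifs <;> simp
  map_smul' r v := by
    cases fl <;> cases bc <;>
      simp only [uFlux, Boundary.homog, leftTrace, rightTrace, lastValue, firstValue, map_smul,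
        eval_smul, smul_eq_mul, RingHom.id_apply] <;> split_ifs <;> simp

/-- The flux of `q` with zero boundary data. -/
noncomputable def qTrace (i : ℕ) (v : Vh M k) : ℝ :=
  qFlux fl bc.homog M 0 (fun j => Vh.poly j v) i

/-- The contribution of the cell `j` to the bilinear form of the scheme. -/
noncomputable def cellForm (v w : Vh M k) (j : ℕ) : ℝ :=
  -polyInt (M.node j) (M.node (j + 1)) (Vh.poly j v * derivative (Vh.poly j w)) +
    uTrace fl bc M k (j + 1) v * (Vh.poly j w).eval (M.node (j + 1)) -
    uTrace fl bc M k j v * (Vh.poly j w).eval (M.node j)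

/-- The bilinear form of the discrete derivative. -/
noncomputable def form : Vh M k →ₗ[ℝ] Vh M k →ₗ[ℝ] ℝ :=
  LinearMap.mk₂ ℝ (fun v w => ∑ j ∈ Finset.range M.N, cellForm fl bc M k v w j)
    (fun v v' w => by
      rw [← Finset.sum_add_distrib]
      refine Finset.sum_congr rfl fun j _ => ?_
      simp only [cellForm, map_add, add_mul]; ring)
    (fun r v w => by
      rw [smul_eq_mul, Finset.mul_sum]
      refine Finset.sum_congr rfl fun j _ => ?_
      simp only [cellForm, map_smul, smul_mul_assoc, smul_eq_mul]; ring)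
    (fun v w w' => by
      rw [← Finset.sum_add_distrib]
      refine Finset.sum_congr rfl fun j _ => ?_
      simp only [cellForm, map_add, mul_add, eval_add]; ring)
    (fun r v w => by
      rw [smul_eq_mul, Finset.mul_sum]
      refine Finset.sum_congr rfl fun j _ => ?_
      simp only [cellForm, map_smul, mul_smul_comm, smul_eq_mul, eval_smul]; ring)

variable {fl bc M k}

theorem form_apply (v w : Vh M k) :
    form fl bc M k v w = ∑ j ∈ Finset.range M.N, cellForm fl bc M k v w j := rfl

theorem uTrace_apply (i : ℕ) (v : Vh M k) :
    uTrace fl bc M k i v = uFlux fl bc.homog M 0 (fun j => Vh.poly j v) i := rfl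

/-- In the periodic case the traces agree at the two ends of Ω; in the mixed case one factor
vanishes at each of them. -/
theorem uTrace_mul_qTrace_zero (v w : Vh M k) :
    uTrace fl bc M k 0 v * qTrace fl bc M k 0 w =
      uTrace fl bc M k M.N v * qTrace fl bc M k M.N w := by
  have hN := M.N_pos
  cases fl <;> cases bc <;>
    simp [uTrace_apply, qTrace, uFlux, qFlux, Boundary.homog, leftTrace, rightTrace, lastValue,
      firstValue, hN.ne, hN.ne']

/-- The two discrete derivatives of the scheme are adjoint up to the sign. -/
theorem sum_qForm_eq (η v : Vh M k) : ∑ j ∈ Finset.range M.N,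
    (-polyInt (M.node j) (M.node (j + 1)) (Vh.poly j η * derivative (Vh.poly j v)) +
      qTrace fl bc M k (j + 1) η * (Vh.poly j v).eval (M.node (j + 1)) -
      qTrace fl bc M k j η * (Vh.poly j v).eval (M.node j)) = -form fl bc M k v η := by
  rw [eq_neg_iff_add_eq_zero, form_apply, ← Finset.sum_add_distrib]
  -- One flux is the cell's own trace of u at one end, the other its own trace of q at the opposite
  -- end. After integration by parts only the difference of the products û q̂ at the two ends is
  -- left, and it telescopes.
  have key : ∀ j ∈ Finset.range M.N,
      (-polyInt (M.node j) (M.node (j + 1)) (Vh.poly j η * derivative (Vh.poly j v)) +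
        qTrace fl bc M k (j + 1) η * (Vh.poly j v).eval (M.node (j + 1)) -
        qTrace fl bc M k j η * (Vh.poly j v).eval (M.node j)) + cellForm fl bc M k v η j =
      (uTrace fl bc M k (j + 1) v * qTrace fl bc M k (j + 1) η) -
        (uTrace fl bc M k j v * qTrace fl bc M k j η) := by
    intro j hj
    have hj' := Finset.mem_range.1 hj
    have parts := polyInt_derivative_mul (M.node j) (M.node (j + 1)) (Vh.poly j η) (Vh.poly j v)
    rw [mul_comm (derivative (Vh.poly j η))] at parts
    rw [cellForm]
    cases fl with
    | minusPlus =>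
      have h1 : uTrace .minusPlus bc M k (j + 1) v = (Vh.poly j v).eval (M.node (j + 1)) := by
        cases bc <;> simp [uTrace_apply, uFlux, Boundary.homog, leftTrace]
      have h2 : qTrace .minusPlus bc M k j η = (Vh.poly j η).eval (M.node j) := by
        cases bc <;> simp [qTrace, qFlux, Boundary.homog, rightTrace, hj'.ne]
      rw [h1, h2]; linear_combination -parts
    | plusMinus =>
      have h1 : uTrace .plusMinus bc M k j v = (Vh.poly j v).eval (M.node j) := by
        cases bc <;> simp [uTrace_apply, uFlux, Boundary.homog, rightTrace, hj'.ne]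
      have h2 : qTrace .plusMinus bc M k (j + 1) η = (Vh.poly j η).eval (M.node (j + 1)) := by
        cases bc <;> simp [qTrace, qFlux, Boundary.homog, leftTrace]
      rw [h1, h2]; linear_combination -parts
  rw [Finset.sum_congr rfl key, Finset.sum_range_sub
    (fun j => uTrace fl bc M k j v * qTrace fl bc M k j η), uTrace_mul_qTrace_zero, sub_self]

theorem abs_uTrace_le {c : ℝ} (hc : M.QuasiUniform c) (v : Vh M k) {i : ℕ} (hi : i ≤ M.N) :
    |uTrace fl bc M k i v| ≤ Vh.invConst k c / √M.h * ‖v‖ := by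
  have hN := M.N_pos
  have h0 : 0 ≤ Vh.invConst k c / √M.h * ‖v‖ :=
    mul_nonneg (div_nonneg (Vh.invConst_nonneg k c) (Real.sqrt_nonneg _)) (norm_nonneg _)
  have hx := fun j hj x hx => Vh.abs_eval_poly_le hc v (j := j) hj (x := x) hx
  set β := Vh.invConst k c / √M.h * ‖v‖
  have hl : ∀ j < M.N, |(Vh.poly j v).eval (M.node j)| ≤ β := fun j hj =>
    hx j hj _ (left_mem_Icc.2 (M.node_lt j hj).le)
  have hr : ∀ j < M.N, |(Vh.poly j v).eval (M.node (j + 1))| ≤ β := fun j hj =>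
    hx j hj _ (right_mem_Icc.2 (M.node_lt j hj).le)
  have hlast := hr (M.N - 1) (by omega)
  rw [Nat.sub_add_cancel hN] at hlast
  cases fl with
  | minusPlus =>
    rcases Nat.eq_zero_or_pos i with h | h
    · subst h
      cases bc <;> simp [uTrace_apply, uFlux, Boundary.homog, leftTrace, lastValue, hlast, h0]
    · have := hr (i - 1) (by omega)
      rw [Nat.sub_add_cancel h] at this
      cases bc <;> simp [uTrace_apply, uFlux, Boundary.homog, leftTrace, h.ne', this]
  | plusMinus =>
    rcases hi.eq_or_lt with h | h
    · subst h
      cases bc <;>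
        simp [uTrace_apply, uFlux, Boundary.homog, rightTrace, firstValue, hl 0 hN, h0]
    · cases bc <;> simp [uTrace_apply, uFlux, Boundary.homog, rightTrace, h.ne, hl i h]

/-- The constant in the bound of the bilinear form. -/
noncomputable def formBound (k : ℕ) (c : ℝ) : ℝ := c * (2 * Real.pi) * (3 * Vh.invConst k c ^ 2)

/-- Each cell contributes at most a multiple of ‖v‖‖w‖/h, and the cells are merely counted, N ≲ 1/h.
This wastes a power of h, which `ParabolicData.norm_eta_le` can afford. -/
theorem abs_form_le {c : ℝ} (hc : M.QuasiUniform c) (v w : Vh M k) :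
    |form fl bc M k v w| ≤ formBound k c / M.h ^ 2 * ‖v‖ * ‖w‖ := by
  have hh := M.h_pos
  have hβ0 := Vh.invConst_nonneg k c
  set β := Vh.invConst k c / √M.h with hβ
  have hβ1 : 0 ≤ β := by positivity
  have hcell : ∀ j ∈ Finset.range M.N, |cellForm fl bc M k v w j| ≤ 3 * (β ^ 2 * (‖v‖ * ‖w‖)) := by
    intro j hj
    have hj' := Finset.mem_range.1 hj
    have hl := M.len_pos hj'
    have h1 := abs_mom_le (M.node_lt j hj').le (fun x hx => Vh.abs_eval_poly_le hc v hj' hx)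
      (fun x hx => Vh.abs_eval_derivative_poly_le hc w hj' hx)
    rw [mom_eval, ← hβ] at h1
    have e1 : β * ‖v‖ * (β * ‖w‖ / M.len j) * (M.node (j + 1) - M.node j) =
        β ^ 2 * (‖v‖ * ‖w‖) := by
      rw [← Mesh.len]; field_simp
    rw [e1] at h1
    have h2 : |uTrace fl bc M k (j + 1) v * (Vh.poly j w).eval (M.node (j + 1))| ≤
        β ^ 2 * (‖v‖ * ‖w‖) := by
      rw [abs_mul]
      refine (mul_le_mul (abs_uTrace_le hc v (by omega)) (Vh.abs_eval_poly_le hc w hj'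
        (right_mem_Icc.2 (M.node_lt j hj').le)) (abs_nonneg _) (by positivity)).trans (le_of_eq ?_)
      ring
    have h3 : |uTrace fl bc M k j v * (Vh.poly j w).eval (M.node j)| ≤
        β ^ 2 * (‖v‖ * ‖w‖) := by
      rw [abs_mul]
      refine (mul_le_mul (abs_uTrace_le hc v (by omega)) (Vh.abs_eval_poly_le hc w hj'
        (left_mem_Icc.2 (M.node_lt j hj').le)) (abs_nonneg _) (by positivity)).trans (le_of_eq ?_)
      ring
    rw [cellForm]
    refine (abs_sub _ _).trans ?_
    have h4 := abs_add_le
      (-polyInt (M.node j) (M.node (j + 1)) (Vh.poly j v * derivative (Vh.poly j w)))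
      (uTrace fl bc M k (j + 1) v * (Vh.poly j w).eval (M.node (j + 1)))
    rw [abs_neg] at h4
    linarith
  rw [form_apply]
  refine (Finset.abs_sum_le_sum_abs _ _).trans ((Finset.sum_le_card_nsmul _ _ _ hcell).trans ?_)
  rw [Finset.card_range, nsmul_eq_mul]
  have hN : (M.N : ℝ) ≤ c * (2 * Real.pi) / M.h := by
    rw [le_div_iff₀ hh]; exact M.N_mul_h_le hc
  have e2 : β ^ 2 = Vh.invConst k c ^ 2 / M.h := by rw [hβ, div_pow, Real.sq_sqrt hh.le]
  calc (M.N : ℝ) * (3 * (β ^ 2 * (‖v‖ * ‖w‖)))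
      ≤ c * (2 * Real.pi) / M.h * (3 * (β ^ 2 * (‖v‖ * ‖w‖))) := by gcongr
    _ = formBound k c / M.h ^ 2 * ‖v‖ * ‖w‖ := by
      rw [e2, formBound]; field_simp

end Form

theorem exists_riesz {E : Type*} [NormedAddCommGroup E] [InnerProductSpace ℝ E]
    [FiniteDimensional ℝ E] (B : E →ₗ[ℝ] E →ₗ[ℝ] ℝ) {K : ℝ} (hK : 0 ≤ K)
    (hB : ∀ v w, |B v w| ≤ K * ‖v‖ * ‖w‖) :
    ∃ D : E →L[ℝ] E, (∀ v w, inner ℝ (D v) w = B v w) ∧ ‖D‖ ≤ K := by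
  have : CompleteSpace E := FiniteDimensional.complete ℝ E
  let f : E →ₗ[ℝ] E := (InnerProductSpace.toDual ℝ E).symm.toLinearEquiv.toLinearMap ∘ₗ
    (LinearMap.toContinuousLinearMap (𝕜 := ℝ) (E := E) (F' := ℝ)).toLinearMap ∘ₗ B
  have hf : ∀ v w, inner ℝ (f v) w = B v w := fun v w => by
    simp [f]
  refine ⟨LinearMap.toContinuousLinearMap f, fun v w => by simpa using hf v w, ?_⟩
  refine ContinuousLinearMap.opNorm_le_bound _ hK fun v => ?_
  refine norm_le_of_forall_inner_le (by positivity) fun χ => ?_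
  have := hB v χ
  rw [← hf] at this
  simpa using this

end LDG


/-! ### The corrected interpolant: consistency, size and time derivative. -/

namespace LDG

open Set Filter Topology MeasureTheory Polynomial

/-! ### The corrected interpolant on a cell -/

theorem SmoothChain.shift {n : ℕ} {B : ℝ} {V : ℕ → ℝ → ℝ} (h : SmoothChain n B V) {m i : ℕ}
    (hm : m + i ≤ n) : SmoothChain m B (fun l => V (l + i)) where
  hasDeriv l hl x hx := by
    rw [Nat.add_right_comm]
    exact h.hasDeriv (l + i) (by omega) x hx
  bound l hl := h.bound (l + i) (by omega)
  lipschitz l hl := h.lipschitz (l + i) (by omega)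

/-- The correction of second order. -/
noncomputable def residual (k : ℕ) (a b e σ e' : ℝ) (V : ℕ → ℝ → ℝ) : ℝ[X] :=
  C (((b - a) / 2) ^ 2 * endCoef k a b e σ (V 2)) * corrBar k a b e e'

/-- The corrected Gauss–Radau interpolant of `V 0`, where `V i` is the `i`-th derivative. -/
noncomputable def interp (k : ℕ) (a b e σ e' σ' : ℝ) (V : ℕ → ℝ → ℝ) : ℝ[X] :=
  gaussRadau k a b e (V 0) -
    (residual k a b e σ e' V + C ((b - a) / 2 * endCoef k a b e' σ' (V 1)) * corr k a b e)

section Interp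

variable {k : ℕ} {a b e σ e' σ' : ℝ} {V : ℕ → ℝ → ℝ}

theorem natDegree_C_mul_le_of_le {p : ℝ[X]} {n : ℕ} (hp : p.natDegree ≤ n) (r : ℝ) :
    (C r * p).natDegree ≤ n := (natDegree_C_mul_le r p).trans hp

theorem natDegree_residual_le (hab : a < b) (he : IsEnd a b e σ) :
    (residual k a b e σ e' V).natDegree ≤ k :=
  natDegree_C_mul_le_of_le (natDegree_corrBar_le hab he) _

theorem natDegree_interp_le (hab : a < b) (he : IsEnd a b e σ) (hV : ContinuousOn (V 0) (Icc a b)) :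
    (interp k a b e σ e' σ' V).natDegree ≤ k :=
  (natDegree_sub_le_of_le (gaussRadau_spec hab he hV).1
    (natDegree_add_le_of_degree_le (natDegree_residual_le hab he)
      (natDegree_C_mul_le_of_le (natDegree_corr_le hab he) _))).trans (max_self k).le

/-- Both corrections vanish at e. Exactness there is what lets the interpolant be replaced by the
solution in the fluxes. -/
theorem eval_interp (hab : a < b) (hk : 2 ≤ k) (he : IsEnd a b e σ) (he' : IsEnd a b e' σ')
    (hV : ContinuousOn (V 0) (Icc a b)) : (interp k a b e σ e' σ' V).eval e = V 0 e := by
  rw [interp, residual, eval_sub, (gaussRadau_spec hab he hV).2.2, eval_add, eval_mul, eval_mul,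
    eval_corrBar hab hk he he', eval_corr hab (by omega) he]
  ring

theorem mom_deriv {v v' : ℝ → ℝ} (hab : a ≤ b)
    (hd : ∀ x ∈ Icc a b, HasDerivWithinAt v (v' x) (Icc a b) x) (hc : ContinuousOn v' (Icc a b))
    (w : ℝ[X]) : mom a b v' w = v b * w.eval b - v a * w.eval a - mom a b v (derivative w) := by
  have hcv : ContinuousOn v (Icc a b) := fun x hx => (hd x hx).continuousWithinAt
  have := intervalIntegral.integral_eq_sub_of_hasDeriv_right (a := a) (b := b)
    (f := fun x => v x * w.eval x) (f' := fun x => v' x * w.eval x + v x * (derivative w).eval x)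
    (by rw [uIcc_of_le hab]; exact hcv.mul w.continuous.continuousOn)
    (fun x hx => by
      rw [min_eq_left hab, max_eq_right hab] at hx
      have h1 := (hd x (Ioo_subset_Icc_self hx)).hasDerivAt (Icc_mem_nhds hx.1 hx.2)
      exact (h1.mul (w.hasDerivAt x)).hasDerivWithinAt)
    ((intervalIntegrable_mul_eval hab hc w).add (intervalIntegrable_mul_eval hab hcv _))
  rw [intervalIntegral.integral_add (intervalIntegrable_mul_eval hab hc w)
    (intervalIntegrable_mul_eval hab hcv _)] at this
  unfold mom
  linarith

/-- The interpolants of a function and of its derivative satisfy the equation of the scheme up to a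
residual. -/
theorem polyInt_interp_mul (hab : a < b) (hk : 2 ≤ k) (he : IsEnd a b e σ) (he' : IsEnd a b e' σ')
    (hd : ∀ x ∈ Icc a b, HasDerivWithinAt (V 0) (V 1 x) (Icc a b) x)
    (hc : ContinuousOn (V 1) (Icc a b)) {w : ℝ[X]} (hw : w.natDegree ≤ k) :
    polyInt a b (interp k a b e' σ' e σ (fun i => V (i + 1)) * w) =
      -polyInt a b (interp k a b e σ e' σ' V * derivative w) + V 0 b * w.eval b - V 0 a * w.eval a -
        polyInt a b (residual k a b e' σ' e (fun i => V (i + 1)) * w) := by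
  have hcv : ContinuousOn (V 0) (Icc a b) := fun x hx => (hd x hx).continuousWithinAt
  have hw' : (derivative w).natDegree < k :=
    (natDegree_derivative_le w).trans_lt (by omega)
  have h1 := mom_sub_polyInt_gaussRadau (k := k) hab he' hc hw
  have h2 := mom_sub_polyInt_gaussRadau (k := k) hab he hcv hw'.le
  rw [polyInt_legP_mul hab hw', mul_zero] at h2
  have h3 := polyInt_legP_mul_eq_corr hab (by omega : 1 ≤ k) he hw
  have h4 := polyInt_corr_mul_eq_corrBar hab hk he he' hw
  have h5 := mom_deriv hab.le hd hc w
  simp only [interp, residual, sub_mul, add_mul, mul_assoc, map_sub, map_add, polyInt_C_mul,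
    zero_add] at *
  rw [h4]
  rw [h3] at h1
  linear_combination -h1 - h2 + h5

/-- Here m counts the further classical derivatives of V i that are spent; the Lipschitz bound of
the last one yields the extra power of h. -/
theorem abs_endCoef_le_of_smoothChain {n m i : ℕ} {B h : ℝ} (hV : SmoothChain n B V) (hab : a < b)
    (hsub : Icc a b ⊆ Omega) (hh : b - a ≤ h) (he : IsEnd a b e σ) (hm : i + m ≤ n) (hmk : m ≤ k) :
    |endCoef k a b e σ (V i)| ≤ 2 * grBound k * (B * h ^ (m + 1)) := by
  have hB := hV.nonneg
  have hba : 0 ≤ b - a := sub_nonneg.2 hab.le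
  obtain ⟨p, hp, hpv⟩ := exists_poly_approx hab.le m (fun l => V (l + i))
    (fun l hl x hx => by
      rw [Nat.add_right_comm]
      exact (hV.hasDeriv (l + i) (by omega) x (hsub hx)).mono hsub)
    (fun x hx y hy => hV.lipschitz (m + i) (by omega) x (hsub hx) y (hsub hy)) hB
  simp only [zero_add] at hpv
  have h1 := abs_endCoef_le_of_approx hab he ((hV.continuousOn (by omega : i ≤ n)).mono hsub)
    (hp.trans hmk) hpv
  have := one_le_grBound k
  exact h1.trans (by gcongr)

theorem abs_eval_residual_le {n m : ℕ} {B h x : ℝ} (hV : SmoothChain n B V) (hab : a < b)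
    (hsub : Icc a b ⊆ Omega) (hh : b - a ≤ h) (he : IsEnd a b e σ) (he' : IsEnd a b e' σ')
    (hm : 2 + m ≤ n) (hmk : m ≤ k) (hx : x ∈ Icc a b) :
    |(residual k a b e σ e' V).eval x| ≤ grBound k * corrBound k * B * h ^ (m + 3) := by
  have hB := hV.nonneg
  have hba : 0 < b - a := sub_pos.2 hab
  have h0 : 0 < h := hba.trans_le hh
  have h1 := abs_endCoef_le_of_smoothChain (k := k) (i := 2) hV hab hsub hh he hm hmk
  have h2 := abs_corrBar_le (k := k) hab he he' hx
  have h3 := one_le_grBound k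
  have h4 : 0 ≤ corrBound k := (abs_nonneg _).trans h2
  rw [residual, eval_mul, eval_C, abs_mul, abs_mul, abs_of_nonneg (by positivity)]
  calc ((b - a) / 2) ^ 2 * |endCoef k a b e σ (V 2)| * |(corrBar k a b e e').eval x|
      ≤ (h / 2) ^ 2 * (2 * grBound k * (B * h ^ (m + 1))) * corrBound k := by gcongr
    _ = (grBound k * corrBound k * B * h ^ (m + 3)) / 2 := by ring
    _ ≤ _ := half_le_self (by positivity)

/-- The constant in the error of the corrected interpolant at the Radau points. -/
noncomputable def interpBound (k : ℕ) : ℝ := 1 + grBound k + 2 * grBound k * corrBound k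

/-- At a Radau point only approximation by degree k + 1 matters. The first correction has size h ·
h^{k+1}, the second h² · h^k because V 2 has k − 1 further derivatives in the chain. -/
theorem abs_sub_interp_le {B h x : ℝ} (hk : 1 ≤ k) (hV : SmoothChain (k + 1) B V) (hab : a < b)
    (hsub : Icc a b ⊆ Omega) (hh : b - a ≤ h) (he : IsEnd a b e σ) (he' : IsEnd a b e' σ')
    (hx : x ∈ Icc a b) (hR : legendre a b (k + 1) x - σ * legendre a b k x = 0) :
    |V 0 x - (interp k a b e σ e' σ' V).eval x| ≤ interpBound k * B * h ^ (k + 2) := by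
  have hB := hV.nonneg
  have hba : 0 < b - a := sub_pos.2 hab
  have h0 : 0 < h := hba.trans_le hh
  obtain ⟨p, hp, hpv⟩ := exists_poly_approx hab.le (k + 1) V
    (fun l hl x hx => (hV.hasDeriv l hl x (hsub hx)).mono hsub)
    (fun x hx y hy => hV.lipschitz (k + 1) le_rfl x (hsub hx) y (hsub hy)) hB
  have h1 := abs_sub_gaussRadau_le_of_radau hab he ((hV.continuousOn (Nat.zero_le _)).mono hsub) hp
    hpv hx hR
  have h2 := abs_eval_residual_le (k := k) (m := k - 1) hV hab hsub hh he he' (by omega) (by omega) hx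
  rw [show k - 1 + 3 = k + 2 by omega] at h2
  have h3 := abs_endCoef_le_of_smoothChain (k := k) (i := 1) (m := k) hV hab hsub hh he' (by omega)
    le_rfl
  have h4 := abs_corr_le_corrBound (k := k) hab he hx
  have h5 := one_le_grBound k
  have h6 : 0 ≤ corrBound k := (abs_nonneg _).trans h4
  have h7 : |(b - a) / 2 * endCoef k a b e' σ' (V 1) * (corr k a b e).eval x| ≤
      grBound k * corrBound k * B * h ^ (k + 2) := by
    rw [abs_mul, abs_mul, abs_of_nonneg (by positivity : 0 ≤ (b - a) / 2)]
    calc (b - a) / 2 * |endCoef k a b e' σ' (V 1)| * |(corr k a b e).eval x|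
        ≤ h / 2 * (2 * grBound k * (B * h ^ (k + 1))) * corrBound k := by gcongr
      _ = _ := by ring
  have h8 : (1 + grBound k) * (B * (b - a) ^ (k + 1 + 1)) ≤ (1 + grBound k) * (B * h ^ (k + 2)) := by
    gcongr
  rw [interp, eval_sub, eval_add, eval_mul, eval_C, sub_sub_eq_add_sub, add_sub_right_comm,
    ← add_assoc]
  refine (abs_add_three _ _ _).trans ?_
  rw [interpBound]
  linarith

end Interp

/-! ### Time derivatives of the interpolants -/

section Time

variable {n k : ℕ} {B T t a b e σ e' σ' : ℝ} {U : ℕ → ℝ → ℝ → ℝ}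

theorem HeatChain.hasDerivWithinAt_mom (h : HeatChain n B T U) {i : ℕ} (hi : i + 2 ≤ n)
    (ht : t ∈ Icc 0 T) (hab : a < b) (hsub : Icc a b ⊆ Omega) (w : ℝ[X]) :
    HasDerivWithinAt (fun s => mom a b (U i s) w) (mom a b (U (i + 2) t) w) (Icc 0 T) t :=
  h.hasDerivWithinAt_integral hi ht hab.le hsub w.continuous

theorem HeatChain.hasDerivWithinAt_endCoef (h : HeatChain n B T U) {i : ℕ} (hi : i + 2 ≤ n)
    (ht : t ∈ Icc 0 T) (hab : a < b) (hsub : Icc a b ⊆ Omega) (he : IsEnd a b e σ) :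
    HasDerivWithinAt (fun s => endCoef k a b e σ (U i s)) (endCoef k a b e σ (U (i + 2) t))
      (Icc 0 T) t := by
  simp only [endCoef_eq]
  exact ((h.time i hi t ht e (hsub (he.mem hab.le))).const_mul _).add
    ((h.hasDerivWithinAt_mom hi ht hab hsub _).const_mul _)

theorem HeatChain.hasDerivWithinAt_grCoef (h : HeatChain n B T U) {i : ℕ} (hi : i + 2 ≤ n)
    (ht : t ∈ Icc 0 T) (hab : a < b) (hsub : Icc a b ⊆ Omega) (he : IsEnd a b e σ) (m : ℕ) :
    HasDerivWithinAt (fun s => grCoef k a b e σ (U i s) m) (grCoef k a b e σ (U (i + 2) t) m)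
      (Icc 0 T) t := by
  have hl : ∀ m, HasDerivWithinAt (fun s => legCoef a b m (U i s)) (legCoef a b m (U (i + 2) t))
      (Icc 0 T) t := fun m => by
    simp only [legCoef_eq]
    exact (h.hasDerivWithinAt_mom hi ht hab hsub _).const_mul _
  unfold grCoef
  split_ifs
  · exact ((h.time i hi t ht e (hsub (he.mem hab.le))).sub
      (HasDerivWithinAt.fun_sum fun m _ => (hl m).mul_const _)).const_mul _
  · exact hl m

theorem HeatChain.hasDerivWithinAt_coeff_residual (h : HeatChain n B T U) (hn : 4 ≤ n)
    (ht : t ∈ Icc 0 T) (hab : a < b) (hsub : Icc a b ⊆ Omega) (he : IsEnd a b e σ) (m : ℕ) :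
    HasDerivWithinAt (fun s => (residual k a b e σ e' (fun i => U i s)).coeff m)
      ((residual k a b e σ e' (fun i => U (i + 2) t)).coeff m) (Icc 0 T) t := by
  simp only [residual, coeff_C_mul]
  exact ((h.hasDerivWithinAt_endCoef (i := 2) (by omega) ht hab hsub he).const_mul _).mul_const _

/-- By the heat equation ∂_t shifts the chain by two. The second correction contains U 2, so U 4 is
reached. -/
theorem HeatChain.hasDerivWithinAt_coeff_interp (h : HeatChain n B T U) (hn : 4 ≤ n)
    (ht : t ∈ Icc 0 T) (hab : a < b) (hsub : Icc a b ⊆ Omega) (he : IsEnd a b e σ)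
    (he' : IsEnd a b e' σ') (m : ℕ) :
    HasDerivWithinAt (fun s => (interp k a b e σ e' σ' (fun i => U i s)).coeff m)
      ((interp k a b e σ e' σ' (fun i => U (i + 2) t)).coeff m) (Icc 0 T) t := by
  -- The projection is given by a choice operator; its dependence on time becomes visible in the
  -- explicit Legendre expansion.
  have hgr : ∀ i ≤ n, ∀ s ∈ Icc 0 T, gaussRadau k a b e (U i s) = grPoly k a b e σ (U i s) :=
    fun i hi s hs => gaussRadau_eq_grPoly hab he (((h.chain s hs).continuousOn hi).mono hsub)
  have h1 : HasDerivWithinAt (fun s => (gaussRadau k a b e (U 0 s)).coeff m)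
      ((gaussRadau k a b e (U 2 t)).coeff m) (Icc 0 T) t := by
    rw [hgr 2 (by omega) t ht]
    refine HasDerivWithinAt.congr_of_mem (f := fun s => (grPoly k a b e σ (U 0 s)).coeff m) ?_
      (fun s hs => by rw [hgr 0 (by omega) s hs]) ht
    simp only [grPoly, finsetSum_coeff, coeff_C_mul]
    exact HasDerivWithinAt.fun_sum fun l _ =>
      (h.hasDerivWithinAt_grCoef (i := 0) (by omega) ht hab hsub he l).mul_const _
  simp only [interp, coeff_sub, coeff_add, coeff_C_mul]
  exact h1.sub ((h.hasDerivWithinAt_coeff_residual hn ht hab hsub he m).add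
    (((h.hasDerivWithinAt_endCoef (i := 1) (by omega) ht hab hsub he').const_mul _).mul_const _))

end Time

/-! ### The ends of a cell used by the fluxes -/

namespace Flux

/-- The end of the cell `(a, b)` at which `û` is the trace from the cell. -/
def uEnd (fl : Flux) (a b : ℝ) : ℝ :=
  match fl with
  | .minusPlus => b
  | .plusMinus => a

/-- The end of the cell `(a, b)` at which `q̂` is the trace from the cell. -/
def qEnd (fl : Flux) (a b : ℝ) : ℝ :=
  match fl with
  | .minusPlus => a
  | .plusMinus => b

/-- The value of `L_1` at `uEnd`. -/
def sgn : Flux → ℝ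
  | .minusPlus => 1
  | .plusMinus => -1

theorem isEnd_uEnd (fl : Flux) (a b : ℝ) : IsEnd a b (fl.uEnd a b) fl.sgn := by
  cases fl <;> simp [uEnd, sgn, IsEnd]

theorem isEnd_qEnd (fl : Flux) (a b : ℝ) : IsEnd a b (fl.qEnd a b) (-fl.sgn) := by
  cases fl <;> simp [qEnd, sgn, IsEnd]

end Flux

section Trace

variable {fl : Flux} {bc : Boundary} {M : Mesh} {k : ℕ} {T t : ℝ} {u : ℝ → ℝ → ℝ}

/-- When ξ is the numerical solution minus an interpolant exact at the end feeding the flux, the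
flux error is the homogeneous trace of ξ. At the boundary of Ω the data of the scheme and of the
solution cancel. -/
theorem uFlux_sub (hbc : BoundaryCondition fl bc T u) (ht : t ∈ Icc 0 T) {v : ℕ → ℝ[X]}
    {ξ : Vh M k} (h : ∀ j < M.N, (Vh.poly j ξ).eval (fl.uEnd (M.node j) (M.node (j + 1))) =
      (v j).eval (fl.uEnd (M.node j) (M.node (j + 1))) - u t (fl.uEnd (M.node j) (M.node (j + 1))))
    {i : ℕ} (hi : i ≤ M.N) :
    uFlux fl bc M t v i - u t (M.node i) = uTrace fl bc M k i ξ := by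
  have hN := M.N_pos
  have hz := M.node_zero
  have hl := M.node_last
  rw [uTrace_apply]
  cases fl with
  | minusPlus =>
    simp only [Flux.uEnd] at h
    have hlast := h (M.N - 1) (by omega)
    rw [Nat.sub_add_cancel hN] at hlast
    rcases Nat.eq_zero_or_pos i with rfl | hpos
    · cases bc with
      | periodic =>
        have := (hbc t ht).1
        simp only [uFlux, Boundary.homog, leftTrace, lastValue, if_true, hlast]
        rw [hz, this, hl]
      | mixed g₀ g₁ =>
        have := (hbc t ht).1
        simp only [uFlux, Boundary.homog, leftTrace, if_true]
        rw [hz, this, sub_self]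
    · have := h (i - 1) (by omega)
      rw [Nat.sub_add_cancel hpos] at this
      cases bc <;> simp only [uFlux, Boundary.homog, leftTrace, if_neg hpos.ne', this]
  | plusMinus =>
    simp only [Flux.uEnd] at h
    rcases hi.eq_or_lt with rfl | hlt
    · cases bc with
      | periodic =>
        have := (hbc t ht).1
        simp only [uFlux, Boundary.homog, rightTrace, firstValue, if_true, h 0 hN]
        rw [hz, this, hl]
      | mixed g₀ g₁ =>
        have := (hbc t ht).2
        simp only [uFlux, Boundary.homog, rightTrace, if_true]
        rw [hl, this, sub_self]
    · cases bc <;> simp only [uFlux, Boundary.homog, rightTrace, if_neg hlt.ne, h i hlt]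

theorem qFlux_sub (hbc : BoundaryCondition fl bc T u) (ht : t ∈ Icc 0 T) {v : ℕ → ℝ[X]}
    {η : Vh M k} (h : ∀ j < M.N, (Vh.poly j η).eval (fl.qEnd (M.node j) (M.node (j + 1))) =
      (v j).eval (fl.qEnd (M.node j) (M.node (j + 1))) -
        qOf u t (fl.qEnd (M.node j) (M.node (j + 1))))
    {i : ℕ} (hi : i ≤ M.N) :
    qFlux fl bc M t v i - qOf u t (M.node i) = qTrace fl bc M k i η := by
  have hN := M.N_pos
  have hz := M.node_zero
  have hl := M.node_last
  rw [qTrace]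
  cases fl with
  | plusMinus =>
    simp only [Flux.qEnd] at h
    have hlast := h (M.N - 1) (by omega)
    rw [Nat.sub_add_cancel hN] at hlast
    rcases Nat.eq_zero_or_pos i with rfl | hpos
    · cases bc with
      | periodic =>
        have := (hbc t ht).2
        simp only [qFlux, Boundary.homog, leftTrace, lastValue, if_true, hlast]
        rw [hz, this, hl]
      | mixed g₀ g₁ =>
        have := (hbc t ht).1
        simp only [qFlux, Boundary.homog, leftTrace, if_true]
        rw [hz, this, sub_self]
    · have := h (i - 1) (by omega)
      rw [Nat.sub_add_cancel hpos] at this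
      cases bc <;> simp only [qFlux, Boundary.homog, leftTrace, if_neg hpos.ne', this]
  | minusPlus =>
    simp only [Flux.qEnd] at h
    rcases hi.eq_or_lt with rfl | hlt
    · cases bc with
      | periodic =>
        have := (hbc t ht).2
        simp only [qFlux, Boundary.homog, rightTrace, firstValue, if_true, h 0 hN]
        rw [hz, this, hl]
      | mixed g₀ g₁ =>
        have := (hbc t ht).2
        simp only [qFlux, Boundary.homog, rightTrace, if_true]
        rw [hl, this, sub_self]
    · cases bc <;> simp only [qFlux, Boundary.homog, rightTrace, if_neg hlt.ne, h i hlt]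

end Trace

end LDG


/-! ### The error equations and the final estimate. -/

namespace LDG

open Set Filter Topology MeasureTheory Polynomial

/-! ### The error equations -/

namespace Vh

variable {M : Mesh} {k : ℕ}

open Classical in
/-- The element of the finite element space with the given polynomials, or `0` if their degrees are
too large. -/
noncomputable def lift (p : ℕ → ℝ[X]) : Vh M k := if hp : InVh M k p then ofPoly p hp else 0

theorem poly_lift {p : ℕ → ℝ[X]} (hp : InVh M k p) {j : ℕ} (hj : j < M.N) :
    poly j (lift p : Vh M k) = p j := by
  rw [lift, dif_pos hp, poly_ofPoly hp hj]

theorem hasDerivWithinAt_lift {p : ℝ → ℕ → ℝ[X]} {p' : ℕ → ℝ[X]} {S : Set ℝ} {t : ℝ}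
    (hp : ∀ s ∈ S, InVh M k (p s)) (hp' : InVh M k p') (ht : t ∈ S)
    (h : ∀ j < M.N, ∀ n, HasDerivWithinAt (fun s => (p s j).coeff n) ((p' j).coeff n) S t) :
    HasDerivWithinAt (fun s => (lift (p s) : Vh M k)) (lift p') S t := by
  refine hasDerivWithinAt_of_coeff fun j hj n => ?_
  rw [poly_lift hp' hj]
  exact (h j hj n).congr_of_mem (fun s hs => by rw [poly_lift (hp s hs) hj]) ht

end Vh

/-- The interpolant of `u` on the cell `j`. -/
noncomputable def uInterp (fl : Flux) (M : Mesh) (k : ℕ) (V : ℕ → ℝ → ℝ) (j : ℕ) : ℝ[X] :=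
  interp k (M.node j) (M.node (j + 1)) (fl.uEnd (M.node j) (M.node (j + 1))) fl.sgn
    (fl.qEnd (M.node j) (M.node (j + 1))) (-fl.sgn) V

/-- The interpolant of `q` on the cell `j`. -/
noncomputable def qInterp (fl : Flux) (M : Mesh) (k : ℕ) (V : ℕ → ℝ → ℝ) (j : ℕ) : ℝ[X] :=
  interp k (M.node j) (M.node (j + 1)) (fl.qEnd (M.node j) (M.node (j + 1))) (-fl.sgn)
    (fl.uEnd (M.node j) (M.node (j + 1))) fl.sgn V

/-- The residual of the equation for `u` on the cell `j`. -/
noncomputable def uResidual (fl : Flux) (M : Mesh) (k : ℕ) (V : ℕ → ℝ → ℝ) (j : ℕ) : ℝ[X] :=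
  residual k (M.node j) (M.node (j + 1)) (fl.uEnd (M.node j) (M.node (j + 1))) fl.sgn
    (fl.qEnd (M.node j) (M.node (j + 1))) V

/-- The residual of the equation for `q` on the cell `j`. -/
noncomputable def qResidual (fl : Flux) (M : Mesh) (k : ℕ) (V : ℕ → ℝ → ℝ) (j : ℕ) : ℝ[X] :=
  residual k (M.node j) (M.node (j + 1)) (fl.qEnd (M.node j) (M.node (j + 1))) (-fl.sgn)
    (fl.uEnd (M.node j) (M.node (j + 1))) V

section InVh

variable {fl : Flux} {M : Mesh} {k n : ℕ} {B : ℝ} {V : ℕ → ℝ → ℝ}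

theorem SmoothChain.inVh_uInterp (hV : SmoothChain n B V) : InVh M k (uInterp fl M k V) :=
  fun j hj => natDegree_interp_le (M.node_lt j hj) (fl.isEnd_uEnd _ _)
    ((hV.continuousOn (Nat.zero_le n)).mono (M.Icc_subset_Omega hj))

theorem SmoothChain.inVh_qInterp (hV : SmoothChain n B V) : InVh M k (qInterp fl M k V) :=
  fun j hj => natDegree_interp_le (M.node_lt j hj) (fl.isEnd_qEnd _ _)
    ((hV.continuousOn (Nat.zero_le n)).mono (M.Icc_subset_Omega hj))

theorem inVh_uResidual : InVh M k (uResidual fl M k V) :=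
  fun j hj => natDegree_residual_le (M.node_lt j hj) (fl.isEnd_uEnd _ _)

theorem inVh_qResidual : InVh M k (qResidual fl M k V) :=
  fun j hj => natDegree_residual_le (M.node_lt j hj) (fl.isEnd_qEnd _ _)

theorem InVh.sub {p q : ℕ → ℝ[X]} (hp : InVh M k p) (hq : InVh M k q) :
    InVh M k (fun j => p j - q j) :=
  fun j hj => (natDegree_sub_le_of_le (hp j hj) (hq j hj)).trans (max_self k).le

theorem norm_lift_uResidual_le (hV : SmoothChain n B V) {m : ℕ} (hm : 2 + m ≤ n) (hmk : m ≤ k) :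
    ‖(Vh.lift (uResidual fl M k V) : Vh M k)‖ ≤
      3 * (grBound k * corrBound k * B * M.h ^ (m + 3)) := by
  have key := fun j (hj : j < M.N) x hx => abs_eval_residual_le (k := k) (x := x) hV
    (M.node_lt j hj) (M.Icc_subset_Omega hj) (M.len_le_h hj) (fl.isEnd_uEnd _ _)
    (fl.isEnd_qEnd _ _) hm hmk hx
  refine Vh.norm_le_of_abs_le ((abs_nonneg _).trans
    (key 0 M.N_pos _ (left_mem_Icc.2 (M.node_lt 0 M.N_pos).le))) fun j hj x hx => ?_
  rw [Vh.poly_lift inVh_uResidual hj]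
  exact key j hj x hx

theorem norm_lift_qResidual_le (hV : SmoothChain n B V) {m : ℕ} (hm : 2 + m ≤ n) (hmk : m ≤ k) :
    ‖(Vh.lift (qResidual fl M k V) : Vh M k)‖ ≤
      3 * (grBound k * corrBound k * B * M.h ^ (m + 3)) := by
  have key := fun j (hj : j < M.N) x hx => abs_eval_residual_le (k := k) (x := x) hV
    (M.node_lt j hj) (M.Icc_subset_Omega hj) (M.len_le_h hj) (fl.isEnd_qEnd _ _)
    (fl.isEnd_uEnd _ _) hm hmk hx
  refine Vh.norm_le_of_abs_le ((abs_nonneg _).trans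
    (key 0 M.N_pos _ (left_mem_Icc.2 (M.node_lt 0 M.N_pos).le))) fun j hj x hx => ?_
  rw [Vh.poly_lift inVh_qResidual hj]
  exact key j hj x hx

end InVh

/-- The prescribed initial value contains the time derivative of a coefficient of u, the interpolant
the same coefficient of U 2. They agree by the heat equation, also at t = 0. -/
theorem interpCell_eq {fl : Flux} {n k : ℕ} {B T t a b : ℝ} {u : ℝ → ℝ → ℝ} {U : ℕ → ℝ → ℝ → ℝ}
    (hT : 0 < T) (hn : 2 ≤ n) (hU : HeatChain n B T U)
    (hEq : ∀ t ∈ Icc 0 T, EqOn (u t) (U 0 t) Omega ∧ EqOn (qOf u t) (U 1 t) Omega)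
    (ht : t ∈ Icc 0 T) (hab : a < b) (hsub : Icc a b ⊆ Omega) :
    interpCell fl k T u t a b =
      interp k a b (fl.uEnd a b) fl.sgn (fl.qEnd a b) (-fl.sgn) (fun i => U i t) := by
  have hu := fun s hs => (hEq s hs).1.mono hsub
  have hq := (hEq t ht).2.mono hsub
  have hd : ∀ e σ, IsEnd a b e σ → derivWithin (fun s => endCoef k a b e σ (u s)) (Icc 0 T) t =
      endCoef k a b e σ (U 2 t) := fun e σ he =>
    ((hU.hasDerivWithinAt_endCoef (i := 0) (k := k) hn ht hab hsub he).congr_of_mem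
      (fun s hs => endCoef_congr hab he (hu s hs)) ht).derivWithin (uniqueDiffOn_Icc hT t ht)
  have ha : IsEnd a b a (-1) := Or.inr ⟨rfl, rfl⟩
  have hb : IsEnd a b b 1 := Or.inl ⟨rfl, rfl⟩
  have hcu := ((hU.chain t ht).continuousOn (Nat.zero_le n)).mono hsub
  have hgr : ∀ e σ, IsEnd a b e σ → gaussRadau k a b e (u t) = gaussRadau k a b e (U 0 t) :=
    fun e σ he => gaussRadau_congr hab he hcu (hu t ht)
  cases fl with
  | minusPlus =>
    simp only [interpCell, interp, residual, Flux.uEnd, Flux.qEnd, Flux.sgn, projMinus, coeffMinus_eq,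
      coeffPlus_eq, F1bar, F2, F1, projPlus, corr_eq, hd b 1 hb, hgr b 1 hb,
      endCoef_congr hab ha hq]
    rfl
  | plusMinus =>
    simp only [interpCell, interp, residual, Flux.uEnd, Flux.qEnd, Flux.sgn, projMinus, coeffMinus_eq,
      coeffPlus_eq, F2bar, F2, F1, projPlus, corr_eq, hd a (-1) ha, hgr a (-1) ha,
      endCoef_congr hab hb hq, neg_neg]
    rw [add_comm (C _ * corr k a b a)]
    rfl

section Errors

variable (fl : Flux) (M : Mesh) (k : ℕ) (U : ℕ → ℝ → ℝ → ℝ) (uh qh : ℝ → ℕ → ℝ[X])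

/-- The difference of `u_h` and the interpolant of `u`. -/
noncomputable def uError (s : ℝ) : Vh M k :=
  Vh.lift fun j => uh s j - uInterp fl M k (fun i => U i s) j

/-- The difference of `q_h` and the interpolant of `q`. -/
noncomputable def qError (s : ℝ) : Vh M k :=
  Vh.lift fun j => qh s j - qInterp fl M k (fun i => U (i + 1) s) j

/-- The polynomial whose coefficients are the time derivatives of those of `u_h`. -/
noncomputable def timeDeriv (T s : ℝ) (j : ℕ) : ℝ[X] :=
  ∑ n ∈ Finset.range (k + 1), C (derivWithin (fun s => (uh s j).coeff n) (Icc 0 T) s) * X ^ n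

end Errors

section Errors

variable {fl : Flux} {bc : Boundary} {M : Mesh} {k : ℕ} {B T c : ℝ} {u₀ : ℝ → ℝ} {u : ℝ → ℝ → ℝ}
  {U : ℕ → ℝ → ℝ → ℝ} {uh qh : ℝ → ℕ → ℝ[X]}

theorem inVh_timeDeriv (s : ℝ) : InVh M k (timeDeriv k uh T s) := fun _ _ =>
  natDegree_sum_le_of_forall_le _ _ fun n hn =>
    (natDegree_C_mul_X_pow_le _ n).trans (Nat.lt_succ_iff.1 (Finset.mem_range.1 hn))

theorem coeff_timeDeriv (s : ℝ) (j n : ℕ) : (timeDeriv k uh T s j).coeff n =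
    if n < k + 1 then derivWithin (fun s => (uh s j).coeff n) (Icc 0 T) s else 0 := by
  simp [timeDeriv, finsetSum_coeff, coeff_X_pow]

theorem IsLDGSolution.hasDerivWithinAt_coeff (h : IsLDGSolution fl bc M k T uh qh) {t : ℝ}
    (ht : t ∈ Icc 0 T) {j : ℕ} (hj : j < M.N) (n : ℕ) :
    HasDerivWithinAt (fun s => (uh s j).coeff n) ((timeDeriv k uh T t j).coeff n) (Icc 0 T) t := by
  rw [coeff_timeDeriv]
  split_ifs with hn
  · exact (h.differentiable j hj n t ht).hasDerivWithinAt
  · refine (hasDerivWithinAt_const t (Icc 0 T) (0 : ℝ)).congr_of_mem (fun s hs => ?_) ht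
    exact coeff_eq_zero_of_natDegree_lt ((h.u_mem s hs j hj).trans_lt (by omega))

theorem IsLDGSolution.derivWithin_eval (hT : 0 < T) (h : IsLDGSolution fl bc M k T uh qh) {t : ℝ}
    (ht : t ∈ Icc 0 T) {j : ℕ} (hj : j < M.N) (x : ℝ) :
    derivWithin (fun s => (uh s j).eval x) (Icc 0 T) t = (timeDeriv k uh T t j).eval x := by
  refine HasDerivWithinAt.derivWithin ?_ (uniqueDiffOn_Icc hT t ht)
  rw [eval_eq_sum_range' (Nat.lt_succ_of_le (inVh_timeDeriv (T := T) (uh := uh) t j hj))]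
  exact HasDerivWithinAt.congr_of_mem
    (HasDerivWithinAt.fun_sum fun n _ => (h.hasDerivWithinAt_coeff ht hj n).mul_const (x ^ n))
    (fun s hs => eval_eq_sum_range' (Nat.lt_succ_of_le (h.u_mem s hs j hj)) x) ht

theorem poly_uError (hld : IsLDGSolution fl bc M k T uh qh) {n : ℕ} (hU : HeatChain n B T U) {t : ℝ}
    (ht : t ∈ Icc 0 T) {j : ℕ} (hj : j < M.N) :
    Vh.poly j (uError fl M k U uh t) = uh t j - uInterp fl M k (fun i => U i t) j :=
  Vh.poly_lift ((hld.u_mem t ht).sub (hU.chain t ht).inVh_uInterp) hj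

theorem poly_qError (hld : IsLDGSolution fl bc M k T uh qh) (hU : HeatChain (k + 3) B T U) {t : ℝ}
    (ht : t ∈ Icc 0 T) {j : ℕ} (hj : j < M.N) :
    Vh.poly j (qError fl M k U qh t) = qh t j - qInterp fl M k (fun i => U (i + 1) t) j :=
  Vh.poly_lift ((hld.q_mem t ht).sub
    ((hU.chain t ht).shift (m := 0) (by omega : 0 + 1 ≤ k + 3)).inVh_qInterp) hj

theorem HeatChain.hasDeriv_cell {n : ℕ} (hU : HeatChain n B T U) {t : ℝ} (ht : t ∈ Icc 0 T) {j : ℕ}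
    (hj : j < M.N) {i : ℕ} (hi : i < n) : ∀ x ∈ Icc (M.node j) (M.node (j + 1)),
      HasDerivWithinAt (U i t) (U (i + 1) t x) (Icc (M.node j) (M.node (j + 1))) x := fun x hx =>
  ((hU.chain t ht).hasDeriv i hi x (M.Icc_subset_Omega hj hx)).mono (M.Icc_subset_Omega hj)

theorem HeatChain.continuousOn_cell {n : ℕ} (hU : HeatChain n B T U) {t : ℝ} (ht : t ∈ Icc 0 T)
    {j : ℕ} (hj : j < M.N) {i : ℕ} (hi : i ≤ n) :
    ContinuousOn (U i t) (Icc (M.node j) (M.node (j + 1))) :=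
  ((hU.chain t ht).continuousOn hi).mono (M.Icc_subset_Omega hj)

theorem uTrace_uError (hk : 2 ≤ k) (hbc : BoundaryCondition fl bc T u) {n : ℕ}
    (hld : IsLDGSolution fl bc M k T uh qh) (hU : HeatChain n B T U)
    (hEq : ∀ t ∈ Icc 0 T, EqOn (u t) (U 0 t) Omega ∧ EqOn (qOf u t) (U 1 t) Omega) {t : ℝ}
    (ht : t ∈ Icc 0 T) {i : ℕ} (hi : i ≤ M.N) :
    uTrace fl bc M k i (uError fl M k U uh t) =
      uFlux fl bc M t (uh t) i - U 0 t (M.node i) := by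
  rw [← (hEq t ht).1 (M.node_mem_Omega hi)]
  refine (uFlux_sub hbc ht (fun j hj => ?_) hi).symm
  have he := fl.isEnd_uEnd (M.node j) (M.node (j + 1))
  rw [poly_uError hld hU ht hj, eval_sub, uInterp, eval_interp (M.node_lt j hj) hk he
    (fl.isEnd_qEnd _ _) (hU.continuousOn_cell ht hj (Nat.zero_le n)),
    (hEq t ht).1 (M.Icc_subset_Omega hj (he.mem (M.node_lt j hj).le))]

theorem qTrace_qError (hk : 2 ≤ k) (hbc : BoundaryCondition fl bc T u)
    (hld : IsLDGSolution fl bc M k T uh qh) (hU : HeatChain (k + 3) B T U)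
    (hEq : ∀ t ∈ Icc 0 T, EqOn (u t) (U 0 t) Omega ∧ EqOn (qOf u t) (U 1 t) Omega) {t : ℝ}
    (ht : t ∈ Icc 0 T) {i : ℕ} (hi : i ≤ M.N) :
    qTrace fl bc M k i (qError fl M k U qh t) =
      qFlux fl bc M t (qh t) i - U 1 t (M.node i) := by
  rw [← (hEq t ht).2 (M.node_mem_Omega hi)]
  refine (qFlux_sub hbc ht (fun j hj => ?_) hi).symm
  have he := fl.isEnd_qEnd (M.node j) (M.node (j + 1))
  rw [poly_qError hld hU ht hj, eval_sub, qInterp, eval_interp (M.node_lt j hj) hk he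
    (fl.isEnd_uEnd _ _) (hU.continuousOn_cell ht hj (by omega)),
    (hEq t ht).2 (M.Icc_subset_Omega hj (he.mem (M.node_lt j hj).le))]

/-- Subtract the consistency identity for the interpolants from the second equation of the scheme,
cell by cell. The only source is the second correction of q. -/
theorem inner_qError (hk : 2 ≤ k) (hbc : BoundaryCondition fl bc T u)
    (hld : IsLDGSolution fl bc M k T uh qh) (hU : HeatChain (k + 3) B T U)
    (hEq : ∀ t ∈ Icc 0 T, EqOn (u t) (U 0 t) Omega ∧ EqOn (qOf u t) (U 1 t) Omega) {t : ℝ}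
    (ht : t ∈ Icc 0 T) (w : Vh M k) :
    inner ℝ (qError fl M k U qh t) w = form fl bc M k (uError fl M k U uh t) w +
      inner ℝ (Vh.lift (qResidual fl M k fun i => U (i + 1) t)) w := by
  rw [form_apply, Vh.inner_eq, Vh.inner_eq, ← Finset.sum_add_distrib]
  refine Finset.sum_congr rfl fun j hj => ?_
  have hj' := Finset.mem_range.1 hj
  have hw := Vh.natDegree_poly_le j w
  have h1 := hld.q_eq t ht j hj' _ hw
  rw [integral_eval_mul_eval, integral_eval_mul_eval] at h1
  have h2 := polyInt_interp_mul (V := fun i => U i t) (M.node_lt j hj') hk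
    (fl.isEnd_uEnd (M.node j) (M.node (j + 1))) (fl.isEnd_qEnd (M.node j) (M.node (j + 1)))
    (hU.hasDeriv_cell ht hj' (by omega)) (hU.continuousOn_cell ht hj' (by omega)) hw
  rw [cellForm, uTrace_uError hk hbc hld hU hEq ht hj'.le,
    uTrace_uError hk hbc hld hU hEq ht (Nat.succ_le_of_lt hj'), poly_qError hld hU ht hj',
    poly_uError hld hU ht hj', Vh.poly_lift inVh_qResidual hj', sub_mul, sub_mul, map_sub, map_sub,
    qInterp, uInterp, qResidual]
  linear_combination h1 - h2

theorem inVh_timeDeriv_sub (hU : HeatChain (k + 3) B T U) {t : ℝ} (ht : t ∈ Icc 0 T) :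
    InVh M k (fun j => timeDeriv k uh T t j - uInterp fl M k (fun i => U (i + 2) t) j) :=
  (inVh_timeDeriv t).sub ((hU.chain t ht).shift (m := 0) (by omega : 0 + 2 ≤ k + 3)).inVh_uInterp

theorem inner_deriv_uError (hk : 2 ≤ k) (hT : 0 < T) (hbc : BoundaryCondition fl bc T u)
    (hld : IsLDGSolution fl bc M k T uh qh) (hU : HeatChain (k + 3) B T U)
    (hEq : ∀ t ∈ Icc 0 T, EqOn (u t) (U 0 t) Omega ∧ EqOn (qOf u t) (U 1 t) Omega) {t : ℝ}
    (ht : t ∈ Icc 0 T) (v : Vh M k) :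
    inner ℝ (Vh.lift fun j => timeDeriv k uh T t j - uInterp fl M k (fun i => U (i + 2) t) j) v =
      -form fl bc M k v (qError fl M k U qh t) +
        inner ℝ (Vh.lift (uResidual fl M k fun i => U (i + 2) t)) v := by
  have hmem := inVh_timeDeriv_sub (fl := fl) (M := M) (uh := uh) hU ht
  rw [← sum_qForm_eq, Vh.inner_eq, Vh.inner_eq, ← Finset.sum_add_distrib]
  refine Finset.sum_congr rfl fun j hj => ?_
  have hj' := Finset.mem_range.1 hj
  have hv := Vh.natDegree_poly_le j v
  have h1 := hld.u_eq t ht j hj' _ hv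
  simp only [hld.derivWithin_eval hT ht hj'] at h1
  rw [integral_eval_mul_eval, integral_eval_mul_eval] at h1
  have h2 := polyInt_interp_mul (V := fun i => U (i + 1) t) (M.node_lt j hj') hk
    (fl.isEnd_qEnd (M.node j) (M.node (j + 1))) (fl.isEnd_uEnd (M.node j) (M.node (j + 1)))
    (hU.hasDeriv_cell ht hj' (by omega)) (hU.continuousOn_cell ht hj' (by omega)) hv
  rw [qTrace_qError hk hbc hld hU hEq ht hj'.le,
    qTrace_qError hk hbc hld hU hEq ht (Nat.succ_le_of_lt hj'), poly_qError hld hU ht hj',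
    Vh.poly_lift hmem hj', Vh.poly_lift inVh_uResidual hj', sub_mul, sub_mul, map_sub, map_sub,
    qInterp, uInterp, uResidual]
  linear_combination h1 - h2

/-- The size of the residuals. -/
noncomputable def residualBound (k : ℕ) (B h : ℝ) : ℝ :=
  3 * (grBound k * corrBound k * B * h ^ (k + 3))

/-- The errors solve a discrete parabolic problem. -/
theorem exists_parabolicData (hk : 2 ≤ k) (hT : 0 < T) (hc : M.QuasiUniform c)
    (hbc : BoundaryCondition fl bc T u) (hld : IsLDGSolution fl bc M k T uh qh)
    (hinit : SpecialInitial fl M k T u uh) (hU : HeatChain (k + 3) B T U)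
    (hEq : ∀ t ∈ Icc 0 T, EqOn (u t) (U 0 t) Omega ∧ EqOn (qOf u t) (U 1 t) Omega) :
    ∃ (D : Vh M k →L[ℝ] Vh M k) (ρ ρ' r : ℝ → Vh M k), ‖D‖ ≤ formBound k c / M.h ^ 2 ∧
      ParabolicData D T M.h (residualBound k B M.h) (uError fl M k U uh) ρ ρ' r ∧
      ∀ t ∈ Icc 0 T, qError fl M k U qh t = D (uError fl M k U uh t) + r t := by
  have hh := M.h_pos
  have hc0 : 0 ≤ c := zero_le_one.trans (M.one_le_of_quasiUniform hc)
  have hK : 0 ≤ formBound k c / M.h ^ 2 := by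
    unfold formBound
    have := Real.pi_pos
    positivity
  obtain ⟨D, hD, hDK⟩ := exists_riesz (form fl bc M k) hK (abs_form_le hc)
  have hη : ∀ t ∈ Icc 0 T, qError fl M k U qh t = D (uError fl M k U uh t) +
      Vh.lift (qResidual fl M k fun i => U (i + 1) t) := fun t ht =>
    ext_inner_right ℝ fun w => by
      rw [inner_qError hk hbc hld hU hEq ht, inner_add_left, hD]
  refine ⟨D, fun t => Vh.lift (uResidual fl M k fun i => U i t),
    fun t => Vh.lift (uResidual fl M k fun i => U (i + 2) t),
    fun t => Vh.lift (qResidual fl M k fun i => U (i + 1) t), hDK, ?_, hη⟩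
  exact {
    h_pos := hh
    h_le := M.h_le
    deriv_xi := fun t ht => by
      have hmem := inVh_timeDeriv_sub (fl := fl) (M := M) (uh := uh) hU ht
      have h1 := Vh.hasDerivWithinAt_lift
        (p := fun s j => uh s j - uInterp fl M k (fun i => U i s) j)
        (fun s hs => (hld.u_mem s hs).sub (hU.chain s hs).inVh_uInterp) hmem ht
        (fun j hj n => by
          simp only [coeff_sub]
          exact (hld.hasDerivWithinAt_coeff ht hj n).sub
            (hU.hasDerivWithinAt_coeff_interp (by omega) ht (M.node_lt j hj)
              (M.Icc_subset_Omega hj) (fl.isEnd_uEnd _ _) (fl.isEnd_qEnd _ _) n))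
      -- Tested with v, the form with arguments v and η is (Dv, η) = (v, D†η).
      refine h1.congr_deriv (ext_inner_right ℝ fun v => ?_)
      rw [inner_deriv_uError hk hT hbc hld hU hEq ht, ← hη t ht, inner_add_left, inner_neg_left,
        ContinuousLinearMap.adjoint_inner_left,
        real_inner_comm (D v), hD]
    deriv_rho := fun t ht => Vh.hasDerivWithinAt_lift (fun _ _ => inVh_uResidual) inVh_uResidual ht
      fun j hj n => hU.hasDerivWithinAt_coeff_residual (by omega) ht (M.node_lt j hj)
        (M.Icc_subset_Omega hj) (fl.isEnd_uEnd _ _) n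
    rho_le := fun t ht => norm_lift_uResidual_le (hU.chain t ht) (by omega) le_rfl
    -- ρ' contains U 4, which has only k − 1 further derivatives in the chain of length k + 3. This
    -- is the lost power of h.
    rho'_le := fun t ht => by
      have h1 := norm_lift_uResidual_le (fl := fl) (M := M) (k := k)
        ((hU.chain t ht).shift (m := k + 1) (i := 2) (by omega)) (m := k - 1) (by omega) (by omega)
      rw [show k - 1 + 3 = k + 2 by omega] at h1
      refine h1.trans (le_of_eq ?_)
      rw [residualBound, pow_succ M.h (k + 2)]
      field_simp
    r_le := fun t ht => norm_lift_qResidual_le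
      ((hU.chain t ht).shift (m := k + 2) (i := 1) (by omega)) (by omega) le_rfl
    -- The special initial value serves to make ξ(0) = 0; otherwise a further term (ξ(0), z(t))
    -- would have to be bounded.
    xi_zero := Vh.ext fun j hj => by
      have h0 : (0 : ℝ) ∈ Icc 0 T := ⟨le_rfl, hT.le⟩
      rw [poly_uError hld hU h0 hj, hinit j hj, map_zero, uInterp,
        interpCell_eq hT (by omega) hU hEq h0 (M.node_lt j hj) (M.Icc_subset_Omega hj), sub_self] }

end Errors

/-! ### Superconvergence at the Radau points -/

/-- The constant of the error estimates. -/
noncomputable def errorBound (k : ℕ) (c : ℝ) : ℝ :=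
  interpBound k + Vh.invConst k c * (620 * (1 + formBound k c ^ 2) *
    (3 * (grBound k * corrBound k)))

theorem corrBound_nonneg (k : ℕ) : 0 ≤ corrBound k :=
  mul_nonneg (sq_nonneg _) (zero_le_one.trans (one_le_legBound k))

theorem errorBound_pos (k : ℕ) (c : ℝ) : 0 < errorBound k c := by
  have h1 := one_le_grBound k
  have h2 := corrBound_nonneg k
  have h3 := Vh.invConst_nonneg k c
  unfold errorBound interpBound
  positivity

/-- The residual size is h · h^{k+2}, and h · h^{-1/2}(h^{-1/2} + s) = 1 + s√h. It is used with s =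
t for u and s = √t for q. -/
theorem inv_sqrt_mul_le {k : ℕ} {c B h s κ : ℝ} (hh : 0 < h) (hB : 0 ≤ B) (hs : 0 ≤ s)
    (hκ : κ ≤ 620 * (1 + formBound k c ^ 2)) :
    interpBound k * B * h ^ (k + 2) +
      Vh.invConst k c / √h * (κ * residualBound k B h * (1 / √h + s)) ≤
      errorBound k c * (1 + s * √h) * h ^ (k + 2) * B := by
  have h1 := one_le_grBound k
  have h2 := corrBound_nonneg k
  have h3 := Vh.invConst_nonneg k c
  have h4 := Real.sqrt_pos.2 hh
  have h5 : h = √h * √h := (Real.mul_self_sqrt hh.le).symm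
  have e1 : Vh.invConst k c / √h * (κ * residualBound k B h * (1 / √h + s)) =
      Vh.invConst k c * (κ * (3 * (grBound k * corrBound k))) * ((1 + s * √h) * h ^ (k + 2) * B) := by
    rw [residualBound, pow_succ h (k + 2)]
    generalize h ^ (k + 2) = p
    rw [h5, Real.sqrt_mul_self h4.le]
    field_simp
  have h6 : 0 ≤ interpBound k := by unfold interpBound; positivity
  have h7 : interpBound k * B * h ^ (k + 2) ≤ interpBound k * ((1 + s * √h) * h ^ (k + 2) * B) := by
    have : 0 ≤ interpBound k * (s * √h * h ^ (k + 2) * B) := by positivity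
    linarith
  have h8 : Vh.invConst k c * (κ * (3 * (grBound k * corrBound k))) *
      ((1 + s * √h) * h ^ (k + 2) * B) ≤ Vh.invConst k c * (620 * (1 + formBound k c ^ 2) *
        (3 * (grBound k * corrBound k))) * ((1 + s * √h) * h ^ (k + 2) * B) := by gcongr
  rw [e1, errorBound]
  linarith

section Superconvergence

variable {fl : Flux} {bc : Boundary} {M : Mesh} {k : ℕ} {B T c t : ℝ} {u₀ : ℝ → ℝ} {u : ℝ → ℝ → ℝ}
  {uh qh : ℝ → ℕ → ℝ[X]}

theorem abs_error_le (hk : 2 ≤ k) (hT : 0 < T) (hc : M.QuasiUniform c)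
    (hu : IsHeatSolution fl bc T u₀ u) (hB : supSobolevNorm (k + 4) T u < ENNReal.ofReal B)
    (hld : IsLDGSolution fl bc M k T uh qh) (hinit : SpecialInitial fl M k T u uh)
    (ht : t ∈ Icc 0 T) {j : ℕ} (hj : j < M.N) {x : ℝ} (hx : x ∈ Icc (M.node j) (M.node (j + 1))) :
    (legendre (M.node j) (M.node (j + 1)) (k + 1) x -
        fl.sgn * legendre (M.node j) (M.node (j + 1)) k x = 0 →
      |u t x - (uh t j).eval x| ≤ errorBound k c * (1 + t * √M.h) * M.h ^ (k + 2) * B) ∧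
    (legendre (M.node j) (M.node (j + 1)) (k + 1) x -
        -fl.sgn * legendre (M.node j) (M.node (j + 1)) k x = 0 →
      |qOf u t x - (qh t j).eval x| ≤ errorBound k c * (1 + √(t * M.h)) * M.h ^ (k + 2) * B) := by
  obtain ⟨U, hU, hEq⟩ := exists_heatChain (n := k + 3) (by omega) hT hu hB
  obtain ⟨D, ρ, ρ', r, hDK, P, hη⟩ := exists_parabolicData hk hT hc hu.boundary hld hinit hU hEq
  have hV := hU.chain t ht
  have hxO := M.Icc_subset_Omega hj hx
  have hh := M.h_pos
  have hinv : 0 ≤ Vh.invConst k c / √M.h :=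
    div_nonneg (Vh.invConst_nonneg k c) (Real.sqrt_nonneg _)
  constructor
  · intro hR
    have h1 := abs_sub_interp_le (by omega) (hV.shift (m := k + 1) (i := 0) (by omega))
      (M.node_lt j hj) (M.Icc_subset_Omega hj) (M.len_le_h hj) (fl.isEnd_uEnd _ _)
      (fl.isEnd_qEnd _ _) hx hR
    have h2 := Vh.abs_eval_poly_le hc (uError fl M k U uh t) hj hx
    have h3 := P.norm_xi_le ht
    rw [poly_uError hld hU ht hj, eval_sub, abs_sub_comm] at h2
    rw [(hEq t ht).1 hxO]
    refine (abs_sub_le _ ((uInterp fl M k (fun i => U i t) j).eval x) _).trans ?_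
    refine le_trans ?_ (inv_sqrt_mul_le (κ := 14) hh hV.nonneg ht.1
      (by nlinarith [sq_nonneg (formBound k c)]))
    exact add_le_add h1 (h2.trans (mul_le_mul_of_nonneg_left h3 hinv))
  · intro hR
    have h1 := abs_sub_interp_le (by omega) (hV.shift (m := k + 1) (i := 1) (by omega))
      (M.node_lt j hj) (M.Icc_subset_Omega hj) (M.len_le_h hj) (fl.isEnd_qEnd _ _)
      (fl.isEnd_uEnd _ _) hx hR
    have h2 := Vh.abs_eval_poly_le hc (qError fl M k U qh t) hj hx
    have h3 := P.norm_eta_le hDK ht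
    rw [poly_qError hld hU ht hj, eval_sub, abs_sub_comm, hη t ht] at h2
    rw [(hEq t ht).2 hxO, Real.sqrt_mul ht.1]
    refine (abs_sub_le _ ((qInterp fl M k (fun i => U (i + 1) t) j).eval x) _).trans ?_
    refine le_trans ?_ (inv_sqrt_mul_le hh hV.nonneg (Real.sqrt_nonneg t) le_rfl)
    exact add_le_add h1 (h2.trans (mul_le_mul_of_nonneg_left h3 hinv))

/-- The estimates are proved for every B strictly above the norm; the limit B → ‖u‖ from above
covers the norm itself, also when it is zero. -/
theorem le_mul_toReal_of_forall_lt {A : ENNReal} (hA : A ≠ ⊤) {x κ : ℝ}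
    (h : ∀ B : ℝ, A < ENNReal.ofReal B → x ≤ κ * B) : x ≤ κ * A.toReal := by
  have hlim : Tendsto (fun B => κ * B) (𝓝[>] A.toReal) (𝓝 (κ * A.toReal)) :=
    ((continuous_const_mul κ).tendsto _).mono_left nhdsWithin_le_nhds
  refine ge_of_tendsto hlim ?_
  filter_upwards [self_mem_nhdsWithin] with B hB
  exact h B ((ENNReal.lt_ofReal_iff_toReal_lt hA).2 hB)

end Superconvergence

end LDG

theorem theorem4p4 (k : ℕ) (hk : 2 ≤ k) (c : ℝ) :
    ∃ C : ℝ, 0 < C ∧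
      ∀ (fl : LDG.Flux) (bc : LDG.Boundary) (M : LDG.Mesh), M.QuasiUniform c →
      ∀ (T : ℝ), 0 < T →
      ∀ (u₀ : ℝ → ℝ) (u : ℝ → ℝ → ℝ), LDG.IsHeatSolution fl bc T u₀ u →
        LDG.supSobolevNorm (k + 4) T u ≠ ⊤ →
      ∀ (uh qh : ℝ → ℕ → Polynomial ℝ), LDG.IsLDGSolution fl bc M k T uh qh →
        LDG.SpecialInitial fl M k T u uh →
      ∀ t ∈ Set.Icc 0 T, ∀ j < M.N,
        (fl = LDG.Flux.minusPlus →
          (∀ x ∈ LDG.rightRadau k (M.node j) (M.node (j + 1)),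
            |u t x - (uh t j).eval x| ≤
              C * (1 + t * √M.h) * M.h ^ (k + 2) * (LDG.supSobolevNorm (k + 4) T u).toReal) ∧
          (∀ x ∈ LDG.leftRadau k (M.node j) (M.node (j + 1)),
            |LDG.qOf u t x - (qh t j).eval x| ≤
              C * (1 + √(t * M.h)) * M.h ^ (k + 2) * (LDG.supSobolevNorm (k + 4) T u).toReal)) ∧
        (fl = LDG.Flux.plusMinus →
          (∀ x ∈ LDG.leftRadau k (M.node j) (M.node (j + 1)),
            |u t x - (uh t j).eval x| ≤
              C * (1 + t * √M.h) * M.h ^ (k + 2) * (LDG.supSobolevNorm (k + 4) T u).toReal) ∧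
          (∀ x ∈ LDG.rightRadau k (M.node j) (M.node (j + 1)),
            |LDG.qOf u t x - (qh t j).eval x| ≤
              C * (1 + √(t * M.h)) * M.h ^ (k + 2) * (LDG.supSobolevNorm (k + 4) T u).toReal)) := by
  refine ⟨LDG.errorBound k c, LDG.errorBound_pos k c, ?_⟩
  intro fl bc M hc T hT u₀ u hu hA uh qh hld hinit t ht j hj
  have key := fun x hx B hB => LDG.abs_error_le hk hT hc hu (B := B) hB hld hinit ht hj (x := x) hx
  refine ⟨?_, ?_⟩ <;> rintro rfl <;> refine ⟨?_, ?_⟩ <;> rintro x ⟨hx, hR, -⟩ <;>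
    refine LDG.le_mul_toReal_of_forall_lt hA fun B hB => ?_
  · exact (key x hx B hB).1 (by rw [LDG.Flux.sgn]; linarith)
  · exact (key x hx B hB).2 (by rw [LDG.Flux.sgn]; linarith)
  · exact (key x hx B hB).1 (by rw [LDG.Flux.sgn]; linarith)
  · exact (key x hx B hB).2 (by rw [LDG.Flux.sgn]; linarith)
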